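/- **Setting.** Let $U$ be a Hopf $*$-algebra over $\mathbb{C}$ (with antipode $S$) and let $\mathcal F$ be a collection of finite-dimensional unital $*$-representations $\hat\pi$ of $U$ on Hilbert spaces such that for each $\hat\pi\in\mathcal F$ there is an invertible positive operator $T$ with $\hat\pi(S^2(x))=T\hat\pi(x)T^{-1}$ for all $x\in U$. Let $A\subseteq \mathrm{Lin}(U,\mathbb{C})$ be the unital $*$-algebra generated by the matrix coefficients $x\mapsto\langle\xi,\hat\pi(x)\eta\rangle$, $\hat\pi\in\mathcal F$, for the convolution product and the $*$-structure $a^*(x)=\overline{a(S(x)^*)}$, with coproduct $\Delta_A$ dual to the product of $U$; write $\tau$ for the pairing of $A$ and $U$. Let $I\subseteq U$ be a unital $*$-subalgebra with $\Delta(I)\subseteq U\otimes I$ (a left coideal $*$-subalgebra), and write $x_{(-1)}\otimes x_{(0)}$ for the coproduct of $x\in I$. Let $\pi_C:A\twoheadrightarrow C$ be the coimage of the restriction map $A\to\mathrm{Lin}(I,\mathbb{C})$, with its quotient coalgebra structure, its left $A$-module structure, and the $\dagger$-structure $\pi_C(a)^\dagger=\pi_C(S_A(a)^*)$. Let $B=\{b\in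 A\mid(\pi_C\otimes\mathrm{id})\Delta_A(b)=\pi_C(1)\otimes b\}$, a $*$-subalgebra of $A$ with $\Delta_A(B)\subseteq B\otimes A$, and write $b_{(0)}\otimes b_{(1)}=\Delta_A(b)$ for $b\in B$. * $D(B,I)$ is the universal unital $*$-algebra generated by copies of $B$ and $I$ with $xb=\tau(b_{(1)},x_{(-1)})\,b_{(0)}x_{(0)}$ for $x\in I$, $b\in B$. * $\mathscr I=\mathrm{Lin}(C,\mathbb{C})$ is the full dual of $C$, with the convolution product, $\omega^*(c)=\overline{\omega(c^\dagger)}$, and the right $A$-action $(x\lhd a)(c)=x(ac)$; $\mathcal I=\{x\in\mathscr I\mid \mathscr I x\mathscr I\text{ is finite-dimensional}\}$ is its restricted dual. $\mathscr D(B,\mathscr I)$ is the universal unital $*$-algebra generated by copies of $B$ and $\mathscr I$ with $xb=b_{(0)}(x\lhd b_{(1)})$, and $\mathcal D(B,\mathcal I)$ is its $*$-subalgebra $B\mathcal I$. * A $*$-representation of $U$ on a pre-Hilbert space is of *$\mathcal F$-type* if every cyclic subspace is finite-dimensional, with all its matrix coefficients in $A$. A $*$-representation of $I$ on a pre-Hilbert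 space is of *$\mathcal F$-type* if every cyclic subspace is finite-dimensional and isomorphic to an $I$-subrepresentation of an $\mathcal F$-type $*$-representation of $U$. A $*$-representation $\theta_0$ of $D(B,I)$ on a pre-Hilbert space $H_0$ is of *$\mathcal F$-type* if its restriction to $I$ is; it is then *admissible* if each irreducible $I$-subrepresentation $W$ of $H_0$ has finite multiplicity, i.e. the space of $I$-intertwiners $W\to H_0$ is finite-dimensional. * For $\theta_0$ of $\mathcal F$-type there is a unique right $C$-comodule structure $\delta:H_0\to H_0\otimes C$ with $\theta_0(x)\xi=(\mathrm{id}\otimes\tau(-,x))\delta(\xi)$ for $x\in I$, $\xi\in H_0$; put $\hat\pi(x)\xi=(\mathrm{id}\otimes x)\delta(\xi)$ for $x\in\mathscr I$. **Proposition.** Let $(H_0,\theta_0)$ be an admissible $\mathcal F$-type $*$-representation of $D(B,I)$, and let $H$ be the Hilbert space completion of $H_0$. Then there is a unique $*$-representation $\theta$ of $\mathcal D(B,\mathcal I)$ by bounded operators on $H$ with $\theta(bx)\xi=\theta_0(b)\hat\pi(x)\xi$ for all $b\in B$, $x\in\mathcal I$, $\xi\in H_0$, and $\theta$ is irreducible (that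 is, $H\neq0$ and $H$ has no closed $\mathcal D(B,\mathcal I)$-stable subspaces other than $0$ and $H$) if and only if $H_0$ is irreducible (simple) as a $D(B,I)$-module. -/

import Mathlib

open scoped TensorProduct ComplexConjugate InnerProductSpace

namespace DrinfeldCoideal

open Coalgebra HopfAlgebra WithConv

universe u v w

set_option linter.unusedSectionVars false
set_option linter.unusedVariables false

section Pairing

variable {R X : Type*} [Ring R] [Algebra ℂ R] [AddCommMonoid X] [Module ℂ X]
  (τ : X →ₗ[ℂ] Module.Dual ℂ R)

/-- The slice map `id ⊗ τ(-, u) : V ⊗ X → V`. -/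
noncomputable def slice {V : Type*} [AddCommMonoid V] [Module ℂ V] (u : R) : V ⊗[ℂ] X →ₗ[ℂ] V :=
  (TensorProduct.rid ℂ V).toLinearMap ∘ₗ (τ.flip u).lTensor V

@[simp] lemma slice_tmul {V : Type*} [AddCommMonoid V] [Module ℂ V] (u : R) (v : V) (f : X) :
    slice τ u (v ⊗ₜ[ℂ] f) = τ f u • v := by
  simp [slice]

variable {τ}

lemma slice_ext (hτ : Function.Injective τ) {V : Type*} [AddCommMonoid V] [Module ℂ V]
    {z w : V ⊗[ℂ] X} (h : ∀ u, slice τ u z = slice τ u w) : z = w := by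
  classical
  let _ : AddCommGroup V := Module.addCommMonoidToAddCommGroup ℂ
  let b := Module.Basis.ofVectorSpace ℂ V
  have h1 : ∀ (z : V ⊗[ℂ] X) i u, τ (TensorProduct.equivFinsuppOfBasisLeft (N := X) b z i) u
      = b.coord i (slice τ u z) := by
    intro z i u
    induction z with
    | zero => simp
    | add x y hx hy => simp [hx, hy]
    | tmul v f => simp [mul_comm]
  apply (TensorProduct.equivFinsuppOfBasisLeft (N := X) b).injective
  ext i
  apply hτ
  ext u
  rw [h1, h1, h]

lemma comul_pairing_unique (hτ : Function.Injective τ) {z w : X ⊗[ℂ] X}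
    (h : ∀ x y, τ (slice τ y z) x = τ (slice τ y w) x) : z = w :=
  slice_ext hτ fun y => hτ (LinearMap.ext fun x => h x y)

variable (τ)

/-- The coproduct on a space of functionals on an algebra `R` which is dual to the product of `R`,
that is `τ (Δ f, x ⊗ y) = τ (f, x y)`. -/
noncomputable def dualComul (hτ : Function.Injective τ)
    (hmul : ∀ f, ∃ z : X ⊗[ℂ] X, ∀ x y, τ (slice τ y z) x = τ f (x * y)) : X →ₗ[ℂ] X ⊗[ℂ] X where
  toFun f := (hmul f).choose
  map_add' f g := by
    apply comul_pairing_unique hτ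
    intro x y
    rw [(hmul (f + g)).choose_spec]
    simp [(hmul f).choose_spec, (hmul g).choose_spec]
  map_smul' c f := by
    apply comul_pairing_unique hτ
    intro x y
    rw [(hmul (c • f)).choose_spec]
    simp [(hmul f).choose_spec]

lemma dualComul_spec (hτ : Function.Injective τ)
    (hmul : ∀ f, ∃ z : X ⊗[ℂ] X, ∀ x y, τ (slice τ y z) x = τ f (x * y)) (f : X) (x y : R) :
    τ (slice τ y (dualComul τ hτ hmul f)) x = τ f (x * y) :=
  (hmul f).choose_spec x y

/-- The coalgebra structure on a space of functionals on an algebra `R` which is dual to the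
algebra structure of `R`. -/
@[reducible] noncomputable def dualCoalgebra (hτ : Function.Injective τ)
    (hmul : ∀ f, ∃ z : X ⊗[ℂ] X, ∀ x y, τ (slice τ y z) x = τ f (x * y)) : Coalgebra ℂ X where
  comul := dualComul τ hτ hmul
  counit := τ.flip 1
  coassoc := by
    have h1 : ∀ (w : X ⊗[ℂ] X) (y z : R),
        slice τ y (slice τ z ((TensorProduct.assoc ℂ X X X).symm
          ((dualComul τ hτ hmul).lTensor X w))) = slice τ (y * z) w := by
      intro w y z
      induction w with
      | zero => simp
      | add a b ha hb => simp only [map_add, ha, hb]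
      | tmul f g =>
        have h2 : ∀ t : X ⊗[ℂ] X, slice τ y (slice τ z ((TensorProduct.assoc ℂ X X X).symm
          (f ⊗ₜ t))) = τ (slice τ z t) y • f := by
          intro t
          induction t with
          | zero => simp
          | add a b ha hb => simp only [map_add, TensorProduct.tmul_add, ha, hb, add_smul,
              LinearMap.add_apply]
          | tmul a b => simp [mul_smul]
        simp [h2, dualComul_spec]
    have h3 : ∀ (w : X ⊗[ℂ] X) (z : R), slice τ z ((dualComul τ hτ hmul).rTensor X w)
        = dualComul τ hτ hmul (slice τ z w) := by
      intro w z
      induction w with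
      | zero => simp
      | add a b ha hb => simp only [map_add, ha, hb]
      | tmul f g => simp
    apply LinearMap.ext
    intro f
    apply (TensorProduct.assoc ℂ X X X).symm.injective
    apply slice_ext hτ
    intro z
    apply comul_pairing_unique hτ
    intro x y
    simp only [LinearMap.comp_apply, LinearEquiv.coe_coe, LinearEquiv.symm_apply_apply]
    rw [h1, h3, dualComul_spec, dualComul_spec, dualComul_spec, mul_assoc]
  rTensor_counit_comp_comul := by
    apply LinearMap.ext
    intro f
    apply (TensorProduct.lid ℂ X).injective
    apply hτ
    ext x
    have h1 : ∀ w : X ⊗[ℂ] X, τ ((TensorProduct.lid ℂ X) ((τ.flip 1).rTensor X w)) x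
        = τ (slice τ x w) 1 := by
      intro w
      induction w with
      | zero => simp
      | add a b ha hb => simp only [map_add, ha, hb, LinearMap.add_apply]
      | tmul f g => simp [mul_comm]
    simp only [LinearMap.comp_apply]
    rw [h1, dualComul_spec]
    simp
  lTensor_counit_comp_comul := by
    apply LinearMap.ext
    intro f
    apply (TensorProduct.rid ℂ X).injective
    apply hτ
    ext x
    have h1 : ∀ w : X ⊗[ℂ] X, ((TensorProduct.rid ℂ X) ((τ.flip 1).lTensor X w))
        = (slice τ 1 w)  := by
      intro w
      induction w with
      | zero => simp
      | add a b ha hb => simp only [map_add, ha, hb]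
      | tmul f g => simp
    simp only [LinearMap.comp_apply]
    rw [h1, dualComul_spec]
    simp

end Pairing

section HopfStar

/-- A Hopf `*`-algebra: a complex Hopf algebra with a `*`-algebra structure for which the coproduct
is `*`-preserving. -/
class HopfStarAlgebra (U : Type*) [Ring U] [HopfAlgebra ℂ U] [StarRing U] [StarModule ℂ U] :
    Prop where
  comul_star : ∀ x : U, comul (R := ℂ) (star x) = star (comul (R := ℂ) x)

variable {U : Type*} [Ring U] [HopfAlgebra ℂ U] [StarRing U] [StarModule ℂ U]

/-- The `*`-operation `f*(x) = conj (f (S(x)*))` on functionals on a Hopf `*`-algebra. -/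
noncomputable def dualStar (f : WithConv (U →ₗ[ℂ] ℂ)) : WithConv (U →ₗ[ℂ] ℂ) :=
  toConv ((star f).ofConv ∘ₗ antipode ℂ)

@[simp] lemma dualStar_apply (f : WithConv (U →ₗ[ℂ] ℂ)) (x : U) :
    dualStar f x = conj (f (star (antipode ℂ x))) := rfl

lemma dualStar_add (f g : WithConv (U →ₗ[ℂ] ℂ)) :
    dualStar (f + g) = dualStar f + dualStar g := by
  ext x
  change dualStar (f + g) x = dualStar f x + dualStar g x
  simp

lemma dualStar_smul (c : ℂ) (f : WithConv (U →ₗ[ℂ] ℂ)) :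
    dualStar (c • f) = conj c • dualStar f := by
  ext x
  change dualStar (c • f) x = conj c * dualStar f x
  simp

/-- The adjoint of a Sweedler representation. -/
def reprStar [HopfStarAlgebra U] {x : U} {ι : Type*} (r : Coalgebra.Repr ℂ x ι) :
    Coalgebra.Repr ℂ (star x) ι where
  index := r.index
  left i := star (r.left i)
  right i := star (r.right i)
  eq := by
    rw [HopfStarAlgebra.comul_star, ← r.eq, star_sum]
    simp

lemma star_algebraMap' (c : ℂ) : star (algebraMap ℂ U c) = algebraMap ℂ U (conj c) := by
  simp [Algebra.algebraMap_eq_smul_one]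

variable [HopfStarAlgebra U]

lemma counit_star (x : U) : counit (R := ℂ) (star x) = conj (counit (R := ℂ) x) := by
  have h : (star (toConv (counit (R := ℂ) (A := U)))) = 1 := by
    have h2 : ∀ f g : WithConv (U →ₗ[ℂ] ℂ), star (f * g) = star f * star g := by
      intro f g
      ext x
      change conj ((f * g) (star x)) = _
      rw [(ℛ ℂ x).convMul_apply, (reprStar (ℛ ℂ x)).convMul_apply]
      simp [reprStar]
    change star (1 : WithConv (U →ₗ[ℂ] ℂ)) = 1
    have h3 := h2 (star 1) 1
    rw [mul_one, star_star, one_mul] at h3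
    exact h3.symm
  have := congrArg (fun f : WithConv (U →ₗ[ℂ] ℂ) => f (star x)) h
  have h4 : conj (counit (R := ℂ) (star (star x))) = counit (R := ℂ) (star x) := this
  rw [star_star] at h4
  exact h4.symm

lemma antipode_star_antipode_star (x : U) : antipode ℂ (star (antipode ℂ (star x))) = x := by
  let T : U →ₗ[ℂ] U := (star (toConv (antipode ℂ (A := U)))).ofConv
  have hT : ∀ x, T x = star (antipode ℂ (star x)) := fun x => rfl
  have h1 : toConv (antipode ℂ (A := U)) * toConv (antipode ℂ ∘ₗ T) = 1 := by
    ext x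
    rw [(ℛ ℂ x).convMul_apply]
    simp only [LinearMap.comp_apply, ← antipode_mul_antidistrib, ← map_sum, hT]
    have : ∑ i ∈ (ℛ ℂ x).index, star (antipode ℂ (star ((ℛ ℂ x).right i))) * (ℛ ℂ x).left i
        = star (∑ i ∈ (reprStar (ℛ ℂ x)).index, (reprStar (ℛ ℂ x)).left i *
          antipode ℂ ((reprStar (ℛ ℂ x)).right i)) := by
      simp [reprStar]
    rw [this, sum_mul_antipode_eq_algebraMap_counit, star_algebraMap', counit_star]
    simp [Algebra.algebraMap_eq_smul_one]
  have h2 : toConv (LinearMap.id (R := ℂ) (M := U)) = toConv (antipode ℂ ∘ₗ T) := by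
    rw [← one_mul (toConv (antipode ℂ ∘ₗ T)), ← LinearMap.id_mul_antipode, mul_assoc, h1, mul_one]
  exact (congrArg (fun f : WithConv (U →ₗ[ℂ] U) => f x) h2).symm

lemma star_antipode_star_antipode (x : U) : star (antipode ℂ (star (antipode ℂ x))) = x := by
  have h := antipode_star_antipode_star (star x)
  rw [star_star] at h
  rw [h, star_star]

end HopfStar

section AntipodeComul

variable {U : Type*} [Ring U] [HopfAlgebra ℂ U]

/-- The map `x ↦ S(x₍₂₎) ⊗ S(x₍₁₎)`. -/
noncomputable def antipodeSwap : U →ₗ[ℂ] U ⊗[ℂ] U :=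
  TensorProduct.map (antipode ℂ) (antipode ℂ) ∘ₗ (TensorProduct.comm ℂ U U).toLinearMap ∘ₗ comul

lemma antipodeSwap_apply (x : U) {ι : Type*} (r : Coalgebra.Repr ℂ x ι) :
    antipodeSwap x = ∑ i ∈ r.index, antipode ℂ (r.right i) ⊗ₜ[ℂ] antipode ℂ (r.left i) := by
  simp [antipodeSwap, ← r.eq]

lemma antipodeSwap_aux (y : U) {ι : Type*} (r : Coalgebra.Repr ℂ y ι) :
    ∑ j ∈ r.index, ((1 : U) ⊗ₜ[ℂ] r.left j) * antipodeSwap (r.right j)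
      = antipode ℂ y ⊗ₜ[ℂ] (1 : U) := by
  let χ : (U ⊗[ℂ] U) ⊗[ℂ] U →ₗ[ℂ] U ⊗[ℂ] U :=
    (TensorProduct.comm ℂ U U).toLinearMap ∘ₗ
      TensorProduct.map (LinearMap.mul' ℂ U ∘ₗ (antipode ℂ).lTensor U) (antipode ℂ)
  have h1 : ∀ a (w : U ⊗[ℂ] U), (χ ∘ₗ (TensorProduct.assoc ℂ U U U).symm.toLinearMap) (a ⊗ₜ w)
      = ((1 : U) ⊗ₜ[ℂ] a) * (TensorProduct.map (antipode ℂ) (antipode ℂ)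
        (TensorProduct.comm ℂ U U w)) := by
    intro a w
    induction w with
    | zero => simp
    | add a b ha hb => simp only [TensorProduct.tmul_add, map_add, ha, hb, mul_add]
    | tmul b c => simp [χ]
  have h2 : ∀ w : U ⊗[ℂ] U, χ (comul.rTensor U w) =
      (antipode ℂ).rTensor U (TensorProduct.comm ℂ U U
        ((Algebra.linearMap ℂ U ∘ₗ counit).rTensor U w)) := by
    intro w
    induction w with
    | zero => simp
    | add a b ha hb => simp only [map_add, ha, hb]
    | tmul b c => simp [χ]
  have h3 : χ (comul.rTensor U (comul (R := ℂ) y)) = ∑ j ∈ r.index,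
      ((1 : U) ⊗ₜ[ℂ] r.left j) * antipodeSwap (r.right j) := by
    rw [← coassoc_symm_apply, ← r.eq]
    simp only [map_sum, LinearMap.lTensor_tmul]
    exact Finset.sum_congr rfl fun i _ => h1 _ _
  rw [← h3, h2, LinearMap.rTensor_comp_apply, rTensor_counit_comul]
  simp

lemma comul_mul_antipodeSwap (x : U) {ι : Type*} (r : Coalgebra.Repr ℂ x ι) :
    ∑ j ∈ r.index, comul (R := ℂ) (r.left j) * antipodeSwap (r.right j)
      = algebraMap ℂ _ (counit (R := ℂ) x) := by
  let χ : (U ⊗[ℂ] U) ⊗[ℂ] U →ₗ[ℂ] U ⊗[ℂ] U :=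
    LinearMap.mul' ℂ (U ⊗[ℂ] U) ∘ₗ antipodeSwap.lTensor (U ⊗[ℂ] U)
  have h1 : ∀ a b, (χ ∘ₗ (TensorProduct.assoc ℂ U U U).symm.toLinearMap) (a ⊗ₜ comul b)
      = (a * antipode ℂ b) ⊗ₜ[ℂ] (1 : U) := by
    intro a b
    have := congrArg (fun t => (a ⊗ₜ[ℂ] (1 : U)) * t) (antipodeSwap_aux b (ℛ ℂ b))
    simp only [Finset.mul_sum, ← mul_assoc, Algebra.TensorProduct.tmul_mul_tmul, mul_one,
      one_mul] at this
    rw [← this, ← (ℛ ℂ b).eq]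
    simp [χ, TensorProduct.tmul_sum]
  have h3 : χ (comul.rTensor U (comul (R := ℂ) x)) = ∑ j ∈ r.index,
      comul (R := ℂ) (r.left j) * antipodeSwap (r.right j) := by
    rw [← r.eq]
    simp [χ]
  have h4 : χ (comul.rTensor U (comul (R := ℂ) x)) = ∑ j ∈ r.index,
      (r.left j * antipode ℂ (r.right j)) ⊗ₜ[ℂ] (1 : U) := by
    rw [← coassoc_symm_apply, ← r.eq]
    simp only [map_sum, LinearMap.lTensor_tmul]
    exact Finset.sum_congr rfl fun i _ => h1 _ _
  rw [← h3, h4, ← TensorProduct.sum_tmul, sum_mul_antipode_eq_algebraMap_counit]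
  rfl

lemma comul_antipode (x : U) : comul (R := ℂ) (antipode ℂ x) = antipodeSwap x := by
  have h1 : toConv (comul (R := ℂ) (A := U)) * toConv (antipodeSwap (U := U)) = 1 := by
    ext x
    rw [(ℛ ℂ x).convMul_apply]
    exact comul_mul_antipodeSwap x _
  have h2 : toConv (comul (R := ℂ) (A := U) ∘ₗ antipode ℂ) * toConv (comul (R := ℂ) (A := U)) = 1 := by
    ext x
    rw [(ℛ ℂ x).convMul_apply]
    simp only [LinearMap.comp_apply, ← Bialgebra.comul_mul, ← map_sum]
    rw [sum_antipode_mul_eq_algebraMap_counit]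
    simp
  have h3 := left_inv_eq_right_inv h2 h1
  exact congrArg (fun f : WithConv (U →ₗ[ℂ] U ⊗[ℂ] U) => f x) h3

/-- A Sweedler representation of the antipode of an element. -/
noncomputable def reprAntipode {x : U} {ι : Type*} (r : Coalgebra.Repr ℂ x ι) :
    Coalgebra.Repr ℂ (antipode ℂ x) ι where
  index := r.index
  left i := antipode ℂ (r.right i)
  right i := antipode ℂ (r.left i)
  eq := by rw [comul_antipode, antipodeSwap_apply x r]

end AntipodeComul

section DualStar

variable {U : Type*} [Ring U] [HopfAlgebra ℂ U] [StarRing U] [StarModule ℂ U] [HopfStarAlgebra U]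

lemma dualStar_mul (f g : WithConv (U →ₗ[ℂ] ℂ)) :
    dualStar (f * g) = dualStar g * dualStar f := by
  ext x
  change dualStar (f * g) x = (dualStar g * dualStar f) x
  rw [(ℛ ℂ x).convMul_apply, dualStar_apply,
    (reprStar (reprAntipode (ℛ ℂ x))).convMul_apply]
  simp [reprStar, reprAntipode, mul_comm]

lemma dualStar_dualStar (f : WithConv (U →ₗ[ℂ] ℂ)) : dualStar (dualStar f) = f := by
  ext x
  change dualStar (dualStar f) x = f x
  simp [star_antipode_star_antipode]

lemma dualStar_one : dualStar (1 : WithConv (U →ₗ[ℂ] ℂ)) = 1 := by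
  ext x
  change dualStar (1 : WithConv (U →ₗ[ℂ] ℂ)) x = (1 : WithConv (U →ₗ[ℂ] ℂ)) x
  simp [counit_star]

end DualStar

section StarRep

/-- A (unital) `*`-representation of a unital `*`-algebra `R` on a pre-Hilbert space `H`. -/
structure StarRep (R : Type*) [Ring R] [Algebra ℂ R] [StarRing R]
    (H : Type*) [NormedAddCommGroup H] [InnerProductSpace ℂ H] where
  toAlgHom : R →ₐ[ℂ] Module.End ℂ H
  inner_star : ∀ (x : R) (v w : H), ⟪v, toAlgHom x w⟫_ℂ = ⟪toAlgHom (star x) v, w⟫_ℂ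

variable {R : Type*} [Ring R] [Algebra ℂ R] [StarRing R]
  {H : Type*} [NormedAddCommGroup H] [InnerProductSpace ℂ H]

namespace StarRep

instance : CoeFun (StarRep R H) (fun _ => R → Module.End ℂ H) := ⟨fun π => π.toAlgHom⟩

/-- The cyclic subspace `π(R)ξ`. -/
def cyclic (π : StarRep R H) (ξ : H) : Submodule ℂ H :=
  LinearMap.range ((LinearMap.applyₗ ξ) ∘ₗ π.toAlgHom.toLinearMap)

/-- The matrix coefficient `x ↦ ⟨ξ, π(x)η⟩`. -/
noncomputable def coeff (π : StarRep R H) (ξ η : H) : WithConv (R →ₗ[ℂ] ℂ) :=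
  toConv ((innerSL ℂ ξ).toLinearMap ∘ₗ (LinearMap.applyₗ η) ∘ₗ π.toAlgHom.toLinearMap)

@[simp] lemma coeff_apply (π : StarRep R H) (ξ η : H) (x : R) : π.coeff ξ η x = ⟪ξ, π x η⟫_ℂ := rfl

lemma mem_cyclic {π : StarRep R H} {ξ v : H} : v ∈ π.cyclic ξ ↔ ∃ x, π x ξ = v := Iff.rfl

lemma map_mem_cyclic (π : StarRep R H) {ξ v : H} (x : R) (hv : v ∈ π.cyclic ξ) :
    π x v ∈ π.cyclic ξ := by
  obtain ⟨y, rfl⟩ := hv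
  exact ⟨x * y, by simp⟩

lemma self_mem_cyclic (π : StarRep R H) (ξ : H) : ξ ∈ π.cyclic ξ := ⟨1, by simp⟩

end StarRep

end StarRep

set_option linter.checkUnivs false in
/-- A collection of finite-dimensional unital `*`-representations of a Hopf `*`-algebra `U`, each of
which is compatible with the square of the antipode: there is an invertible positive operator `T`
with `π(S²(x)) = T π(x) T⁻¹`. -/
structure RepFamily (U : Type u) [Ring U] [HopfAlgebra ℂ U] [StarRing U] where
  ι : Type v
  space : ι → Type w
  [normed : ∀ i, NormedAddCommGroup (space i)]
  [innerProd : ∀ i, InnerProductSpace ℂ (space i)]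
  [finDim : ∀ i, FiniteDimensional ℂ (space i)]
  rep : ∀ i, StarRep U (space i)
  antipodeSq_compatible : ∀ i, ∃ T : (Module.End ℂ (space i))ˣ,
    (T : Module.End ℂ (space i)).IsPositive ∧
      ∀ x, rep i (antipode ℂ (antipode ℂ x)) = (T : Module.End ℂ (space i)) * rep i x * ↑(T⁻¹)

namespace RepFamily

attribute [instance] normed innerProd finDim

variable {U : Type u} [Ring U] [HopfAlgebra ℂ U] [StarRing U] [StarModule ℂ U]
  (F : RepFamily.{u, v, w} U)

/-- The matrix coefficients of the representations in the collection. -/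
def coeffs : Set (WithConv (U →ₗ[ℂ] ℂ)) := {f | ∃ i ξ η, f = (F.rep i).coeff ξ η}

/-- The unital `*`-algebra `A` generated by the matrix coefficients, inside the linear dual of `U`
with the convolution product and the `*`-structure `dualStar`. -/
noncomputable def matAlg : Subalgebra ℂ (WithConv (U →ₗ[ℂ] ℂ)) :=
  sInf {S | F.coeffs ⊆ S ∧ ∀ f ∈ S, dualStar f ∈ S}

lemma coeff_mem (i : F.ι) (ξ η : F.space i) : (F.rep i).coeff ξ η ∈ F.matAlg := by
  rw [matAlg, Algebra.mem_sInf]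
  exact fun S hS => hS.1 ⟨i, ξ, η, rfl⟩

lemma dualStar_mem {f : WithConv (U →ₗ[ℂ] ℂ)} (hf : f ∈ F.matAlg) : dualStar f ∈ F.matAlg := by
  rw [matAlg, Algebra.mem_sInf] at hf ⊢
  exact fun S hS => hS.2 f (hf S hS)

variable [HopfStarAlgebra U]

/-- The underlying type of the `*`-algebra `A`. -/
def Alg : Type _ := F.matAlg

noncomputable instance : Ring F.Alg := inferInstanceAs (Ring F.matAlg)

noncomputable instance : Algebra ℂ F.Alg := inferInstanceAs (Algebra ℂ F.matAlg)

/-- The inclusion of `A` in the convolution algebra of all functionals on `U`. -/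
noncomputable def val : F.Alg →ₐ[ℂ] WithConv (U →ₗ[ℂ] ℂ) := F.matAlg.val

/-- A functional in the generated `*`-algebra, as an element of `A`. -/
def ofMem (f : WithConv (U →ₗ[ℂ] ℂ)) (hf : f ∈ F.matAlg) : F.Alg := ⟨f, hf⟩

@[simp] lemma val_ofMem (f : WithConv (U →ₗ[ℂ] ℂ)) (hf : f ∈ F.matAlg) : F.val (F.ofMem f hf) = f := rfl

lemma val_mem (a : F.Alg) : F.val a ∈ F.matAlg := a.2

lemma val_injective : Function.Injective F.val := Subtype.val_injective

noncomputable instance : Star F.Alg := ⟨fun a => F.ofMem (dualStar (F.val a)) (F.dualStar_mem (F.val_mem a))⟩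

@[simp] lemma val_star (a : F.Alg) : F.val (star a) = dualStar (F.val a) := rfl

noncomputable instance : StarRing F.Alg where
  star_involutive a := F.val_injective (by simp [dualStar_dualStar])
  star_mul a b := F.val_injective (by simp [dualStar_mul])
  star_add a b := F.val_injective (by simp [dualStar_add])

instance : StarModule ℂ F.Alg where
  star_smul c a := F.val_injective (by simp [dualStar_smul])

/-- Induction over the elements of `A`. -/
lemma matAlg_induction {P : WithConv (U →ₗ[ℂ] ℂ) → Prop}
    (hcoeff : ∀ i ξ η, P ((F.rep i).coeff ξ η))
    (halg : ∀ c : ℂ, P (algebraMap ℂ _ c))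
    (hadd : ∀ f g, f ∈ F.matAlg → g ∈ F.matAlg → P f → P g → P (f + g))
    (hmul : ∀ f g, f ∈ F.matAlg → g ∈ F.matAlg → P f → P g → P (f * g))
    (hstar : ∀ f, f ∈ F.matAlg → P f → P (dualStar f))
    {f : WithConv (U →ₗ[ℂ] ℂ)} (hf : f ∈ F.matAlg) : P f := by
  let S : Subalgebra ℂ (WithConv (U →ₗ[ℂ] ℂ)) :=
    { carrier := {f | f ∈ F.matAlg ∧ P f}
      mul_mem' := fun ha hb => ⟨mul_mem ha.1 hb.1, hmul _ _ ha.1 hb.1 ha.2 hb.2⟩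
      add_mem' := fun ha hb => ⟨add_mem ha.1 hb.1, hadd _ _ ha.1 hb.1 ha.2 hb.2⟩
      algebraMap_mem' := fun c => ⟨Subalgebra.algebraMap_mem _ _, halg c⟩ }
  have hS : F.matAlg ≤ S := by
    apply sInf_le
    refine ⟨?_, fun f hf => ⟨F.dualStar_mem hf.1, hstar _ hf.1 hf.2⟩⟩
    rintro _ ⟨i, ξ, η, rfl⟩
    exact ⟨F.coeff_mem i ξ η, hcoeff i ξ η⟩
  exact (hS hf).2

/-- The pairing `τ` between `A` and `U`. -/
noncomputable def pair : F.Alg →ₗ[ℂ] Module.Dual ℂ U :=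
  (WithConv.linearEquiv ℂ (U →ₗ[ℂ] ℂ)).toLinearMap ∘ₗ F.val.toLinearMap

@[simp] lemma pair_apply (a : F.Alg) (x : U) : F.pair a x = F.val a x := rfl

lemma pair_injective : Function.Injective F.pair := by
  intro a b h
  exact F.val_injective (WithConv.ext h)

lemma pair_mul (a b : F.Alg) (x : U) {ι : Type*} (r : Coalgebra.Repr ℂ x ι) :
    F.pair (a * b) x = ∑ i ∈ r.index, F.pair a (r.left i) * F.pair b (r.right i) :=
  r.convMul_apply _ _

lemma pair_one (x : U) : F.pair 1 x = counit (R := ℂ) x := rfl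

lemma pair_star (a : F.Alg) (x : U) : F.pair (star a) x = conj (F.pair a (star (antipode ℂ x))) :=
  rfl

lemma slice_mul (z w : F.Alg ⊗[ℂ] F.Alg) (x y : U) {ι κ : Type*} (r : Coalgebra.Repr ℂ x ι)
    (s : Coalgebra.Repr ℂ y κ) : F.pair (slice F.pair y (z * w)) x =
      ∑ i ∈ r.index, ∑ j ∈ s.index, F.pair (slice F.pair (s.left j) z) (r.left i) *
        F.pair (slice F.pair (s.right j) w) (r.right i) := by
  induction z with
  | zero => simp
  | add a b ha hb => simp only [add_mul, map_add, ha, hb, LinearMap.add_apply, Finset.sum_add_distrib]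
  | tmul a b =>
    induction w with
    | zero => simp
    | add a b ha hb =>
      simp only [mul_add, map_add, ha, hb, LinearMap.add_apply, Finset.sum_add_distrib]
    | tmul c d =>
      simp only [Algebra.TensorProduct.tmul_mul_tmul, slice_tmul, map_smul, LinearMap.smul_apply,
        smul_eq_mul]
      rw [F.pair_mul a c x r, F.pair_mul b d y s, Finset.sum_mul_sum, Finset.sum_comm]
      exact Finset.sum_congr rfl fun i _ => Finset.sum_congr rfl fun j _ => by ring

lemma slice_star (z : F.Alg ⊗[ℂ] F.Alg) (x y : U) : F.pair (slice F.pair y (star z)) x =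
    conj (F.pair (slice F.pair (star (antipode ℂ y)) z) (star (antipode ℂ x))) := by
  induction z with
  | zero => simp
  | add a b ha hb => simp only [star_add, map_add, ha, hb, LinearMap.add_apply]
  | tmul a b => simp

lemma exists_comul (a : F.Alg) : ∃ z : F.Alg ⊗[ℂ] F.Alg, ∀ x y,
    F.pair (slice F.pair y z) x = F.pair a (x * y) := by
  obtain ⟨a, ha⟩ : ∃ f : F.matAlg, F.ofMem f.1 f.2 = a := ⟨⟨F.val a, F.val_mem a⟩, rfl⟩
  obtain ⟨a, ha'⟩ := a
  subst ha
  simp only [pair_apply, val_ofMem]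
  refine F.matAlg_induction (P := fun a => ∃ z : F.Alg ⊗[ℂ] F.Alg, ∀ x y,
    F.pair (slice F.pair y z) x = a (x * y)) ?_ ?_ ?_ ?_ ?_ ha'
  · intro i ξ η
    let e := stdOrthonormalBasis ℂ (F.space i)
    refine ⟨∑ k, F.ofMem _ (F.coeff_mem i ξ (e k)) ⊗ₜ F.ofMem _ (F.coeff_mem i (e k) η), ?_⟩
    intro x y
    simp only [map_sum, slice_tmul, map_smul, LinearMap.sum_apply, LinearMap.smul_apply, pair_apply,
      StarRep.coeff_apply, smul_eq_mul, map_mul, Module.End.mul_apply]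
    conv_rhs => rw [← e.sum_repr' ((F.rep i) y η)]
    simp
  · intro c
    refine ⟨c • 1, fun x y => ?_⟩
    simp [Algebra.TensorProduct.one_def, mul_comm]
  · intro f g _ _ hf hg
    obtain ⟨z, hz⟩ := hf
    obtain ⟨w, hw⟩ := hg
    exact ⟨z + w, fun x y => by simp only [map_add, LinearMap.add_apply, hz, hw]; rfl⟩
  · intro f g _ _ hf hg
    obtain ⟨z, hz⟩ := hf
    obtain ⟨w, hw⟩ := hg
    refine ⟨z * w, fun x y => ?_⟩
    rw [F.slice_mul z w x y (ℛ ℂ x) (ℛ ℂ y), ((ℛ ℂ x).mul (ℛ ℂ y)).convMul_apply]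
    simp [hz, hw, Finset.sum_product]
  · intro f _ hf
    obtain ⟨z, hz⟩ := hf
    refine ⟨star z, fun x y => ?_⟩
    rw [F.slice_star, hz]
    simp [antipode_mul_antidistrib]

noncomputable instance : Coalgebra ℂ F.Alg :=
  dualCoalgebra F.pair F.pair_injective F.exists_comul

lemma pair_comul (a : F.Alg) (x y : U) :
    F.pair (slice F.pair y (comul (R := ℂ) a)) x = F.pair a (x * y) :=
  dualComul_spec _ _ _ _ _ _

lemma counit_eq (a : F.Alg) : counit (R := ℂ) a = F.pair a 1 := rfl

end RepFamily

section

variable {U : Type u} [Ring U] [HopfAlgebra ℂ U] [StarRing U] [StarModule ℂ U]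
  [HopfStarAlgebra U]

section Antipode

lemma star_conv_mul (f g : WithConv (U →ₗ[ℂ] ℂ)) : star (f * g) = star f * star g := by
  ext x
  change conj ((f * g) (star x)) = _
  rw [(ℛ ℂ x).convMul_apply, (reprStar (ℛ ℂ x)).convMul_apply]
  simp [reprStar]

variable (F : RepFamily.{u, v, w} U)

namespace RepFamily

lemma dagger_mem_aux {f : WithConv (U →ₗ[ℂ] ℂ)} (hf : f ∈ F.matAlg) :
    star f ∈ F.matAlg ∧ star (dualStar f) ∈ F.matAlg := by
  refine F.matAlg_induction (P := fun f => star f ∈ F.matAlg ∧ star (dualStar f) ∈ F.matAlg)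
    ?_ ?_ ?_ ?_ ?_ hf
  · intro i ξ η
    constructor
    · have : star ((F.rep i).coeff ξ η) = (F.rep i).coeff η ξ := by
        ext x
        change conj ⟪ξ, F.rep i (star x) η⟫_ℂ = ⟪η, F.rep i x ξ⟫_ℂ
        rw [inner_conj_symm, ← (F.rep i).inner_star]
      rw [this]
      exact F.coeff_mem _ _ _
    · obtain ⟨T, hT, hTS⟩ := F.antipodeSq_compatible i
      have h1 : ∀ v, (↑T : Module.End ℂ (F.space i)) ((↑T⁻¹ : Module.End ℂ (F.space i)) v) = v :=
        fun v => by rw [← Module.End.mul_apply, T.mul_inv]; rfl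
      have h2 : ∀ v, (↑T⁻¹ : Module.End ℂ (F.space i)) ((↑T : Module.End ℂ (F.space i)) v) = v :=
        fun v => by rw [← Module.End.mul_apply, T.inv_mul]; rfl
      have hsymm : ∀ v w, ⟪(↑T : Module.End ℂ (F.space i)) v, w⟫_ℂ = ⟪v, (↑T : Module.End ℂ (F.space i)) w⟫_ℂ := hT.1
      have : star (dualStar ((F.rep i).coeff ξ η)) =
          dualStar ((F.rep i).coeff ((↑T : Module.End ℂ (F.space i)) η)
            ((↑T⁻¹ : Module.End ℂ (F.space i)) ξ)) := by
        ext x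
        change conj (conj ⟪ξ, F.rep i (star (antipode ℂ (star x))) η⟫_ℂ) =
          conj ⟪(↑T : Module.End ℂ (F.space i)) η, F.rep i (star (antipode ℂ x))
            ((↑T⁻¹ : Module.End ℂ (F.space i)) ξ)⟫_ℂ
        have h3 := hTS (star (antipode ℂ (star x)))
        rw [antipode_star_antipode_star] at h3
        have h4 : (F.rep i (star (antipode ℂ (star x)))) η = (↑T⁻¹ : Module.End ℂ (F.space i))
            (F.rep i (antipode ℂ x) ((↑T : Module.End ℂ (F.space i)) η)) := by
          rw [h3]
          simp only [Module.End.mul_apply, h2]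
        rw [Complex.conj_conj, inner_conj_symm, ← (F.rep i).inner_star, h4]
        conv_lhs => rw [← h1 ξ, hsymm, h1]
      rw [this]
      exact F.dualStar_mem (F.coeff_mem _ _ _)
  · intro c
    have h1 : dualStar (algebraMap ℂ (WithConv (U →ₗ[ℂ] ℂ)) c) = algebraMap ℂ _ (conj c) := by
      rw [Algebra.algebraMap_eq_smul_one, dualStar_smul, dualStar_one,
        Algebra.algebraMap_eq_smul_one]
    have h2 : ∀ c : ℂ, star (algebraMap ℂ (WithConv (U →ₗ[ℂ] ℂ)) c) = algebraMap ℂ _ (conj c) := by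
      intro c
      ext x
      change conj (c • counit (R := ℂ) (star x)) = conj c • counit (R := ℂ) x
      simp [counit_star]
    rw [h1, h2, h2]
    exact ⟨Subalgebra.algebraMap_mem _ _, Subalgebra.algebraMap_mem _ _⟩
  · intro f g _ _ hf hg
    rw [dualStar_add, star_add, star_add]
    exact ⟨add_mem hf.1 hg.1, add_mem hf.2 hg.2⟩
  · intro f g _ _ hf hg
    rw [dualStar_mul, star_conv_mul, star_conv_mul]
    exact ⟨mul_mem hf.1 hg.1, mul_mem hg.2 hf.2⟩
  · intro f _ hf
    rw [dualStar_dualStar]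
    exact ⟨hf.2, hf.1⟩

/-- The `†`-structure `a† = S(a)*` of `A`, explicitly `a†(x) = conj (a(x*))`. -/
noncomputable def dagger : F.Alg →ₗ⋆[ℂ] F.Alg where
  toFun a := F.ofMem (star (F.val a)) (F.dagger_mem_aux (F.val_mem a)).1
  map_add' a b := F.val_injective (by simp)
  map_smul' c a := F.val_injective (by simp)

@[simp] lemma pair_dagger (a : F.Alg) (x : U) :
    F.pair (F.dagger a) x = conj (F.pair a (star x)) := rfl

/-- The antipode of `A`, which is dual to the antipode of `U`. -/
noncomputable def antipodeA : F.Alg →ₗ[ℂ] F.Alg where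
  toFun a := star (F.dagger a)
  map_add' a b := by simp
  map_smul' c a := by simp

@[simp] lemma pair_antipodeA (a : F.Alg) (x : U) :
    F.pair (F.antipodeA a) x = F.pair a (antipode ℂ x) := by
  change F.pair (star (F.dagger a)) x = _
  simp [pair_star, - pair_apply]

lemma dagger_eq (a : F.Alg) : F.dagger a = star (F.antipodeA a) := (star_star _).symm

/-- The inverse of the antipode of `A`. -/
noncomputable def antipodeAInv : F.Alg →ₗ[ℂ] F.Alg where
  toFun a := F.dagger (star a)
  map_add' a b := by simp
  map_smul' c a := by simp

@[simp] lemma pair_antipodeAInv (a : F.Alg) (x : U) :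
    F.pair (F.antipodeAInv a) x = F.pair a (star (antipode ℂ (star x))) := by
  change F.pair (F.dagger (star a)) x = _
  simp [pair_star, - pair_apply]

end RepFamily

end Antipode

/-- A left coideal `*`-subalgebra of `U`: a unital `*`-subalgebra `I` with `Δ(I) ⊆ U ⊗ I`. -/
class IsLeftCoideal (I : StarSubalgebra ℂ U) : Prop where
  comul_mem : ∀ x ∈ I, comul (R := ℂ) x ∈
    LinearMap.range (I.subtype.toAlgHom.toLinearMap.lTensor U)

section Coideal

variable (I : StarSubalgebra ℂ U)

/-- The inclusion of `I` in `U`. -/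
def incl : I →ₗ[ℂ] U := I.subtype.toAlgHom.toLinearMap

@[simp] lemma incl_apply (x : I) : incl I x = (x : U) := rfl

lemma lTensor_incl_injective : Function.Injective ((incl I).lTensor U) :=
  Module.Flat.lTensor_preserves_injective_linearMap _ Subtype.val_injective

variable [IsLeftCoideal I]

/-- The coaction `I → U ⊗ I`, `x ↦ x₍₋₁₎ ⊗ x₍₀₎`, given by restriction of the coproduct. -/
noncomputable def coact : I →ₗ[ℂ] U ⊗[ℂ] I :=
  (LinearEquiv.ofInjective _ (lTensor_incl_injective I)).symm.toLinearMap ∘ₗ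
    (comul ∘ₗ incl I).codRestrict (LinearMap.range ((incl I).lTensor U))
      (fun x => IsLeftCoideal.comul_mem x.1 x.2)

lemma lTensor_coact (x : I) : (incl I).lTensor U (coact I x) = comul (R := ℂ) (x : U) := by
  have := LinearEquiv.apply_symm_apply (LinearEquiv.ofInjective _ (lTensor_incl_injective I))
    ((comul ∘ₗ incl I).codRestrict (LinearMap.range ((incl I).lTensor U))
      (fun x => IsLeftCoideal.comul_mem x.1 x.2) x)
  exact congrArg Subtype.val this

variable (F : RepFamily.{u, v, w} U)

namespace RepFamily

/-- The restriction map `A → Lin(I, ℂ)`, `a ↦ τ(a, -)|_I`. -/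
noncomputable def restr : F.Alg →ₗ[ℂ] Module.Dual ℂ I := (incl I).dualMap ∘ₗ F.pair

@[simp] lemma restr_apply (a : F.Alg) (x : I) : F.restr I a x = F.pair a x := rfl

/-- The coalgebra `C`, which is the coimage of the restriction map `A → Lin(I, ℂ)`. -/
abbrev coimage : Type _ := F.Alg ⧸ LinearMap.ker (F.restr I)

/-- The quotient map `π_C : A → C`. -/
noncomputable def proj : F.Alg →ₗ[ℂ] F.coimage I := (LinearMap.ker (F.restr I)).mkQ

lemma proj_surjective : Function.Surjective (F.proj I) := Submodule.mkQ_surjective _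

/-- The pairing `τ` between `C` and `I`. -/
noncomputable def pairC : F.coimage I →ₗ[ℂ] Module.Dual ℂ I :=
  (LinearMap.ker (F.restr I)).liftQ (F.restr I) le_rfl

@[simp] lemma pairC_proj (a : F.Alg) (x : I) : F.pairC I (F.proj I a) x = F.pair a x := rfl

lemma pairC_injective : Function.Injective (F.pairC I) := by
  rw [← LinearMap.ker_eq_bot]
  exact Submodule.ker_liftQ_eq_bot' _ _ rfl

lemma slice_map_proj (w : F.Alg ⊗[ℂ] F.Alg) (x y : I) :
    F.pairC I (slice (F.pairC I) y (TensorProduct.map (F.proj I) (F.proj I) w)) x =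
      F.pair (slice F.pair (y : U) w) x := by
  induction w with
  | zero => simp
  | add a b ha hb => simp only [map_add, LinearMap.add_apply, ha, hb]
  | tmul a b => simp

lemma exists_comulC (c : F.coimage I) : ∃ z : F.coimage I ⊗[ℂ] F.coimage I, ∀ x y,
    F.pairC I (slice (F.pairC I) y z) x = F.pairC I c (x * y) := by
  obtain ⟨a, rfl⟩ := F.proj_surjective I c
  exact ⟨TensorProduct.map (F.proj I) (F.proj I) (comul a), fun x y => by
    rw [slice_map_proj, pair_comul, pairC_proj]; rfl⟩

/-- The quotient coalgebra structure on `C`. -/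
noncomputable instance : Coalgebra ℂ (F.coimage I) :=
  dualCoalgebra (F.pairC I) (F.pairC_injective I) (F.exists_comulC I)

lemma pairC_comul (c : F.coimage I) (x y : I) :
    F.pairC I (slice (F.pairC I) y (comul (R := ℂ) c)) x = F.pairC I c (x * y) :=
  dualComul_spec _ _ _ _ _ _

/-- The quotient map `π_C` is a coalgebra map. -/
lemma comul_proj (a : F.Alg) : comul (R := ℂ) (F.proj I a) =
    TensorProduct.map (F.proj I) (F.proj I) (comul a) := by
  apply comul_pairing_unique (F.pairC_injective I)
  intro x y
  rw [pairC_comul, slice_map_proj, pair_comul, pairC_proj]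
  rfl

lemma counitC_eq (c : F.coimage I) : counit (R := ℂ) c = F.pairC I c 1 := rfl

lemma pair_mul_coideal (a b : F.Alg) (x : I) : F.pair (a * b) x =
    LinearMap.mul' ℂ ℂ (TensorProduct.map (F.pair a) (F.restr I b) (coact I x)) := by
  change LinearMap.mul' ℂ ℂ (TensorProduct.map (F.pair a) (F.pair b) (comul (R := ℂ) (x : U))) = _
  rw [← lTensor_coact]
  generalize coact I x = z
  induction z with
  | zero => simp
  | add p q hp hq => simp only [map_add, hp, hq]
  | tmul p q => simp

/-- The left `A`-module structure on `C`, characterised by `a · π_C(b) = π_C(ab)`. -/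
noncomputable def act (a : F.Alg) : F.coimage I →ₗ[ℂ] F.coimage I :=
  (LinearMap.ker (F.restr I)).mapQ (LinearMap.ker (F.restr I)) (LinearMap.mulLeft ℂ a) (by
    intro b hb
    rw [LinearMap.mem_ker] at hb
    rw [Submodule.mem_comap, LinearMap.mem_ker]
    ext x
    rw [LinearMap.mulLeft_apply, restr_apply, pair_mul_coideal, hb]
    simp)

@[simp] lemma act_proj (a b : F.Alg) : F.act I a (F.proj I b) = F.proj I (a * b) := rfl

/-- The `†`-structure on `C`, characterised by `π_C(a)† = π_C(a†)`. -/
noncomputable def daggerC : F.coimage I →ₗ⋆[ℂ] F.coimage I :=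
  (LinearMap.ker (F.restr I)).mapQ (LinearMap.ker (F.restr I)) F.dagger (by
    intro b hb
    rw [LinearMap.mem_ker] at hb
    rw [Submodule.mem_comap, LinearMap.mem_ker]
    ext x
    have := LinearMap.congr_fun hb (star x)
    rw [restr_apply] at this ⊢
    rw [pair_dagger, ← StarMemClass.coe_star, this]
    simp)

@[simp] lemma daggerC_proj (a : F.Alg) : F.daggerC I (F.proj I a) = F.proj I (F.dagger a) := rfl

@[simp] lemma pairC_daggerC (c : F.coimage I) (x : I) :
    F.pairC I (F.daggerC I c) x = conj (F.pairC I c (star x)) := by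
  obtain ⟨a, rfl⟩ := F.proj_surjective I c
  rfl

lemma daggerC_daggerC (c : F.coimage I) : F.daggerC I (F.daggerC I c) = c := by
  apply F.pairC_injective I
  ext x
  simp

/-- The opposite Sweedler representation of `c†`. -/
noncomputable def reprDagger {c : F.coimage I} {ι : Type*} (r : Coalgebra.Repr ℂ c ι) :
    Coalgebra.Repr ℂ (F.daggerC I c) ι where
  index := r.index
  left i := F.daggerC I (r.right i)
  right i := F.daggerC I (r.left i)
  eq := by
    apply comul_pairing_unique (F.pairC_injective I)
    intro x y
    rw [pairC_comul, pairC_daggerC, star_mul, ← pairC_comul, ← r.eq]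
    simp [mul_comm]

/-- The full linear dual of `C`, as a unital algebra under convolution. -/
def fullDual : Type _ := WithConv (F.coimage I →ₗ[ℂ] ℂ)

noncomputable instance : Ring (F.fullDual I) :=
  inferInstanceAs (Ring (WithConv (F.coimage I →ₗ[ℂ] ℂ)))

noncomputable instance : Algebra ℂ (F.fullDual I) :=
  inferInstanceAs (Algebra ℂ (WithConv (F.coimage I →ₗ[ℂ] ℂ)))

/-- The identification of `fullDual` with the space of linear functionals on `C`. -/
noncomputable def dualEquiv : F.fullDual I ≃ₗ[ℂ] (F.coimage I →ₗ[ℂ] ℂ) :=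
  WithConv.linearEquiv ℂ _

lemma dualEquiv_mul (x y : F.fullDual I) (c : F.coimage I) {ι : Type*}
    (r : Coalgebra.Repr ℂ c ι) : F.dualEquiv I (x * y) c =
      ∑ i ∈ r.index, F.dualEquiv I x (r.left i) * F.dualEquiv I y (r.right i) :=
  r.convMul_apply _ _

/-- The `*`-structure `ω*(c) = conj (ω(c†))` on the full linear dual of `C`. -/
noncomputable instance : Star (F.fullDual I) :=
  ⟨fun x => (F.dualEquiv I).symm
    { toFun := fun c => conj (F.dualEquiv I x (F.daggerC I c))
      map_add' := by simp
      map_smul' := by simp }⟩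

@[simp] lemma dualEquiv_star (x : F.fullDual I) (c : F.coimage I) :
    F.dualEquiv I (star x) c = conj (F.dualEquiv I x (F.daggerC I c)) := rfl

noncomputable instance : StarRing (F.fullDual I) where
  star_involutive x := by
    apply (F.dualEquiv I).injective
    ext c
    simp [daggerC_daggerC]
  star_mul x y := by
    apply (F.dualEquiv I).injective
    apply LinearMap.ext
    intro c
    rw [dualEquiv_star, dualEquiv_mul _ _ _ _ _ (F.reprDagger I (ℛ ℂ c)),
      dualEquiv_mul _ _ _ _ _ (ℛ ℂ c)]
    simp [reprDagger, mul_comm]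
  star_add x y := by
    apply (F.dualEquiv I).injective
    apply LinearMap.ext
    intro c
    simp

instance : StarModule ℂ (F.fullDual I) where
  star_smul a x := by
    apply (F.dualEquiv I).injective
    apply LinearMap.ext
    intro c
    simp

/-- The right `A`-module structure on the full dual of `C`: `τ(c, x ◁ a) = τ(ac, x)`. -/
noncomputable def rightAct (x : F.fullDual I) : F.Alg →ₗ[ℂ] F.fullDual I where
  toFun a := (F.dualEquiv I).symm (F.dualEquiv I x ∘ₗ F.act I a)
  map_add' a b := by
    apply (F.dualEquiv I).injective
    apply LinearMap.ext
    intro c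
    obtain ⟨d, rfl⟩ := F.proj_surjective I c
    simp [add_mul]
  map_smul' t a := by
    apply (F.dualEquiv I).injective
    apply LinearMap.ext
    intro c
    obtain ⟨d, rfl⟩ := F.proj_surjective I c
    simp

@[simp] lemma dualEquiv_rightAct (x : F.fullDual I) (a : F.Alg) (c : F.coimage I) :
    F.dualEquiv I (F.rightAct I x a) c = F.dualEquiv I x (F.act I a c) := by
  simp [rightAct]

end RepFamily

end Coideal

end

section

variable {U : Type u} [Ring U] [HopfAlgebra ℂ U] [StarRing U] [StarModule ℂ U]
  [HopfStarAlgebra U] (I : StarSubalgebra ℂ U) [IsLeftCoideal I] (F : RepFamily.{u, v, w} U)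

namespace RepFamily

section Invariants

lemma coinv_iff (b : F.Alg) :
    (F.proj I).rTensor F.Alg (comul (R := ℂ) b) = F.proj I 1 ⊗ₜ[ℂ] b ↔
      ∀ (x : I) (y : U), F.pair b (x * y) = counit (R := ℂ) (x : U) * F.pair b y := by
  have h1 : ∀ (w : F.Alg ⊗[ℂ] F.Alg) (x : I) (y : U),
      F.pairC I (slice F.pair y ((F.proj I).rTensor F.Alg w)) x = F.pair (slice F.pair y w) x := by
    intro w x y
    induction w with
    | zero => simp
    | add a b ha hb => simp only [map_add, LinearMap.add_apply, ha, hb]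
    | tmul a b => simp
  constructor
  · intro h x y
    rw [← pair_comul, ← h1, h]
    simp [mul_comm, -pair_apply, pair_one]
  · intro h
    apply slice_ext F.pair_injective
    intro y
    apply F.pairC_injective I
    ext x
    rw [h1, pair_comul, h]
    simp [mul_comm, -pair_apply, pair_one]

lemma pair_coinv_inv {b : F.Alg}
    (h : ∀ (x : I) (y : U), F.pair b (x * y) = counit (R := ℂ) (x : U) * F.pair b y)
    (x : I) (y : U) : F.pair b (star (antipode ℂ (star (x : U))) * y) =
      counit (R := ℂ) (x : U) * F.pair b y := by
  let Φ : U ⊗[ℂ] U →ₗ[ℂ] ℂ := (F.pair b ∘ₗ LinearMap.mulRight ℂ y ∘ₗ LinearMap.mul' ℂ U) ∘ₗ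
    (TensorProduct.comm ℂ U U).toLinearMap ∘ₗ
      ((star (toConv (antipode ℂ (A := U)))).ofConv).rTensor U
  have hΦ : ∀ p q, Φ (p ⊗ₜ q) = F.pair b (q * star (antipode ℂ (star p)) * y) := fun p q => rfl
  have h1 : Φ (comul (R := ℂ) (x : U)) = counit (R := ℂ) (x : U) * F.pair b y := by
    rw [← (ℛ ℂ (x : U)).eq]
    simp only [map_sum, hΦ]
    rw [← map_sum (F.pair b), ← Finset.sum_mul]
    have := congrArg star (sum_antipode_mul_eq_algebraMap_counit (reprStar (ℛ ℂ (x : U))))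
    simp only [star_sum, star_mul, star_algebraMap', counit_star, Complex.conj_conj] at this
    simp only [reprStar, star_star] at this
    rw [this, ← Algebra.smul_def]
    simp
  have h2 : ∀ w : U ⊗[ℂ] I, Φ ((incl I).lTensor U w) = F.pair b
      ((TensorProduct.lift ((LinearMap.lsmul ℂ U).flip ∘ₗ
        ((star (toConv (antipode ℂ (A := U)))).ofConv))
        ((counit (R := ℂ) (A := U)).lTensor U ((incl I).lTensor U w))) * y) := by
    intro w
    induction w with
    | zero => simp
    | add p q hp hq => simp only [map_add, hp, hq, add_mul]
    | tmul p q =>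
      simp only [LinearMap.lTensor_tmul, hΦ, incl_apply, mul_assoc, h]
      rw [TensorProduct.lift.tmul]
      change _ = F.pair b ((counit (R := ℂ) (q : U) • star (antipode ℂ (star p))) * y)
      simp
  rw [← h1, ← lTensor_coact, h2, lTensor_coact, lTensor_counit_comul, TensorProduct.lift.tmul]
  change _ = F.pair b (((1 : ℂ) • star (antipode ℂ (star (x : U)))) * y)
  rw [one_smul]

lemma coinv_mul {a b : F.Alg}
    (ha : ∀ (x : I) (y : U), F.pair a (x * y) = counit (R := ℂ) (x : U) * F.pair a y)
    (hb : ∀ (x : I) (y : U), F.pair b (x * y) = counit (R := ℂ) (x : U) * F.pair b y)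
    (x : I) (y : U) : F.pair (a * b) (x * y) = counit (R := ℂ) (x : U) * F.pair (a * b) y := by
  have h0 : ∀ w : U, F.pair (a * b) w =
      LinearMap.mul' ℂ ℂ (TensorProduct.map (F.pair a) (F.pair b) (comul (R := ℂ) w)) := fun w => rfl
  have h1 : ∀ (w : U ⊗[ℂ] I) (t : U ⊗[ℂ] U),
      LinearMap.mul' ℂ ℂ (TensorProduct.map (F.pair a) (F.pair b) ((incl I).lTensor U w * t)) =
      LinearMap.mul' ℂ ℂ (TensorProduct.map (F.pair a) (F.pair b)
        ((TensorProduct.rid ℂ U ((counit (R := ℂ) (A := U)).lTensor U ((incl I).lTensor U w)) ⊗ₜ 1)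
          * t)) := by
    intro w t
    induction w with
    | zero => simp
    | add p q hp hq => simp only [map_add, add_mul, hp, hq, TensorProduct.add_tmul]
    | tmul p q =>
      induction t with
      | zero => simp
      | add s t hs ht => simp only [mul_add, map_add, hs, ht]
      | tmul s t =>
        simp only [LinearMap.lTensor_tmul, Algebra.TensorProduct.tmul_mul_tmul, incl_apply,
          TensorProduct.map_tmul, LinearMap.mul'_apply, hb, TensorProduct.rid_tmul, one_mul,
          smul_mul_assoc, map_smul, smul_eq_mul]
        ring
  have h2 : ∀ t : U ⊗[ℂ] U,
      LinearMap.mul' ℂ ℂ (TensorProduct.map (F.pair a) (F.pair b) (((x : U) ⊗ₜ 1) * t)) =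
      counit (R := ℂ) (x : U) * LinearMap.mul' ℂ ℂ (TensorProduct.map (F.pair a) (F.pair b) t) := by
    intro t
    induction t with
    | zero => simp
    | add s t hs ht => simp only [mul_add, map_add, hs, ht]
    | tmul s t =>
      simp only [Algebra.TensorProduct.tmul_mul_tmul, TensorProduct.map_tmul, LinearMap.mul'_apply,
        ha, one_mul]
      ring
  rw [h0, Bialgebra.comul_mul, ← lTensor_coact, h1, lTensor_coact, lTensor_counit_comul,
    TensorProduct.rid_tmul, one_smul, h2, h0]

/-- The algebra `B = ᶜA` of left `C`-coinvariants of `A`, that is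
`B = {b ∈ A | (π_C ⊗ id) Δ(b) = π_C(1) ⊗ b}`. -/
noncomputable def coinv : StarSubalgebra ℂ F.Alg where
  carrier := {b | (F.proj I).rTensor F.Alg (comul (R := ℂ) b) = F.proj I 1 ⊗ₜ[ℂ] b}
  mul_mem' := by
    intro a b ha hb
    simp only [Set.mem_ofPred_eq, coinv_iff] at ha hb ⊢
    exact F.coinv_mul I ha hb
  add_mem' := by
    intro a b ha hb
    simp only [Set.mem_ofPred_eq] at ha hb ⊢
    rw [map_add, map_add, ha, hb, TensorProduct.tmul_add]
  algebraMap_mem' := by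
    intro c
    rw [Set.mem_ofPred_eq, coinv_iff]
    intro x y
    rw [Algebra.algebraMap_eq_smul_one, map_smul, LinearMap.smul_apply, LinearMap.smul_apply,
      pair_one, pair_one, Bialgebra.counit_mul]
    simp; ring
  star_mem' := by
    intro b hb
    simp only [Set.mem_ofPred_eq, coinv_iff] at hb ⊢
    intro x y
    rw [pair_star, pair_star, antipode_mul_antidistrib, star_mul]
    have := F.pair_coinv_inv I hb (star x) (star (antipode ℂ y))
    rw [StarMemClass.coe_star, star_star, counit_star] at this
    rw [this]
    simp

lemma mem_coinv {b : F.Alg} : b ∈ F.coinv I ↔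
    (F.proj I).rTensor F.Alg (comul (R := ℂ) b) = F.proj I 1 ⊗ₜ[ℂ] b := Iff.rfl

/-- The inclusion of `B` in `A`. -/
noncomputable def inclB : F.coinv I →ₗ[ℂ] F.Alg := (F.coinv I).subtype.toAlgHom.toLinearMap

lemma inclB_injective : Function.Injective (F.inclB I) := Subtype.val_injective

lemma rTensor_inclB_injective : Function.Injective ((F.inclB I).rTensor F.Alg) :=
  Module.Flat.rTensor_preserves_injective_linearMap _ (F.inclB_injective I)

/-- The subalgebra `B` is a right coideal of `A`. -/
lemma comul_coinv_mem (b : F.coinv I) : comul (R := ℂ) (F.inclB I b) ∈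
    LinearMap.range ((F.inclB I).rTensor F.Alg) := by
  have hex : Function.Exact (F.inclB I) (LinearMap.range (F.inclB I)).mkQ := by
    rw [LinearMap.exact_iff, Submodule.ker_mkQ]
  have hex2 := rTensor_exact F.Alg hex (Submodule.mkQ_surjective _)
  apply (hex2 _).1
  apply slice_ext F.pair_injective
  intro u
  have h1 : ∀ w : F.Alg ⊗[ℂ] F.Alg,
      slice F.pair u ((LinearMap.range (F.inclB I)).mkQ.rTensor F.Alg w) =
        (LinearMap.range (F.inclB I)).mkQ (slice F.pair u w) := by
    intro w
    induction w with
    | zero => simp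
    | add p q hp hq => simp only [map_add, hp, hq]
    | tmul p q => simp
  rw [h1, map_zero, Submodule.mkQ_apply, Submodule.Quotient.mk_eq_zero]
  refine ⟨⟨slice F.pair u (comul (F.inclB I b)), ?_⟩, rfl⟩
  have hb := (F.coinv_iff I b.1).1 b.2
  change _ ∈ F.coinv I
  rw [mem_coinv, coinv_iff]
  intro x y
  rw [pair_comul, pair_comul, mul_assoc]
  exact hb x (y * u)

/-- The right `A`-comodule structure `δ_B : B → B ⊗ A`, given by restriction of the coproduct. -/
noncomputable def coactB : F.coinv I →ₗ[ℂ] F.coinv I ⊗[ℂ] F.Alg :=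
  (LinearEquiv.ofInjective _ (F.rTensor_inclB_injective I)).symm.toLinearMap ∘ₗ
    (comul ∘ₗ F.inclB I).codRestrict (LinearMap.range ((F.inclB I).rTensor F.Alg))
      (F.comul_coinv_mem I)

lemma rTensor_coactB (b : F.coinv I) :
    (F.inclB I).rTensor F.Alg (F.coactB I b) = comul (R := ℂ) (b : F.Alg) := by
  have := LinearEquiv.apply_symm_apply (LinearEquiv.ofInjective _ (F.rTensor_inclB_injective I))
    ((comul ∘ₗ F.inclB I).codRestrict (LinearMap.range ((F.inclB I).rTensor F.Alg))
      (F.comul_coinv_mem I) b)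
  exact congrArg Subtype.val this

end Invariants

section RestrictedDual

/-- The space `J x J`, for `J` the full dual of `C`. -/
noncomputable def bimod (x : F.fullDual I) : Submodule ℂ (F.fullDual I) :=
  Submodule.span ℂ {w | ∃ y z, w = y * x * z}

lemma comulA_mul (a b : F.Alg) : comul (R := ℂ) (a * b) = comul (R := ℂ) a * comul (R := ℂ) b := by
  apply comul_pairing_unique F.pair_injective
  intro x y
  rw [pair_comul, F.slice_mul _ _ x y (ℛ ℂ x) (ℛ ℂ y), F.pair_mul _ _ _ ((ℛ ℂ x).mul (ℛ ℂ y))]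
  simp only [pair_comul]
  simp [Finset.sum_product]

lemma rightAct_mul (x y : F.fullDual I) (a : F.Alg) {ι : Type*} (r : Coalgebra.Repr ℂ a ι) :
    F.rightAct I (x * y) a =
      ∑ i ∈ r.index, F.rightAct I x (r.left i) * F.rightAct I y (r.right i) := by
  apply (F.dualEquiv I).injective
  apply LinearMap.ext
  intro c
  obtain ⟨d, rfl⟩ := F.proj_surjective I c
  have hrepr : ∀ (d : F.Alg) (z : F.Alg ⊗[ℂ] F.Alg) (hz : comul (R := ℂ) d = z) (x y : F.fullDual I),
      F.dualEquiv I (x * y) (F.proj I d) = LinearMap.mul' ℂ ℂ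
        (TensorProduct.map (F.dualEquiv I x ∘ₗ F.proj I) (F.dualEquiv I y ∘ₗ F.proj I) z) := by
    intro d z hz x y
    rw [TensorProduct.map_comp, LinearMap.comp_apply, ← hz, ← comul_proj]
    rfl
  rw [dualEquiv_rightAct, act_proj, hrepr _ _ (comulA_mul F a d), map_sum, LinearMap.sum_apply]
  simp only [hrepr d _ rfl]
  rw [← r.eq, Finset.sum_mul, map_sum, map_sum]
  refine Finset.sum_congr rfl fun i _ => ?_
  generalize comul (R := ℂ) d = t
  induction t with
  | zero => simp
  | add s t hs ht => simp only [mul_add, map_add, hs, ht]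
  | tmul s t => simp

@[simp] lemma rightAct_rightAct (x : F.fullDual I) (a b : F.Alg) :
    F.rightAct I (F.rightAct I x a) b = F.rightAct I x (a * b) := by
  apply (F.dualEquiv I).injective
  apply LinearMap.ext
  intro c
  obtain ⟨d, rfl⟩ := F.proj_surjective I c
  simp [mul_assoc]

@[simp] lemma rightAct_one (x : F.fullDual I) : F.rightAct I x 1 = x := by
  apply (F.dualEquiv I).injective
  apply LinearMap.ext
  intro c
  obtain ⟨d, rfl⟩ := F.proj_surjective I c
  simp

lemma sum_antipodeA_mul (a : F.Alg) {ι : Type*} (r : Coalgebra.Repr ℂ a ι) :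
    ∑ i ∈ r.index, F.antipodeA (r.left i) * r.right i = counit (R := ℂ) a • 1 := by
  apply F.pair_injective
  ext x
  have h : ∀ p q : U, F.pair a (p * q) = ∑ i ∈ r.index, F.pair (r.left i) p * F.pair (r.right i) q := by
    intro p q
    rw [← pair_comul, ← r.eq]
    simp [mul_comm]
  rw [map_sum, LinearMap.sum_apply]
  simp only [F.pair_mul _ _ x (ℛ ℂ x), pair_antipodeA]
  rw [Finset.sum_comm]
  simp only [← h]
  rw [← map_sum, sum_antipode_mul_eq_smul]
  simp [pair_one, counit_eq, mul_comm, -pair_apply]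

lemma sum_antipodeAInv_mul (a : F.Alg) {ι : Type*} (r : Coalgebra.Repr ℂ a ι) :
    ∑ i ∈ r.index, F.antipodeAInv (r.right i) * r.left i = counit (R := ℂ) a • 1 := by
  apply F.pair_injective
  ext x
  have h : ∀ p q : U, F.pair a (p * q) = ∑ i ∈ r.index, F.pair (r.right i) q * F.pair (r.left i) p := by
    intro p q
    rw [← pair_comul, ← r.eq]
    simp
  rw [map_sum, LinearMap.sum_apply]
  simp only [F.pair_mul _ _ x (ℛ ℂ x), pair_antipodeAInv]
  rw [Finset.sum_comm]
  simp only [← h]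
  have := congrArg star (sum_antipode_mul_eq_smul (reprStar (ℛ ℂ x)))
  simp only [star_sum, star_mul, star_smul, counit_star] at this
  simp only [reprStar, star_star, star_one] at this
  rw [← map_sum, this]
  simp [pair_one, counit_eq, mul_comm, -pair_apply]

lemma mul_rightAct (z x : F.fullDual I) (a : F.Alg) {ι : Type*} (r : Coalgebra.Repr ℂ a ι) :
    z * F.rightAct I x a = ∑ i ∈ r.index,
      F.rightAct I (F.rightAct I z (F.antipodeA (r.left i)) * x) (r.right i) := by
  let Φ : (F.Alg ⊗[ℂ] F.Alg) ⊗[ℂ] F.Alg →ₗ[ℂ] F.fullDual I :=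
    LinearMap.mul' ℂ _ ∘ₗ TensorProduct.map
      (F.rightAct I z ∘ₗ LinearMap.mul' ℂ _ ∘ₗ F.antipodeA.rTensor F.Alg) (F.rightAct I x)
  have h1 : Φ (comul.rTensor F.Alg (comul (R := ℂ) a)) = ∑ i ∈ r.index,
      F.rightAct I (F.rightAct I z (F.antipodeA (r.left i)) * x) (r.right i) := by
    rw [← coassoc_symm_apply, ← r.eq]
    simp only [map_sum, LinearMap.lTensor_tmul]
    refine Finset.sum_congr rfl fun i _ => ?_
    rw [F.rightAct_mul I _ _ _ (ℛ ℂ (r.right i)), ← (ℛ ℂ (r.right i)).eq]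
    simp [Φ, TensorProduct.tmul_sum]
  have h2 : ∀ p q : F.Alg, Φ (comul (R := ℂ) p ⊗ₜ q) = z * F.rightAct I x (counit (R := ℂ) p • q) := by
    intro p q
    have h3 := F.sum_antipodeA_mul p (ℛ ℂ p)
    rw [← (ℛ ℂ p).eq]
    simp only [Φ, LinearMap.comp_apply, TensorProduct.map_tmul, map_sum, LinearMap.rTensor_tmul,
      LinearMap.mul'_apply]
    rw [← map_sum, h3]
    simp
  rw [← h1, ← r.eq]
  simp only [map_sum, LinearMap.rTensor_tmul, h2]
  rw [← Finset.mul_sum, ← map_sum, sum_counit_smul]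

lemma rightAct_mul_right (x y : F.fullDual I) (a : F.Alg) {ι : Type*} (r : Coalgebra.Repr ℂ a ι) :
    F.rightAct I x a * y = ∑ i ∈ r.index,
      F.rightAct I (x * F.rightAct I y (F.antipodeAInv (r.right i))) (r.left i) := by
  let Φ : F.Alg ⊗[ℂ] (F.Alg ⊗[ℂ] F.Alg) →ₗ[ℂ] F.fullDual I :=
    LinearMap.mul' ℂ _ ∘ₗ TensorProduct.map (F.rightAct I x)
      (F.rightAct I y ∘ₗ LinearMap.mul' ℂ _ ∘ₗ F.antipodeAInv.rTensor F.Alg ∘ₗ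
        (TensorProduct.comm ℂ F.Alg F.Alg).toLinearMap)
  have h1 : Φ (comul.lTensor F.Alg (comul (R := ℂ) a)) = ∑ i ∈ r.index,
      F.rightAct I (x * F.rightAct I y (F.antipodeAInv (r.right i))) (r.left i) := by
    rw [← coassoc_apply, ← r.eq]
    simp only [map_sum, LinearMap.rTensor_tmul]
    refine Finset.sum_congr rfl fun i _ => ?_
    rw [F.rightAct_mul I _ _ _ (ℛ ℂ (r.left i)), ← (ℛ ℂ (r.left i)).eq]
    simp [Φ, TensorProduct.sum_tmul]
  have h2 : ∀ p q : F.Alg, Φ (q ⊗ₜ comul (R := ℂ) p) = F.rightAct I x (counit (R := ℂ) p • q) * y := by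
    intro p q
    have h3 := F.sum_antipodeAInv_mul p (ℛ ℂ p)
    rw [← (ℛ ℂ p).eq]
    simp only [Φ, LinearMap.comp_apply, TensorProduct.map_tmul, map_sum, LinearMap.rTensor_tmul,
      LinearMap.mul'_apply, LinearEquiv.coe_coe, TensorProduct.comm_tmul]
    rw [← map_sum, h3]
    simp
  rw [← h1, ← r.eq]
  simp only [map_sum, LinearMap.lTensor_tmul, h2]
  rw [← Finset.sum_mul, ← map_sum]
  congr 2
  have := congrArg (TensorProduct.rid ℂ F.Alg) (sum_tmul_counit_eq r)
  rw [map_sum] at this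
  simp only [TensorProduct.rid_tmul, one_smul] at this
  rw [this]

/-- The restricted dual of `C`: the elements `x` of the full dual `J` with `J x J`
finite-dimensional. -/
noncomputable def restrictedDual : Submodule ℂ (F.fullDual I) where
  carrier := {x | FiniteDimensional ℂ (F.bimod I x)}
  zero_mem' := by
    have : F.bimod I 0 = ⊥ := by
      rw [bimod, Submodule.span_eq_bot]
      rintro _ ⟨y, z, rfl⟩
      simp
    rw [Set.mem_ofPred_eq, this]
    infer_instance
  add_mem' := by
    intro x y hx hy
    rw [Set.mem_ofPred_eq] at hx hy ⊢
    have h : F.bimod I (x + y) ≤ F.bimod I x ⊔ F.bimod I y := by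
      rw [bimod, Submodule.span_le]
      rintro _ ⟨p, q, rfl⟩
      rw [mul_add, add_mul]
      exact Submodule.add_mem_sup (Submodule.subset_span ⟨p, q, rfl⟩)
        (Submodule.subset_span ⟨p, q, rfl⟩)
    exact Submodule.finiteDimensional_of_le h
  smul_mem' := by
    intro c x hx
    rw [Set.mem_ofPred_eq] at hx ⊢
    have h : F.bimod I (c • x) ≤ F.bimod I x := by
      rw [bimod, Submodule.span_le]
      rintro _ ⟨p, q, rfl⟩
      rw [mul_smul_comm, smul_mul_assoc]
      exact Submodule.smul_mem _ _ (Submodule.subset_span ⟨p, q, rfl⟩)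
    exact Submodule.finiteDimensional_of_le h

lemma mem_restrictedDual {x : F.fullDual I} :
    x ∈ F.restrictedDual I ↔ FiniteDimensional ℂ (F.bimod I x) := Iff.rfl

lemma mul_mem_restrictedDual_right {x : F.fullDual I} (hx : x ∈ F.restrictedDual I)
    (y : F.fullDual I) : x * y ∈ F.restrictedDual I := by
  rw [mem_restrictedDual] at hx ⊢
  have h : F.bimod I (x * y) ≤ F.bimod I x := by
    rw [bimod, Submodule.span_le]
    rintro _ ⟨p, q, rfl⟩
    exact Submodule.subset_span ⟨p, y * q, by simp [mul_assoc]⟩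
  exact Submodule.finiteDimensional_of_le h

lemma mul_mem_restrictedDual_left {x : F.fullDual I} (hx : x ∈ F.restrictedDual I)
    (y : F.fullDual I) : y * x ∈ F.restrictedDual I := by
  rw [mem_restrictedDual] at hx ⊢
  have h : F.bimod I (y * x) ≤ F.bimod I x := by
    rw [bimod, Submodule.span_le]
    rintro _ ⟨p, q, rfl⟩
    exact Submodule.subset_span ⟨p * y, q, by simp [mul_assoc]⟩
  exact Submodule.finiteDimensional_of_le h

lemma star_mem_restrictedDual {x : F.fullDual I} (hx : x ∈ F.restrictedDual I) :
    star x ∈ F.restrictedDual I := by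
  rw [mem_restrictedDual] at hx ⊢
  have h : F.bimod I (star x) ≤
      (F.bimod I x).map ((starLinearEquiv ℂ (A := F.fullDual I)).toLinearMap) := by
    rw [bimod, Submodule.span_le]
    rintro _ ⟨p, q, rfl⟩
    exact ⟨star q * x * star p, Submodule.subset_span ⟨_, _, rfl⟩, by simp [mul_assoc]⟩
  have : FiniteDimensional ℂ
    ((F.bimod I x).map ((starLinearEquiv ℂ (A := F.fullDual I)).toLinearMap)) :=
    Module.Finite.iff_fg.2 ((Module.Finite.iff_fg.1 hx).map _)
  exact Submodule.finiteDimensional_of_le h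

/-- The restricted dual is stable under the right `A`-module structure. -/
lemma rightAct_mem_restrictedDual {x : F.fullDual I} (hx : x ∈ F.restrictedDual I) (a : F.Alg) :
    F.rightAct I x a ∈ F.restrictedDual I := by
  rw [mem_restrictedDual] at hx ⊢
  let act : F.Alg → F.fullDual I →ₗ[ℂ] F.fullDual I := fun b =>
    { toFun := fun z => F.rightAct I z b
      map_add' := fun y z => by
        apply (F.dualEquiv I).injective
        apply LinearMap.ext
        intro c
        simp
      map_smul' := fun t z => by
        apply (F.dualEquiv I).injective
        apply LinearMap.ext
        intro c
        simp }
  have hact : ∀ b z, act b z = F.rightAct I z b := fun b z => rfl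
  let r := ℛ ℂ a
  let s := fun i => ℛ ℂ (r.right i)
  let W : Submodule ℂ (F.fullDual I) := ⨆ i : r.index, ⨆ j : (s i).index,
    (F.bimod I x).map (act ((s i).left j))
  have : FiniteDimensional ℂ W := by infer_instance
  have h : F.bimod I (F.rightAct I x a) ≤ W := by
    rw [bimod, Submodule.span_le]
    rintro _ ⟨p, q, rfl⟩
    rw [F.mul_rightAct I p x a r, Finset.sum_mul]
    refine Submodule.sum_mem _ fun i hi => ?_
    rw [F.rightAct_mul_right I _ q (r.right i) (s i)]
    refine Submodule.sum_mem _ fun j hj => ?_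
    refine Submodule.mem_iSup_of_mem ⟨i, hi⟩ (Submodule.mem_iSup_of_mem ⟨j, hj⟩ ?_)
    exact ⟨_, Submodule.subset_span ⟨_, _, rfl⟩, rfl⟩
  exact Submodule.finiteDimensional_of_le h

end RestrictedDual

end RepFamily

end

section Double

/-- The opposite of a complex algebra, with the conjugate scalar action. -/
def ConjOp (A : Type*) : Type _ := Aᵐᵒᵖ

instance (A : Type*) [Ring A] : Ring (ConjOp A) := inferInstanceAs (Ring Aᵐᵒᵖ)

instance (A : Type*) [Ring A] [Algebra ℂ A] : Algebra ℂ (ConjOp A) :=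
  RingHom.toAlgebra' ((algebraMap ℂ Aᵐᵒᵖ).comp (starRingEnd ℂ))
    (fun c x => Algebra.commutes (A := Aᵐᵒᵖ) (conj c) x)

/-- The identity map from an algebra to its conjugate opposite. -/
def toConjOp {A : Type*} [Ring A] : A ≃+ ConjOp A := MulOpposite.opAddEquiv

lemma toConjOp_mul {A : Type*} [Ring A] (a b : A) :
    toConjOp (a * b) = toConjOp b * toConjOp a := rfl

lemma toConjOp_one {A : Type*} [Ring A] : toConjOp (1 : A) = 1 := rfl

lemma toConjOp_smul {A : Type*} [Ring A] [Algebra ℂ A] (c : ℂ) (a : A) :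
    toConjOp (c • a) = conj c • toConjOp a := by
  rw [Algebra.smul_def, Algebra.smul_def, toConjOp_mul]
  have : algebraMap ℂ (ConjOp A) (conj c) = toConjOp (algebraMap ℂ A c) := by
    change algebraMap ℂ Aᵐᵒᵖ (conj (conj c)) = _
    rw [Complex.conj_conj]
    rfl
  rw [this, ← toConjOp_mul, ← toConjOp_mul, Algebra.commutes]

variable {B R : Type*} [Ring B] [Algebra ℂ B] [StarRing B] [StarModule ℂ B]
  [Ring R] [Algebra ℂ R] [StarRing R] [StarModule ℂ R] (T : R → B → B ⊗[ℂ] R)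

/-- The defining relations of the universal unital `*`-algebra generated by copies of the unital
`*`-algebras `B` and `R`, with interchange relations `x b = ∑ bᵢ xᵢ` whenever `T x b = ∑ bᵢ ⊗ xᵢ`.
The adjoints of the interchange relations are included, as they hold in any `*`-algebra in which the
interchange relations hold. -/
inductive DoubleRel : FreeAlgebra ℂ (B ⊕ R) → FreeAlgebra ℂ (B ⊕ R) → Prop
  | add_left (b b' : B) : DoubleRel (FreeAlgebra.ι ℂ (.inl (b + b')))
      (FreeAlgebra.ι ℂ (.inl b) + FreeAlgebra.ι ℂ (.inl b'))
  | smul_left (c : ℂ) (b : B) : DoubleRel (FreeAlgebra.ι ℂ (.inl (c • b)))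
      (c • FreeAlgebra.ι ℂ (.inl b))
  | mul_left (b b' : B) : DoubleRel (FreeAlgebra.ι ℂ (.inl (b * b')))
      (FreeAlgebra.ι ℂ (.inl b) * FreeAlgebra.ι ℂ (.inl b'))
  | one_left : DoubleRel (FreeAlgebra.ι ℂ (.inl 1)) 1
  | add_right (x x' : R) : DoubleRel (FreeAlgebra.ι ℂ (.inr (x + x')))
      (FreeAlgebra.ι ℂ (.inr x) + FreeAlgebra.ι ℂ (.inr x'))
  | smul_right (c : ℂ) (x : R) : DoubleRel (FreeAlgebra.ι ℂ (.inr (c • x)))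
      (c • FreeAlgebra.ι ℂ (.inr x))
  | mul_right (x x' : R) : DoubleRel (FreeAlgebra.ι ℂ (.inr (x * x')))
      (FreeAlgebra.ι ℂ (.inr x) * FreeAlgebra.ι ℂ (.inr x'))
  | one_right : DoubleRel (FreeAlgebra.ι ℂ (.inr 1)) 1
  | interchange (x : R) (b : B) (n : ℕ) (b' : Fin n → B) (x' : Fin n → R)
      (h : T x b = ∑ i, b' i ⊗ₜ[ℂ] x' i) :
      DoubleRel (FreeAlgebra.ι ℂ (.inr x) * FreeAlgebra.ι ℂ (.inl b))
        (∑ i, FreeAlgebra.ι ℂ (.inl (b' i)) * FreeAlgebra.ι ℂ (.inr (x' i)))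
  | interchange_star (x : R) (b : B) (n : ℕ) (b' : Fin n → B) (x' : Fin n → R)
      (h : T x b = ∑ i, b' i ⊗ₜ[ℂ] x' i) :
      DoubleRel (FreeAlgebra.ι ℂ (.inl (star b)) * FreeAlgebra.ι ℂ (.inr (star x)))
        (∑ i, FreeAlgebra.ι ℂ (.inr (star (x' i))) * FreeAlgebra.ι ℂ (.inl (star (b' i))))

/-- The universal unital `*`-algebra generated by copies of the unital `*`-algebras `B` and `R`, with
interchange relations `x b = ∑ bᵢ xᵢ` whenever `T x b = ∑ bᵢ ⊗ xᵢ`. -/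
def Double : Type _ := RingQuot (DoubleRel T)

namespace Double

noncomputable instance : Ring (Double T) := inferInstanceAs (Ring (RingQuot (DoubleRel T)))

noncomputable instance : Algebra ℂ (Double T) :=
  inferInstanceAs (Algebra ℂ (RingQuot (DoubleRel T)))

/-- The quotient map from the free algebra. -/
noncomputable def quot : FreeAlgebra ℂ (B ⊕ R) →ₐ[ℂ] Double T := RingQuot.mkAlgHom ℂ (DoubleRel T)

variable {T} in
lemma quot_rel {p q : FreeAlgebra ℂ (B ⊕ R)} (h : DoubleRel T p q) : quot T p = quot T q :=
  RingQuot.mkAlgHom_rel ℂ h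

/-- The canonical map `B → Double T`. -/
noncomputable def inl : B →ₐ[ℂ] Double T := AlgHom.ofLinearMap
  { toFun := fun b => quot T (FreeAlgebra.ι ℂ (.inl b))
    map_add' := fun b b' => by rw [quot_rel (.add_left b b'), map_add]
    map_smul' := fun c b => by rw [quot_rel (.smul_left c b), map_smul]; rfl }
  (by
    change quot T (FreeAlgebra.ι ℂ (.inl 1)) = 1
    rw [quot_rel .one_left, map_one])
  (fun b b' => by
    change quot T (FreeAlgebra.ι ℂ (.inl (b * b'))) = _
    rw [quot_rel (.mul_left b b'), map_mul]
    rfl)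

/-- The canonical map `R → Double T`. -/
noncomputable def inr : R →ₐ[ℂ] Double T := AlgHom.ofLinearMap
  { toFun := fun b => quot T (FreeAlgebra.ι ℂ (.inr b))
    map_add' := fun b b' => by rw [quot_rel (.add_right b b'), map_add]
    map_smul' := fun c b => by rw [quot_rel (.smul_right c b), map_smul]; rfl }
  (by
    change quot T (FreeAlgebra.ι ℂ (.inr 1)) = 1
    rw [quot_rel .one_right, map_one])
  (fun b b' => by
    change quot T (FreeAlgebra.ι ℂ (.inr (b * b'))) = _
    rw [quot_rel (.mul_right b b'), map_mul]
    rfl)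

lemma quot_inl (b : B) : quot T (FreeAlgebra.ι ℂ (.inl b)) = inl T b := rfl

lemma quot_inr (x : R) : quot T (FreeAlgebra.ι ℂ (.inr x)) = inr T x := rfl

variable {T} in
lemma inr_mul_inl {x : R} {b : B} {n : ℕ} {b' : Fin n → B} {x' : Fin n → R}
    (h : T x b = ∑ i, b' i ⊗ₜ[ℂ] x' i) :
    inr T x * inl T b = ∑ i, inl T (b' i) * inr T (x' i) := by
  have := quot_rel (.interchange x b n b' x' h)
  simpa only [map_mul, map_sum, quot_inl, quot_inr] using this

variable {T} in
lemma inl_star_mul_inr_star {x : R} {b : B} {n : ℕ} {b' : Fin n → B} {x' : Fin n → R}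
    (h : T x b = ∑ i, b' i ⊗ₜ[ℂ] x' i) :
    inl T (star b) * inr T (star x) = ∑ i, inr T (star (x' i)) * inl T (star (b' i)) := by
  have := quot_rel (.interchange_star x b n b' x' h)
  simpa only [map_mul, map_sum, quot_inl, quot_inr] using this

variable {T} in
lemma induction {P : Double T → Prop} (hl : ∀ b, P (inl T b)) (hr : ∀ x, P (inr T x))
    (hadd : ∀ p q, P p → P q → P (p + q)) (hmul : ∀ p q, P p → P q → P (p * q)) (d : Double T) :
    P d := by
  obtain ⟨p, rfl⟩ : ∃ p, quot T p = d := RingQuot.mkAlgHom_surjective ℂ (DoubleRel T) d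
  induction p using FreeAlgebra.induction with
  | grade0 c =>
    rw [AlgHom.commutes, ← AlgHom.commutes (inl T)]
    exact hl _
  | grade1 x => rcases x with b | x; exacts [hl b, hr x]
  | mul p q hp hq => rw [map_mul]; exact hmul _ _ hp hq
  | add p q hp hq => rw [map_add]; exact hadd _ _ hp hq

/-- The `*`-operation on the generators, extended to the free algebra. -/
noncomputable def preStar : FreeAlgebra ℂ (B ⊕ R) →ₐ[ℂ] ConjOp (Double T) :=
  FreeAlgebra.lift ℂ (Sum.elim (fun b => toConjOp (inl T (star b)))
    (fun x => toConjOp (inr T (star x))))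

@[simp] lemma preStar_inl (b : B) :
    preStar T (FreeAlgebra.ι ℂ (.inl b)) = toConjOp (inl T (star b)) := by
  simp [preStar]

@[simp] lemma preStar_inr (x : R) :
    preStar T (FreeAlgebra.ι ℂ (.inr x)) = toConjOp (inr T (star x)) := by
  simp [preStar]

lemma preStar_rel ⦃p q : FreeAlgebra ℂ (B ⊕ R)⦄ (h : DoubleRel T p q) :
    preStar T p = preStar T q := by
  induction h with
  | add_left b b' => simp
  | smul_left c b => simp [toConjOp_smul]
  | mul_left b b' => simp [toConjOp_mul]
  | one_left => simp [toConjOp_one]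
  | add_right b b' => simp
  | smul_right c b => simp [toConjOp_smul]
  | mul_right b b' => simp [toConjOp_mul]
  | one_right => simp [toConjOp_one]
  | interchange x b n b' x' h =>
    simp only [map_mul, map_sum, preStar_inl, preStar_inr, ← toConjOp_mul]
    rw [inl_star_mul_inr_star h, map_sum]
  | interchange_star x b n b' x' h =>
    simp only [map_mul, map_sum, preStar_inl, preStar_inr, ← toConjOp_mul, star_star]
    rw [inr_mul_inl h, map_sum]

/-- The `*`-operation as a homomorphism to the conjugate opposite algebra. -/
noncomputable def starHom : Double T →ₐ[ℂ] ConjOp (Double T) :=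
  RingQuot.liftAlgHom ℂ ⟨preStar T, preStar_rel T⟩

lemma starHom_inl (b : B) : starHom T (inl T b) = toConjOp (inl T (star b)) := by
  rw [← preStar_inl]
  exact RingQuot.liftAlgHom_mkAlgHom_apply _ _ _ _

lemma starHom_inr (x : R) : starHom T (inr T x) = toConjOp (inr T (star x)) := by
  rw [← preStar_inr]
  exact RingQuot.liftAlgHom_mkAlgHom_apply _ _ _ _

noncomputable instance : Star (Double T) := ⟨fun d => toConjOp.symm (starHom T d)⟩

lemma toConjOp_star (d : Double T) : toConjOp (star d) = starHom T d := rfl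

lemma star_inl (b : B) : star (inl T b) = inl T (star b) :=
  toConjOp.injective (starHom_inl T b)

lemma star_inr (x : R) : star (inr T x) = inr T (star x) :=
  toConjOp.injective (starHom_inr T x)

lemma star_add_aux (p q : Double T) : star (p + q) = star p + star q :=
  toConjOp.injective (by rw [map_add, toConjOp_star, toConjOp_star, toConjOp_star, map_add])

lemma star_mul_aux (p q : Double T) : star (p * q) = star q * star p :=
  toConjOp.injective (by rw [toConjOp_mul, toConjOp_star, toConjOp_star, toConjOp_star, map_mul])

noncomputable instance : StarRing (Double T) where
  star_involutive d := by
    induction d using induction with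
    | hl b => rw [star_inl, star_inl, star_star]
    | hr x => rw [star_inr, star_inr, star_star]
    | hadd p q hp hq => rw [star_add_aux, star_add_aux, hp, hq]
    | hmul p q hp hq => rw [star_mul_aux, star_mul_aux, hp, hq]
  star_mul := star_mul_aux T
  star_add := star_add_aux T

instance : StarModule ℂ (Double T) where
  star_smul c d := toConjOp.injective (by
    rw [toConjOp_star, map_smul, ← toConjOp_star, toConjOp_smul]
    simp)

end Double

end Double

section

section Pairing

variable {R X : Type*} [Ring R] [Algebra ℂ R] [AddCommMonoid X] [Module ℂ X]
  (τ : X →ₗ[ℂ] Module.Dual ℂ R) {V : Type*} [AddCommMonoid V] [Module ℂ V]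

/-- The slices `u ↦ (id ⊗ τ(-, u))(z)` of an element `z` of `V ⊗ X`, as a linear map in `u`. -/
noncomputable def sliceHom (z : V ⊗[ℂ] X) : R →ₗ[ℂ] V where
  toFun u := slice τ u z
  map_add' u u' := by
    induction z with
    | zero => simp
    | add a b ha hb => simp only [map_add, ha, hb]; abel
    | tmul a b => simp [add_smul]
  map_smul' c u := by
    induction z with
    | zero => simp
    | add a b ha hb => simp only [map_add, ha, hb, smul_add]
    | tmul a b => simp [mul_smul]

@[simp] lemma sliceHom_apply (z : V ⊗[ℂ] X) (u : R) : sliceHom τ z u = slice τ u z := rfl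

end Pairing

variable {U : Type u} [Ring U] [HopfAlgebra ℂ U] [StarRing U] [StarModule ℂ U]
  [HopfStarAlgebra U] (I : StarSubalgebra ℂ U) [IsLeftCoideal I] (F : RepFamily.{u, v, w} U)

namespace RepFamily

section DrinfeldDouble

/-- The interchange `x ⊗ b ↦ τ(b₍₁₎, x₍₋₁₎) b₍₀₎ ⊗ x₍₀₎` for `x ∈ I`, `b ∈ B`. -/
noncomputable def interchange (x : I) (b : F.coinv I) : F.coinv I ⊗[ℂ] I :=
  (sliceHom F.pair (F.coactB I b)).rTensor I (coact I x)

/-- The Drinfeld double `D(B, I)`: the universal `*`-algebra generated by copies of `B` and `I` with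
`x b = τ(b₍₁₎, x₍₋₁₎) b₍₀₎ x₍₀₎`. -/
abbrev drinfeldDouble : Type _ := Double (F.interchange I)

/-- The interchange `x ⊗ b ↦ b₍₀₎ ⊗ (x ◁ b₍₁₎)` for `x` in the full dual of `C` and `b ∈ B`. -/
noncomputable def fullInterchange (x : F.fullDual I) (b : F.coinv I) :
    F.coinv I ⊗[ℂ] F.fullDual I :=
  (F.rightAct I x).lTensor (F.coinv I) (F.coactB I b)

/-- The universal `*`-algebra generated by copies of `B` and the full dual of `C`, with
`x b = b₍₀₎ (x ◁ b₍₁₎)`. -/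
abbrev fullDouble : Type _ := Double (F.fullInterchange I)

/-- The space spanned by the products `b x` with `b ∈ B` and `x` in the restricted dual of `C`. -/
noncomputable def restrictedSpan : Submodule ℂ (F.fullDouble I) :=
  Submodule.span ℂ {d | ∃ b, ∃ x ∈ F.restrictedDual I, d = Double.inl _ b * Double.inr _ x}

lemma inl_mul_inr_mem (b : F.coinv I) {x : F.fullDual I} (hx : x ∈ F.restrictedDual I) :
    Double.inl (F.fullInterchange I) b * Double.inr _ x ∈ F.restrictedSpan I :=
  Submodule.subset_span ⟨b, x, hx, rfl⟩

lemma inl_mul_mem (b : F.coinv I) {d : F.fullDouble I} (hd : d ∈ F.restrictedSpan I) :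
    Double.inl (F.fullInterchange I) b * d ∈ F.restrictedSpan I := by
  induction hd using Submodule.span_induction with
  | mem d hd =>
    obtain ⟨b', x, hx, rfl⟩ := hd
    rw [← mul_assoc, ← map_mul]
    exact F.inl_mul_inr_mem I _ hx
  | zero => simp
  | add p q _ _ hp hq => rw [mul_add]; exact add_mem hp hq
  | smul c p _ hp => rw [mul_smul_comm]; exact Submodule.smul_mem _ _ hp

lemma mul_inr_mem {d : F.fullDouble I} (hd : d ∈ F.restrictedSpan I) {x : F.fullDual I}
    (hx : x ∈ F.restrictedDual I) : d * Double.inr _ x ∈ F.restrictedSpan I := by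
  induction hd using Submodule.span_induction with
  | mem d hd =>
    obtain ⟨b', x', hx', rfl⟩ := hd
    rw [mul_assoc, ← map_mul]
    exact F.inl_mul_inr_mem I _ (F.mul_mem_restrictedDual_right I hx' x)
  | zero => simp
  | add p q _ _ hp hq => rw [add_mul]; exact add_mem hp hq
  | smul c p _ hp => rw [smul_mul_assoc]; exact Submodule.smul_mem _ _ hp

lemma inr_mul_inl_mem {x : F.fullDual I} (hx : x ∈ F.restrictedDual I) (b : F.coinv I) :
    Double.inr (F.fullInterchange I) x * Double.inl _ b ∈ F.restrictedSpan I := by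
  obtain ⟨n, p, q, hpq⟩ := TensorProduct.exists_sum_tmul_eq (F.coactB I b)
  have h : F.fullInterchange I x b = ∑ i, p i ⊗ₜ[ℂ] F.rightAct I x (q i) := by
    rw [fullInterchange, hpq]
    simp
  rw [Double.inr_mul_inl h]
  exact Submodule.sum_mem _ fun i _ =>
    F.inl_mul_inr_mem I _ (F.rightAct_mem_restrictedDual I hx _)

/-- The `*`-algebra `𝒟(B, 𝓘) = B𝓘`, where `𝓘` is the restricted dual of `C`, as a (typically
non-unital) `*`-subalgebra of `fullDouble`. -/
noncomputable def restrictedDouble : NonUnitalStarSubalgebra ℂ (F.fullDouble I) where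
  carrier := F.restrictedSpan I
  add_mem' := fun ha hb => add_mem ha hb
  zero_mem' := zero_mem _
  smul_mem' := fun c _ ha => Submodule.smul_mem _ c ha
  mul_mem' := by
    intro d e hd he
    change _ ∈ F.restrictedSpan I
    induction hd using Submodule.span_induction with
    | mem d hd =>
      obtain ⟨b, x, hx, rfl⟩ := hd
      induction he using Submodule.span_induction with
      | mem e he =>
        obtain ⟨b', x', hx', rfl⟩ := he
        have h := F.mul_inr_mem I (F.inl_mul_mem I b (F.inr_mul_inl_mem I hx b')) hx'
        simpa only [mul_assoc] using h
      | zero => simp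
      | add p q _ _ hp hq => rw [mul_add]; exact add_mem hp hq
      | smul c p _ hp => rw [mul_smul_comm]; exact Submodule.smul_mem _ _ hp
    | zero => simp
    | add p q _ _ hp hq => rw [add_mul]; exact add_mem hp hq
    | smul c p _ hp => rw [smul_mul_assoc]; exact Submodule.smul_mem _ _ hp
  star_mem' := by
    intro d hd
    change _ ∈ F.restrictedSpan I
    change d ∈ F.restrictedSpan I at hd
    induction hd using Submodule.span_induction with
    | mem d hd =>
      obtain ⟨b, x, hx, rfl⟩ := hd
      rw [star_mul, Double.star_inl, Double.star_inr]
      exact F.inr_mul_inl_mem I (F.star_mem_restrictedDual I hx) _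
    | zero => simp
    | add p q _ _ hp hq => rw [star_add]; exact add_mem hp hq
    | smul c p _ hp => rw [star_smul]; exact Submodule.smul_mem _ _ hp

/-- The element `b x` of `𝒟(B, 𝓘)`. -/
noncomputable def restrictedMk (b : F.coinv I) (x : F.restrictedDual I) : F.restrictedDouble I :=
  ⟨Double.inl _ b * Double.inr _ (x : F.fullDual I), F.inl_mul_inr_mem I b x.2⟩

end DrinfeldDouble

section FType

variable {I}

/-- A `*`-representation of `U` on a pre-Hilbert space is of `𝓕`-type if its cyclic subspaces are
finite-dimensional, with matrix coefficients in `A`. -/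
def IsFType {G : Type*} [NormedAddCommGroup G] [InnerProductSpace ℂ G] (ρ : StarRep U G) : Prop :=
  ∀ ξ, FiniteDimensional ℂ (ρ.cyclic ξ) ∧
    ∀ v ∈ ρ.cyclic ξ, ∀ w ∈ ρ.cyclic ξ, ρ.coeff v w ∈ F.matAlg

/-- A `*`-representation `π` of `I` on a pre-Hilbert space is of `𝓕`-type if its cyclic subspaces
are finite-dimensional, and isomorphic to `I`-subrepresentations of `𝓕`-type `*`-representations
of `U`. (A finite-dimensional subspace of an `𝓕`-type representation of `U` is contained in a
finite-dimensional subrepresentation, so that it is no restriction to let `G` be in `Type`.) -/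
def IsCoidealFType {H : Type*} [NormedAddCommGroup H] [InnerProductSpace ℂ H] (π : StarRep I H) :
    Prop :=
  ∀ ξ, FiniteDimensional ℂ (π.cyclic ξ) ∧
    ∃ (G : Type) (_ : NormedAddCommGroup G) (_ : InnerProductSpace ℂ G) (ρ : StarRep U G),
      F.IsFType ρ ∧ ∃ j : π.cyclic ξ →ₗᵢ[ℂ] G, ∀ (x : I) (v : π.cyclic ξ),
        j ⟨π x v, π.map_mem_cyclic x v.2⟩ = ρ (x : U) (j v)

variable {F} {H : Type*} [NormedAddCommGroup H] [InnerProductSpace ℂ H]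

lemma IsCoidealFType.exists_coaction {π : StarRep I H} (hπ : F.IsCoidealFType π) (ξ : H) :
    ∃ z : H ⊗[ℂ] F.coimage I, ∀ x : I, slice (F.pairC I) x z = π x ξ := by
  obtain ⟨hfd, G, _, _, ρ, hρ, j, hj⟩ := hπ ξ
  let e := stdOrthonormalBasis ℂ (π.cyclic ξ)
  let η : π.cyclic ξ := ⟨ξ, π.self_mem_cyclic ξ⟩
  have hmem : ∀ v : π.cyclic ξ, j v ∈ ρ.cyclic (j η) := by
    rintro ⟨_, x, rfl⟩
    exact ⟨(x : U), (hj x η).symm⟩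
  have hcoeff : ∀ k, ρ.coeff (j (e k)) (j η) ∈ F.matAlg := fun k =>
    (hρ (j η)).2 _ (hmem _) _ (hmem _)
  refine ⟨∑ k, ((e k : π.cyclic ξ) : H) ⊗ₜ[ℂ] F.proj I (F.ofMem _ (hcoeff k)), fun x => ?_⟩
  simp only [map_sum, slice_tmul, pairC_proj, pair_apply, val_ofMem, StarRep.coeff_apply, ← hj,
    j.inner_map_map]
  have := congrArg (fun v : π.cyclic ξ => (v : H))
    (e.sum_repr' ⟨π x (η : H), π.map_mem_cyclic x η.2⟩)
  simpa using this

/-- The unitary right `C`-comodule structure `δ : H → H ⊗ C` associated to an `𝓕`-type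
`*`-representation `π` of `I`, determined by `π(x)ξ = (id ⊗ τ(-, x)) δ(ξ)`. -/
noncomputable def IsCoidealFType.coaction {π : StarRep I H} (hπ : F.IsCoidealFType π) :
    H →ₗ[ℂ] H ⊗[ℂ] F.coimage I where
  toFun ξ := (hπ.exists_coaction ξ).choose
  map_add' ξ η := by
    apply slice_ext (F.pairC_injective I)
    intro x
    rw [map_add, (hπ.exists_coaction (ξ + η)).choose_spec, (hπ.exists_coaction ξ).choose_spec,
      (hπ.exists_coaction η).choose_spec, map_add]
  map_smul' c ξ := by
    apply slice_ext (F.pairC_injective I)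
    intro x
    rw [map_smul, (hπ.exists_coaction (c • ξ)).choose_spec, (hπ.exists_coaction ξ).choose_spec,
      map_smul]
    rfl

lemma IsCoidealFType.slice_coaction {π : StarRep I H} (hπ : F.IsCoidealFType π) (ξ : H) (x : I) :
    slice (F.pairC I) x (hπ.coaction ξ) = π x ξ :=
  (hπ.exists_coaction ξ).choose_spec x

/-- The associated action `x ↦ (ξ ↦ (id ⊗ x) δ(ξ))` of the full dual of `C` on `H`. -/
noncomputable def IsCoidealFType.dualAction {π : StarRep I H} (hπ : F.IsCoidealFType π)
    (x : F.fullDual I) : H →ₗ[ℂ] H :=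
  (TensorProduct.rid ℂ H).toLinearMap ∘ₗ (F.dualEquiv I x).lTensor H ∘ₗ hπ.coaction

end FType

end RepFamily

namespace StarRep

section Irreducibility

variable {R : Type*} [Ring R] [Algebra ℂ R] [StarRing R]
  {H : Type*} [NormedAddCommGroup H] [InnerProductSpace ℂ H] (π : StarRep R H)

/-- The subspace `W` is stable under the representation. -/
def IsStable (W : Submodule ℂ H) : Prop := ∀ x, ∀ v ∈ W, π x v ∈ W

/-- The subspace `W` is an irreducible subrepresentation. -/
def IsIrreducibleSub (W : Submodule ℂ H) : Prop :=
  W ≠ ⊥ ∧ π.IsStable W ∧ ∀ W' ≤ W, π.IsStable W' → W' = ⊥ ∨ W' = W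

/-- The space of intertwiners from the subrepresentation `W` to the full representation. Its
dimension is the multiplicity of `W`, for `W` finite-dimensional and irreducible. -/
def intertwiners (W : Submodule ℂ H) : Submodule ℂ (W →ₗ[ℂ] H) where
  carrier := {f | ∀ (x : R) (v w : W), (w : H) = π x v → f w = π x (f v)}
  add_mem' := fun hf hg x v w h => by simp [hf x v w h, hg x v w h]
  zero_mem' := fun x v w h => by simp
  smul_mem' := fun c f hf x v w h => by simp [hf x v w h]

/-- Each irreducible subrepresentation has finite multiplicity. -/
def HasFiniteMultiplicities : Prop :=
  ∀ W, π.IsIrreducibleSub W → FiniteDimensional ℂ (π.intertwiners W)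

/-- Irreducibility (simplicity) of the underlying module. -/
def IsSimple : Prop :=
  letI : Module R H := Module.compHom H (π.toAlgHom : R →+* Module.End ℂ H)
  IsSimpleModule R H

end Irreducibility

end StarRep

/-- A `*`-representation of a (possibly non-unital) `*`-algebra on a Hilbert space is irreducible if
the space is non-zero and has no non-trivial stable closed subspaces. -/
def IsIrreducibleRep {D K : Type*} [NonUnitalRing D] [Module ℂ D] [Star D]
    [NormedAddCommGroup K] [InnerProductSpace ℂ K] [CompleteSpace K]
    (θ : D →⋆ₙₐ[ℂ] (K →L[ℂ] K)) : Prop :=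
  Nontrivial K ∧ ∀ V : Submodule ℂ K, IsClosed (V : Set K) →
    (∀ d, ∀ v ∈ V, θ d v ∈ V) → V = ⊥ ∨ V = ⊤

namespace RepFamily

variable {I F} {H : Type*} [NormedAddCommGroup H] [InnerProductSpace ℂ H]

/-- The underlying `*`-representation of `I` of a `*`-representation of `D(B, I)`. -/
noncomputable def resI (θ₀ : StarRep (F.drinfeldDouble I) H) : StarRep I H where
  toAlgHom := θ₀.toAlgHom.comp (Double.inr (F.interchange I))
  inner_star x v w := by
    simp only [AlgHom.comp_apply]
    rw [← Double.star_inr, ← θ₀.inner_star]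

/-- The `*`-representation `θ` of `𝒟(B, 𝓘)` on the completion of `H` is the one associated to the
`𝓕`-type `*`-representation `θ₀` of `D(B, I)` on `H`: one has `θ(b x) = π(b) π̂(x)` for `b ∈ B` and
`x ∈ 𝓘`, with `π(b)` and `π̂(x)` the (extensions to the completion of the) actions of `b` and `x`
on `H`. -/
def IsAssociated (θ₀ : StarRep (F.drinfeldDouble I) H) (hθ₀ : F.IsCoidealFType (resI θ₀))
    (θ : F.restrictedDouble I →⋆ₙₐ[ℂ]
      (UniformSpace.Completion H →L[ℂ] UniformSpace.Completion H)) : Prop :=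
  ∀ (b : F.coinv I) (x : F.restrictedDual I) (ξ : H),
    θ (F.restrictedMk I b x) (ξ : UniformSpace.Completion H) =
      ((θ₀ (Double.inl _ b) (hθ₀.dualAction x ξ) : H) : UniformSpace.Completion H)

end RepFamily

end

end DrinfeldCoideal

open DrinfeldCoideal

/-! Three facts carry the theorem: functionals on `C` act on each vector as elements of `I` do,
elements of the restricted dual act with finite rank, and every vector of `H₀` is fixed by some
element of the restricted dual.

Density. Since `C` embeds in the dual of `I`, every functional on `C` agrees with an element of `I`
on any given finite subset of `C`. A coaction involves finitely many elements of `C` at each vector,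
so multiplicativity, adjoints and the interchange relation with `B` pass from `I` to the full dual.
This makes `H₀` a `*`-representation `fullRep` of the full double.

Finite rank. For `x` in the restricted dual, `L`, the span of the products `y * x * z`, is a
finite-dimensional left ideal containing `x`. Each vector `ξ` gives a module map `L → H₀`, `z ↦ z
ξ`. As `H₀` is semisimple with finite multiplicities, all module maps `L → H₀` take values in one
finite-dimensional subspace, which contains the range of `x`
(`IsCoidealFType.finiteDimensional_range`). A finite rank operator with a formal adjoint is bounded,
so `fullRep` restricted to `B𝓘` extends to the completion. Density of `H₀` gives uniqueness.

Local units. The condition on the square of the antipode makes contragredients unitarizable, so `A`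
is spanned by entries of unitary matrices. These make `C` a semisimple module over its dual, and a
finite-dimensional subcoalgebra has a complementary subcoalgebra. The counit of the first, extended
by zero on the second, lies in the restricted dual; choosing the first large enough for `δ(ξ)` makes
this functional fix `ξ` (`CoimageRep.exists_dualRep_eq_self`).

Irreducibility. If `x` fixes `ξ` and has finite rank, applying it to the closure of a subspace `W`
of `H₀` lands in the finite-dimensional, hence closed, space `x W`. So no stable `W` is properly
dense in `H₀`. Conversely, `x` maps a closed stable subspace `V` into `V ∩ H₀`. If that intersection
vanishes, every `x` kills `V`, and `V` is orthogonal to all fixed vectors, that is to `H₀`. -/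

namespace DrinfeldCoideal

open Coalgebra HopfAlgebra WithConv Filter

universe u v w

/-! ### Density of `I` in the full dual of `C`, and the action of that dual on comodules. -/

section Approximation

variable {U : Type u} [Ring U] [HopfAlgebra ℂ U] [StarRing U] [StarModule ℂ U]
  [HopfStarAlgebra U] (I : StarSubalgebra ℂ U) [IsLeftCoideal I] (F : RepFamily.{u, v, w} U)

namespace RepFamily

/-- On the finite-dimensional span of `S` the pairing with `I` is still injective in its first
variable, so by finite-dimensional duality every functional on the span is evaluation at an element
of `I`. -/
lemma exists_pairC_eq (x : F.fullDual I) (S : Finset (F.coimage I)) :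
    ∃ y : I, ∀ c ∈ S, F.pairC I c y = F.dualEquiv I x c := by
  let E := Submodule.span ℂ (S : Set (F.coimage I))
  let f : E →ₗ[ℂ] Module.Dual ℂ I := F.pairC I ∘ₗ E.subtype
  have hf : Function.Injective f := (F.pairC_injective I).comp Subtype.val_injective
  obtain ⟨y, hy⟩ := LinearMap.flip_surjective_iff₁.2 hf (F.dualEquiv I x ∘ₗ E.subtype)
  exact ⟨y, fun c hc => LinearMap.congr_fun hy ⟨c, Submodule.subset_span hc⟩⟩

/-- The filter on `I` generated by the sets of elements agreeing with a given functional at an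
element of `C`. -/
noncomputable def approx (x : F.fullDual I) : Filter I :=
  ⨅ c : F.coimage I, 𝓟 {y | F.pairC I c y = F.dualEquiv I x c}

lemma eventually_approx (x : F.fullDual I) (c : F.coimage I) :
    ∀ᶠ y in F.approx I x, F.pairC I c y = F.dualEquiv I x c :=
  mem_iInf_of_mem c (mem_principal_self _)

instance (x : F.fullDual I) : (F.approx I x).NeBot := by
  refine (hasBasis_iInf_principal_finite _).neBot_iff.2 fun {t} ht => ?_
  obtain ⟨y, hy⟩ := F.exists_pairC_eq I x ht.toFinset
  exact ⟨y, Set.mem_iInter₂.2 fun c hc => hy c (ht.mem_toFinset.2 hc)⟩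

/-- Lets one `y` approximate `x` at one vector while `star y` approximates `star x` at another,
which is what adjoint relations need. -/
lemma tendsto_star_approx (x : F.fullDual I) :
    Tendsto star (F.approx I x) (F.approx I (star x)) := by
  rw [approx.eq_1 I F (star x), tendsto_iInf]
  intro c
  rw [tendsto_principal]
  filter_upwards [F.eventually_approx I x (F.daggerC I c)] with y hy
  rw [dualEquiv_star, ← hy, pairC_daggerC, Complex.conj_conj]

variable {V : Type*} [AddCommGroup V] [Module ℂ V]

lemma slice_eventually_eq (x : F.fullDual I) (z : V ⊗[ℂ] F.coimage I) :
    ∀ᶠ y in F.approx I x, slice (F.pairC I) y z =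
      TensorProduct.rid ℂ V ((F.dualEquiv I x).lTensor V z) := by
  induction z with
  | zero => simp
  | add a b ha hb => filter_upwards [ha, hb] with y ha hb; simp only [map_add, ha, hb]
  | tmul v c => filter_upwards [F.eventually_approx I x c] with y hy; simp [hy]

lemma pairC_mul (c : F.coimage I) (x y : I) {ι : Type*} (r : Coalgebra.Repr ℂ c ι) :
    F.pairC I c (x * y) = ∑ i ∈ r.index, F.pairC I (r.left i) x * F.pairC I (r.right i) y := by
  rw [← pairC_comul, ← r.eq]
  simp [mul_comm]

/-- The product of `I` is dual to the coproduct of `C`, which involves finitely many terms at `c`.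
The nested quantifiers leave `y` free to depend on `y'`. -/
lemma eventually_approx_mul (x x' : F.fullDual I) (c : F.coimage I) :
    ∀ᶠ y' in F.approx I x', ∀ᶠ y in F.approx I x,
      F.pairC I c (y * y') = F.dualEquiv I (x * x') c := by
  have h1 : ∀ᶠ y' in F.approx I x', ∀ i ∈ (ℛ ℂ c).index,
      F.pairC I ((ℛ ℂ c).right i) y' = F.dualEquiv I x' ((ℛ ℂ c).right i) :=
    (Finset.eventually_all _).2 fun i _ => F.eventually_approx I x' _
  have h2 : ∀ᶠ y in F.approx I x, ∀ i ∈ (ℛ ℂ c).index,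
      F.pairC I ((ℛ ℂ c).left i) y = F.dualEquiv I x ((ℛ ℂ c).left i) :=
    (Finset.eventually_all _).2 fun i _ => F.eventually_approx I x _
  filter_upwards [h1] with y' h1
  filter_upwards [h2] with y h2
  rw [F.pairC_mul I c y y' (ℛ ℂ c), F.dualEquiv_mul I x x' c (ℛ ℂ c)]
  exact Finset.sum_congr rfl fun i hi => by rw [h1 i hi, h2 i hi]

lemma slice_eventually_eq_mul (x x' : F.fullDual I) (z : V ⊗[ℂ] F.coimage I) :
    ∀ᶠ y' in F.approx I x', ∀ᶠ y in F.approx I x, slice (F.pairC I) (y * y') z =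
      TensorProduct.rid ℂ V ((F.dualEquiv I (x * x')).lTensor V z) := by
  induction z with
  | zero => simp
  | add a b ha hb =>
    filter_upwards [ha, hb] with y' ha hb
    filter_upwards [ha, hb] with y ha hb
    simp only [map_add, ha, hb]
  | tmul v c =>
    filter_upwards [F.eventually_approx_mul I x x' c] with y' h
    filter_upwards [h] with y h
    simp [h]

/-- A representation of `I` which comes from a right comodule structure over `C`. -/
structure CoimageRep (V : Type*) [AddCommGroup V] [Module ℂ V] where
  rep : I →ₐ[ℂ] Module.End ℂ V
  coaction : V →ₗ[ℂ] V ⊗[ℂ] F.coimage I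
  slice_coaction : ∀ ξ x, slice (F.pairC I) x (coaction ξ) = rep x ξ

namespace CoimageRep

variable {I F} (M : F.CoimageRep I V)

/-- The action `ξ ↦ (id ⊗ x) δ(ξ)` of a functional on `C`. -/
noncomputable def dualAct (x : F.fullDual I) : V →ₗ[ℂ] V :=
  (TensorProduct.rid ℂ V).toLinearMap ∘ₗ (F.dualEquiv I x).lTensor V ∘ₗ M.coaction

lemma eventually_rep_eq (x : F.fullDual I) (ξ : V) :
    ∀ᶠ y in F.approx I x, M.rep y ξ = M.dualAct x ξ := by
  filter_upwards [F.slice_eventually_eq I x (M.coaction ξ)] with y hy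
  rw [← M.slice_coaction, hy]
  rfl

/-- Hence subspaces stable under `I` are stable under the full dual. -/
lemma exists_rep_eq (x : F.fullDual I) (ξ : V) : ∃ y : I, M.dualAct x ξ = M.rep y ξ := by
  obtain ⟨y, hy⟩ := (M.eventually_rep_eq x ξ).exists
  exact ⟨y, hy.symm⟩

lemma dualAct_mul (x x' : F.fullDual I) (ξ : V) :
    M.dualAct (x * x') ξ = M.dualAct x (M.dualAct x' ξ) := by
  -- The element `y'` replaces `x'` at `ξ`; only then can `y` be chosen to replace `x` at the new
  -- vector `M.rep y' ξ`.
  obtain ⟨y', h1, h2⟩ := ((F.slice_eventually_eq_mul I x x' (M.coaction ξ)).and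
    (M.eventually_rep_eq x' ξ)).exists
  obtain ⟨y, h3, h4⟩ := (h1.and (M.eventually_rep_eq x (M.rep y' ξ))).exists
  rw [← h2, ← h4, ← Module.End.mul_apply, ← map_mul, ← M.slice_coaction, h3]
  rfl

/-- The representation of the full dual of `C` on a `C`-comodule. -/
noncomputable def dualRep : F.fullDual I →ₐ[ℂ] Module.End ℂ V := AlgHom.ofLinearMap
  { toFun := M.dualAct
    map_add' := fun x x' => by ext; simp [dualAct]
    map_smul' := fun c x => by ext; simp [dualAct] }
  (by
    ext ξ
    have h : ∀ z : V ⊗[ℂ] F.coimage I, TensorProduct.rid ℂ V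
        ((F.dualEquiv I 1).lTensor V z) = slice (F.pairC I) 1 z := by
      intro z
      induction z with
      | zero => simp
      | add a b ha hb => simp only [map_add, ha, hb]
      | tmul v c =>
        have : F.dualEquiv I 1 c = F.pairC I c 1 := rfl
        simp [this]
    change M.dualAct 1 ξ = ξ
    rw [dualAct, LinearMap.comp_apply, LinearMap.comp_apply, LinearEquiv.coe_coe, h,
      M.slice_coaction, map_one, Module.End.one_apply])
  (fun x x' => LinearMap.ext fun ξ => M.dualAct_mul x x' ξ)

lemma eventually_rep_eq_dualRep (x : F.fullDual I) (ξ : V) :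
    ∀ᶠ y in F.approx I x, M.rep y ξ = M.dualRep x ξ := M.eventually_rep_eq x ξ

lemma exists_rep_eq_dualRep (x : F.fullDual I) (ξ : V) : ∃ y : I, M.dualRep x ξ = M.rep y ξ :=
  M.exists_rep_eq x ξ

/-- Intertwiners for `I` are intertwiners for the full dual of `C`. -/
lemma map_dualRep {W : Type*} [AddCommGroup W] [Module ℂ W] (N : F.CoimageRep I W)
    (f : V →ₗ[ℂ] W) (ξ : V) (hf : ∀ y, f (M.rep y ξ) = N.rep y (f ξ)) (x : F.fullDual I) :
    f (M.dualRep x ξ) = N.dualRep x (f ξ) := by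
  obtain ⟨y, h1, h2⟩ := ((M.eventually_rep_eq_dualRep x ξ).and
    (N.eventually_rep_eq_dualRep x (f ξ))).exists
  rw [← h1, hf, h2]

end CoimageRep

/-- The evaluation of functionals on `C` at an element of `I`. -/
noncomputable def evalI (y : I) : F.fullDual I := (F.dualEquiv I).symm ((F.pairC I).flip y)

@[simp] lemma dualEquiv_evalI (y : I) (c : F.coimage I) :
    F.dualEquiv I (F.evalI I y) c = F.pairC I c y := by
  simp [evalI]

variable {I F} in
lemma CoimageRep.dualRep_evalI (M : F.CoimageRep I V) (y : I) (ξ : V) :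
    M.dualRep (F.evalI I y) ξ = M.rep y ξ := by
  rw [← M.slice_coaction]
  change TensorProduct.rid ℂ V ((F.dualEquiv I (F.evalI I y)).lTensor V (M.coaction ξ)) = _
  generalize M.coaction ξ = z
  induction z with
  | zero => simp
  | add a b ha hb => simp only [map_add, ha, hb]
  | tmul v c => simp

/-- The regular representation of `I` on `C`. -/
noncomputable def regular : F.CoimageRep I (F.coimage I) where
  rep := AlgHom.ofLinearMap
    { toFun := fun y => slice (F.pairC I) y ∘ₗ comul
      map_add' := fun y y' => LinearMap.ext fun c => (sliceHom (F.pairC I) (comul c)).map_add y y'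
      map_smul' := fun t y => LinearMap.ext fun c =>
        (sliceHom (F.pairC I) (comul c)).map_smul t y }
    (by
      ext c
      apply F.pairC_injective I
      ext y
      change F.pairC I (slice (F.pairC I) 1 (comul (R := ℂ) _)) y = _
      rw [pairC_comul, mul_one]
      rfl)
    (fun y y' => by
      apply LinearMap.ext
      intro c
      apply F.pairC_injective I
      ext z
      change F.pairC I (slice (F.pairC I) (y * y') (comul (R := ℂ) _)) z =
        F.pairC I (slice (F.pairC I) y (comul (R := ℂ) (slice (F.pairC I) y' (comul (R := ℂ) _)))) z
      rw [pairC_comul, pairC_comul, pairC_comul, mul_assoc])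
  coaction := comul
  slice_coaction c y := rfl

lemma pairC_regular (y z : I) (c : F.coimage I) :
    F.pairC I ((F.regular I).rep y c) z = F.pairC I c (z * y) :=
  F.pairC_comul I c z y

lemma dualEquiv_regular (x x' : F.fullDual I) (c : F.coimage I) :
    F.dualEquiv I x ((F.regular I).dualRep x' c) = F.dualEquiv I (x * x') c := by
  change F.dualEquiv I x (TensorProduct.rid ℂ _ ((F.dualEquiv I x').lTensor _ (comul c))) = _
  rw [F.dualEquiv_mul I x x' c (ℛ ℂ c), ← (ℛ ℂ c).eq]
  simp [mul_comm]

end RepFamily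

end Approximation

end DrinfeldCoideal

/-! ### Extension of the representation from `D(B, I)` to the double of `B` and the full dual. -/

namespace DrinfeldCoideal

open Coalgebra HopfAlgebra WithConv Filter

universe u v w

namespace Double

variable {B R : Type*} [Ring B] [Algebra ℂ B] [StarRing B] [StarModule ℂ B]
  [Ring R] [Algebra ℂ R] [StarRing R] [StarModule ℂ R] {T : R → B → B ⊗[ℂ] R}

/-- The universal property of the double. -/
noncomputable def lift {A : Type*} [Ring A] [Algebra ℂ A] (f : B →ₐ[ℂ] A) (g : R →ₐ[ℂ] A)
    (h : ∀ (x : R) (b : B) (n : ℕ) (b' : Fin n → B) (x' : Fin n → R),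
      T x b = ∑ i, b' i ⊗ₜ[ℂ] x' i → g x * f b = ∑ i, f (b' i) * g (x' i))
    (h_star : ∀ (x : R) (b : B) (n : ℕ) (b' : Fin n → B) (x' : Fin n → R),
      T x b = ∑ i, b' i ⊗ₜ[ℂ] x' i →
        f (star b) * g (star x) = ∑ i, g (star (x' i)) * f (star (b' i))) :
    Double T →ₐ[ℂ] A :=
  RingQuot.liftAlgHom ℂ ⟨FreeAlgebra.lift ℂ (Sum.elim f g), by
    intro p q hpq
    induction hpq with
    | interchange x b n b' x' e => simpa using h x b n b' x' e
    | interchange_star x b n b' x' e => simpa using h_star x b n b' x' e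
    | _ => simp⟩

section

variable {A : Type*} [Ring A] [Algebra ℂ A] (f : B →ₐ[ℂ] A) (g : R →ₐ[ℂ] A)
    (h : ∀ (x : R) (b : B) (n : ℕ) (b' : Fin n → B) (x' : Fin n → R),
      T x b = ∑ i, b' i ⊗ₜ[ℂ] x' i → g x * f b = ∑ i, f (b' i) * g (x' i))
    (h_star : ∀ (x : R) (b : B) (n : ℕ) (b' : Fin n → B) (x' : Fin n → R),
      T x b = ∑ i, b' i ⊗ₜ[ℂ] x' i →
        f (star b) * g (star x) = ∑ i, g (star (x' i)) * f (star (b' i)))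

lemma lift_inl (b : B) : lift f g h h_star (inl T b) = f b :=
  (RingQuot.liftAlgHom_mkAlgHom_apply _ _ _ _).trans (by simp)

lemma lift_inr (x : R) : lift f g h h_star (inr T x) = g x :=
  (RingQuot.liftAlgHom_mkAlgHom_apply _ _ _ _).trans (by simp)

end

lemma inr_mul_inl_eq (x : R) (b : B) : inr T x * inl T b =
    LinearMap.mul' ℂ _ (TensorProduct.map (inl T).toLinearMap (inr T).toLinearMap (T x b)) := by
  obtain ⟨n, p, q, h⟩ := TensorProduct.exists_sum_tmul_eq (T x b)
  rw [inr_mul_inl h, h]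
  simp

end Double

section

variable {U : Type u} [Ring U] [HopfAlgebra ℂ U] [StarRing U] [StarModule ℂ U]
  [HopfStarAlgebra U] {I : StarSubalgebra ℂ U} [IsLeftCoideal I] {F : RepFamily.{u, v, w} U}

namespace RepFamily

variable {H : Type*} [NormedAddCommGroup H] [InnerProductSpace ℂ H]

lemma CoimageRep.inner_dualRep (M : F.CoimageRep I H)
    (hM : ∀ y v w, ⟪v, M.rep y w⟫_ℂ = ⟪M.rep (star y) v, w⟫_ℂ) (x : F.fullDual I) (v w : H) :
    ⟪v, M.dualRep x w⟫_ℂ = ⟪M.dualRep (star x) v, w⟫_ℂ := by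
  obtain ⟨y, h1, h2⟩ := ((M.eventually_rep_eq_dualRep x w).and
    ((F.tendsto_star_approx I x).eventually (M.eventually_rep_eq_dualRep (star x) v))).exists
  rw [← h1, ← h2, hM]

/-- The comodule underlying an `𝓕`-type representation of `I`. -/
noncomputable def IsCoidealFType.coimageRep {π : StarRep I H} (hπ : F.IsCoidealFType π) :
    F.CoimageRep I H where
  rep := π.toAlgHom
  coaction := hπ.coaction
  slice_coaction := hπ.slice_coaction

lemma IsCoidealFType.inner_dualRep {π : StarRep I H} (hπ : F.IsCoidealFType π)
    (x : F.fullDual I) (v w : H) :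
    ⟪v, hπ.coimageRep.dualRep x w⟫_ℂ = ⟪hπ.coimageRep.dualRep (star x) v, w⟫_ℂ :=
  hπ.coimageRep.inner_dualRep π.inner_star x v w

variable (I F) in
/-- The action `y ↦ τ(a, y₍₋₁₎) y₍₀₎` of `a ∈ A` on `I`. -/
noncomputable def coidealAct (a : F.Alg) : I →ₗ[ℂ] I :=
  (TensorProduct.lid ℂ I).toLinearMap ∘ₗ (F.pair a).rTensor I ∘ₗ coact I

/-- The map `coidealAct a` on `I` is the transpose of the action of `a` on `C`, so it is the
counterpart on `I` of `x ↦ x ◁ a`; `tendsto_coidealAct` makes this precise. -/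
lemma pairC_coidealAct (a : F.Alg) (c : F.coimage I) (y : I) :
    F.pairC I c (F.coidealAct I a y) = F.pairC I (F.act I a c) y := by
  obtain ⟨d, rfl⟩ := F.proj_surjective I c
  rw [act_proj, pairC_proj, pairC_proj, pair_mul_coideal, coidealAct]
  simp only [LinearMap.comp_apply]
  generalize coact I y = z
  induction z with
  | zero => simp
  | add p q hp hq => rw [map_add, map_add, map_add, map_add, ← hp, ← hq]; simp
  | tmul p q => simp

lemma tendsto_coidealAct (a : F.Alg) (x : F.fullDual I) :
    Tendsto (F.coidealAct I a) (F.approx I x) (F.approx I (F.rightAct I x a)) := by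
  rw [approx.eq_1 I F (F.rightAct I x a), tendsto_iInf]
  intro c
  rw [tendsto_principal]
  filter_upwards [F.eventually_approx I x (F.act I a c)] with y hy
  rw [dualEquiv_rightAct, ← hy, pairC_coidealAct]

variable (θ₀ : StarRep (F.drinfeldDouble I) H) (hF : F.IsCoidealFType (resI θ₀))

include hF in
-- The limit, as `y ∈ I` approximates `x`, of the interchange relation of `y` and `b` in `D(B, I)`.
-- The coefficients `τ(b₍₁₎, y₍₋₁₎) y₍₀₎` are the elements `coidealAct b₍₁₎ y`, which approximate `x
-- ◁ b₍₁₎`.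
lemma dualRep_inl (x : F.fullDual I) (b : F.coinv I) (n : ℕ) (b' : Fin n → F.coinv I)
    (x' : Fin n → F.fullDual I) (h : F.fullInterchange I x b = ∑ i, b' i ⊗ₜ[ℂ] x' i) (ξ : H) :
    hF.coimageRep.dualRep x (θ₀ (Double.inl _ b) ξ) =
      ∑ i, θ₀ (Double.inl _ (b' i)) (hF.coimageRep.dualRep (x' i) ξ) := by
  let Ψ : F.coinv I ⊗[ℂ] F.fullDual I →ₗ[ℂ] H := LinearMap.applyₗ ξ ∘ₗ LinearMap.mul' ℂ _ ∘ₗ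
    TensorProduct.map (θ₀.toAlgHom.toLinearMap ∘ₗ (Double.inl _).toLinearMap)
      hF.coimageRep.dualRep.toLinearMap
  have hΨ : ∀ b x, Ψ (b ⊗ₜ x) = θ₀ (Double.inl _ b) (hF.coimageRep.dualRep x ξ) :=
    fun b x => rfl
  let Θ : F.coinv I ⊗[ℂ] I →ₗ[ℂ] H := LinearMap.applyₗ ξ ∘ₗ θ₀.toAlgHom.toLinearMap ∘ₗ
    LinearMap.mul' ℂ _ ∘ₗ TensorProduct.map (Double.inl (F.interchange I)).toLinearMap
      (Double.inr (F.interchange I)).toLinearMap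
  have hΘ : ∀ b y, Θ (b ⊗ₜ y) = θ₀ (Double.inl _ b) (hF.coimageRep.rep y ξ) := by
    intro b y
    change θ₀ (Double.inl _ b * Double.inr _ y) ξ = _
    rw [map_mul]
    rfl
  have h1 : ∀ z : F.coinv I ⊗[ℂ] F.Alg, ∀ᶠ y in F.approx I x,
      Θ ((sliceHom F.pair z).rTensor I (coact I y)) =
        Ψ ((F.rightAct I x).lTensor (F.coinv I) z) := by
    intro z
    induction z with
    | zero =>
      have : sliceHom F.pair (0 : F.coinv I ⊗[ℂ] F.Alg) = 0 := by ext; simp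
      simp [this]
    | add p q hp hq =>
      have : sliceHom F.pair (p + q) = sliceHom F.pair p + sliceHom F.pair q := by ext; simp
      filter_upwards [hp, hq] with y hp hq
      rw [this, LinearMap.rTensor_add, LinearMap.add_apply, map_add, hp, hq, map_add, map_add]
    | tmul b a =>
      have h2 : ∀ w : U ⊗[ℂ] I, (sliceHom F.pair (b ⊗ₜ[ℂ] a)).rTensor I w =
          b ⊗ₜ[ℂ] TensorProduct.lid ℂ I ((F.pair a).rTensor I w) := by
        intro w
        induction w with
        | zero => simp
        | add p q hp hq => simp only [map_add, hp, hq, TensorProduct.tmul_add]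
        | tmul p q => simp [TensorProduct.smul_tmul]
      filter_upwards [(F.tendsto_coidealAct a x).eventually
        (hF.coimageRep.eventually_rep_eq_dualRep (F.rightAct I x a) ξ)] with y hy
      rw [h2, hΘ, LinearMap.lTensor_tmul, hΨ, ← hy]
      rfl
  -- One element of `I` that stands for `x` on both sides: at the vector `b ξ` on the left, and
  -- through its coaction at `ξ` on the right.
  obtain ⟨y, h3, h4⟩ := ((h1 (F.coactB I b)).and
    (hF.coimageRep.eventually_rep_eq_dualRep x (θ₀ (Double.inl _ b) ξ))).exists
  have h5 : Ψ (F.fullInterchange I x b) =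
      ∑ i, θ₀ (Double.inl _ (b' i)) (hF.coimageRep.dualRep (x' i) ξ) := by
    rw [h, map_sum]
    rfl
  rw [← h4, ← h5, fullInterchange, ← h3]
  change (θ₀ (Double.inr _ y) * θ₀ (Double.inl _ b)) ξ = _
  rw [← map_mul, Double.inr_mul_inl_eq]
  rfl

lemma inner_inl (b : F.coinv I) (v w : H) :
    ⟪v, θ₀ (Double.inl _ b) w⟫_ℂ = ⟪θ₀ (Double.inl _ (star b)) v, w⟫_ℂ := by
  rw [θ₀.inner_star, Double.star_inl]

include hF in
-- The formal adjoint of `dualRep_inl`: moving every factor across the inner product reduces it to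
-- that relation. It is required because `Double` also imposes the starred relations.
lemma inl_star_dualRep_star (x : F.fullDual I) (b : F.coinv I) (n : ℕ) (b' : Fin n → F.coinv I)
    (x' : Fin n → F.fullDual I) (h : F.fullInterchange I x b = ∑ i, b' i ⊗ₜ[ℂ] x' i) (ξ : H) :
    θ₀ (Double.inl _ (star b)) (hF.coimageRep.dualRep (star x) ξ) =
      ∑ i, hF.coimageRep.dualRep (star (x' i)) (θ₀ (Double.inl _ (star (b' i))) ξ) := by
  refine ext_inner_left ℂ fun v => ?_
  rw [inner_inl, hF.inner_dualRep, star_star, star_star, dualRep_inl θ₀ hF x b n b' x' h,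
    sum_inner, inner_sum]
  refine Finset.sum_congr rfl fun i _ => ?_
  rw [hF.inner_dualRep, star_star, inner_inl, star_star]

/-- The action of the double of `B` and the full dual of `C` associated to an `𝓕`-type
representation of `D(B, I)`. -/
noncomputable def fullHom : F.fullDouble I →ₐ[ℂ] Module.End ℂ H :=
  Double.lift (θ₀.toAlgHom.comp (Double.inl _)) hF.coimageRep.dualRep
    (fun x b n b' x' h => LinearMap.ext fun ξ =>
      (dualRep_inl θ₀ hF x b n b' x' h ξ).trans (by rw [LinearMap.sum_apply]; rfl))
    (fun x b n b' x' h => LinearMap.ext fun ξ =>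
      (inl_star_dualRep_star θ₀ hF x b n b' x' h ξ).trans (by rw [LinearMap.sum_apply]; rfl))

lemma fullHom_inl (b : F.coinv I) : fullHom θ₀ hF (Double.inl _ b) = θ₀ (Double.inl _ b) :=
  Double.lift_inl _ _ _ _ b

lemma fullHom_inr (x : F.fullDual I) :
    fullHom θ₀ hF (Double.inr _ x) = hF.coimageRep.dualRep x :=
  Double.lift_inr _ _ _ _ x

/-- The `*`-representation of the double of `B` and the full dual of `C` associated to an
`𝓕`-type representation of `D(B, I)`. -/
noncomputable def fullRep : StarRep (F.fullDouble I) H where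
  toAlgHom := fullHom θ₀ hF
  inner_star d := by
    induction d using Double.induction with
    | hl b =>
      intro v w
      rw [Double.star_inl, fullHom_inl, fullHom_inl, inner_inl]
    | hr x =>
      intro v w
      rw [Double.star_inr, fullHom_inr, fullHom_inr, hF.inner_dualRep]
    | hadd p q hp hq =>
      intro v w
      rw [star_add, map_add, map_add, LinearMap.add_apply, LinearMap.add_apply, inner_add_left,
        inner_add_right, hp, hq]
    | hmul p q hp hq =>
      intro v w
      rw [star_mul, map_mul, map_mul, Module.End.mul_apply, Module.End.mul_apply, hp, hq]

lemma fullRep_inl (b : F.coinv I) : fullRep θ₀ hF (Double.inl _ b) = θ₀ (Double.inl _ b) :=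
  fullHom_inl θ₀ hF b

lemma fullRep_inr (x : F.fullDual I) :
    fullRep θ₀ hF (Double.inr _ x) = hF.coimageRep.dualRep x :=
  fullHom_inr θ₀ hF x

end RepFamily

end

end DrinfeldCoideal

/-! ### Semisimplicity from invariant inner products, and finite-dimensionality of Hom spaces. -/

namespace DrinfeldCoideal

section StarModules

/-- A finitely generated semisimple module is a finite direct sum of simple submodules, and a
homomorphism is determined by its restrictions to them. -/
lemma finiteDimensional_hom_of_simple {R : Type*} [Ring R] {H : Type*} [AddCommGroup H]
    [Module ℂ H] [Module R H] [SMulCommClass R ℂ H] {M : Type*} [AddCommGroup M] [Module R M]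
    [IsSemisimpleModule R M] [Module.Finite R M]
    (hM : ∀ S : Submodule R M, IsSimpleModule R S → FiniteDimensional ℂ (S →ₗ[R] H)) :
    FiniteDimensional ℂ (M →ₗ[R] H) := by
  obtain ⟨n, S, e, hS⟩ := IsSemisimpleModule.exists_linearEquiv_fin_dfinsupp R M
  have := fun i => hM (S i) (hS i)
  let σ : ∀ i, S i →ₗ[R] M := fun i => e.symm.toLinearMap ∘ₗ
    DFinsupp.lsingle (R := R) (M := fun i => S i) i
  let Φ : (M →ₗ[R] H) →ₗ[ℂ] ∀ i, (S i →ₗ[R] H) :=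
    { toFun := fun f i => f ∘ₗ σ i
      map_add' := fun f g => rfl
      map_smul' := fun c f => rfl }
  refine FiniteDimensional.of_injective Φ fun f g hfg => ?_
  have h : f ∘ₗ e.symm.toLinearMap = g ∘ₗ e.symm.toLinearMap :=
    DFinsupp.lhom_ext' fun i => congrFun hfg i
  ext m
  simpa using LinearMap.congr_fun h (e m)

/-- Here finite multiplicity is known only for simple submodules of `H`. A simple submodule of `M`
embeds in a power of `H`, so some coordinate is nonzero on it, hence injective by simplicity; this
identifies it with a submodule of `H`. -/
lemma finiteDimensional_hom_of_injective_pi {R : Type*} [Ring R] {H : Type*} [AddCommGroup H]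
    [Module ℂ H] [Module R H] [SMulCommClass R ℂ H] [IsSemisimpleModule R H]
    (hH : ∀ S : Submodule R H, IsSimpleModule R S → FiniteDimensional ℂ (S →ₗ[R] H))
    {M : Type*} [AddCommGroup M] [Module R M] [Module.Finite R M] {t : Type*} [Finite t]
    (j : M →ₗ[R] (t → H)) (hj : Function.Injective j) : FiniteDimensional ℂ (M →ₗ[R] H) := by
  have : IsSemisimpleModule R M := IsSemisimpleModule.of_injective j hj
  refine finiteDimensional_hom_of_simple fun S hS => ?_
  have := IsSimpleModule.nontrivial R S
  obtain ⟨s, hs⟩ := exists_ne (0 : S)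
  have h1 : j s.1 ≠ 0 := fun h => hs (Subtype.ext (hj (h.trans (map_zero j).symm)))
  obtain ⟨ξ, hξ⟩ := Function.ne_iff.1 h1
  let p : S →ₗ[R] H := LinearMap.proj ξ ∘ₗ j ∘ₗ S.subtype
  have hp : Function.Injective p := by
    refine (LinearMap.injective_or_eq_zero p).resolve_right fun h => hξ ?_
    exact LinearMap.congr_fun h s
  let e : S ≃ₗ[R] LinearMap.range p := LinearEquiv.ofInjective p hp
  have : IsSimpleModule R (LinearMap.range p) := IsSimpleModule.congr e.symm
  have := hH (LinearMap.range p) this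
  let Φ : (S →ₗ[R] H) →ₗ[ℂ] (LinearMap.range p →ₗ[R] H) :=
    { toFun := fun f => f ∘ₗ e.symm.toLinearMap
      map_add' := fun f g => rfl
      map_smul' := fun c f => rfl }
  refine FiniteDimensional.of_injective Φ fun f f' hff => ?_
  ext m
  simpa [Φ] using LinearMap.congr_fun hff (e m)

variable {R : Type*} [Ring R] [Algebra ℂ R]

section Semisimple

variable [StarRing R] {G : Type*} [NormedAddCommGroup G]
  [InnerProductSpace ℂ G] [Module R G] [IsScalarTower ℂ R G]

/-- The orthogonal complement of a submodule, as a submodule. -/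
def orthogonalSubmodule (hstar : ∀ (x : R) (v w : G), ⟪v, x • w⟫_ℂ = ⟪star x • v, w⟫_ℂ)
    (N : Submodule R G) : Submodule R G where
  carrier := {v | ∀ p ∈ N, ⟪p, v⟫_ℂ = 0}
  add_mem' := fun ha hb p hp => by rw [inner_add_right, ha p hp, hb p hp, add_zero]
  zero_mem' := fun p _ => inner_zero_right p
  smul_mem' := fun x v hv p hp => by rw [hstar, hv _ (N.smul_mem _ hp)]

/-- The orthogonal complement of a submodule is a submodule by invariance of the inner product. -/
lemma isSemisimpleModule_of_finiteDimensional_sub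
    (hstar : ∀ (x : R) (v w : G), ⟪v, x • w⟫_ℂ = ⟪star x • v, w⟫_ℂ) (N : Submodule R G)
    [FiniteDimensional ℂ (N.restrictScalars ℂ)] : IsSemisimpleModule R N := by
  rw [isSemisimpleModule_iff]
  refine ⟨fun P => ⟨(orthogonalSubmodule hstar (P.map N.subtype)).comap N.subtype, ?_, ?_⟩⟩
  · rw [Submodule.disjoint_def]
    intro v hv hv'
    have := hv' v.1 ⟨v, hv, rfl⟩
    exact Subtype.ext (inner_self_eq_zero.1 this)
  · rw [codisjoint_iff, eq_top_iff]
    rintro v -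
    let Q : Submodule ℂ G := (P.map N.subtype).restrictScalars ℂ
    have hQN : Q ≤ N.restrictScalars ℂ := by
      rintro _ ⟨p, _, rfl⟩
      exact p.2
    have : FiniteDimensional ℂ Q := Submodule.finiteDimensional_of_le hQN
    -- Orthogonal projection onto `Q` exists because `Q` is finite-dimensional; the ambient space
    -- need not be complete.
    obtain ⟨q, ⟨p, hp, rfl⟩, q', hq', hv⟩ := Q.exists_add_mem_mem_orthogonal v.1
    have h1 : v = p + (v - p) := by abel
    rw [h1]
    refine Submodule.add_mem_sup hp ?_
    have h2 : (v - p).1 = q' := by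
      change v.1 - p.1 = q'
      rw [hv]
      simp
    change (v - p).1 ∈ orthogonalSubmodule hstar (P.map N.subtype)
    rw [h2]
    exact fun r hr => (Q.mem_orthogonal q').1 hq' r hr

/-- The module is the sum of its cyclic submodules, each of which is semisimple. -/
lemma isSemisimpleModule_of_star
    (hstar : ∀ (x : R) (v w : G), ⟪v, x • w⟫_ℂ = ⟪star x • v, w⟫_ℂ)
    (hfd : ∀ v : G, FiniteDimensional ℂ ((Submodule.span R {v}).restrictScalars ℂ)) :
    IsSemisimpleModule R G := by
  refine isSemisimpleModule_of_isSemisimpleModule_submodule'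
    (p := fun v : G => Submodule.span R {v})
    (fun v => isSemisimpleModule_of_finiteDimensional_sub hstar _) ?_
  rw [eq_top_iff]
  exact fun v _ => Submodule.mem_iSup_of_mem v (Submodule.mem_span_singleton_self v)

end Semisimple

section FiniteMultiplicity

variable {H : Type*} [AddCommGroup H] [Module ℂ H] [Module R H] [IsScalarTower ℂ R H]
  [SMulCommClass R ℂ H]

/-- `M` is not assumed semisimple, but every homomorphism to `H` factors through the quotient of `M`
by the common kernel of all of them. That quotient embeds in a finite power of `H`, where the
previous lemma applies. -/
lemma finiteDimensional_hom [IsSemisimpleModule R H]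
    (hH : ∀ S : Submodule R H, IsSimpleModule R S → FiniteDimensional ℂ (S →ₗ[R] H))
    (M : Type*) [AddCommGroup M] [Module ℂ M] [Module R M] [IsScalarTower ℂ R M]
    [FiniteDimensional ℂ M] : FiniteDimensional ℂ (M →ₗ[R] H) := by
  have : Module.Finite R M := Module.Finite.of_restrictScalars_finite ℂ R M
  -- By the descending chain condition on subspaces of `M`, finitely many homomorphisms already cut
  -- out the common kernel.
  obtain ⟨t, ht⟩ := Finset.exists_inf_le
    fun f : M →ₗ[R] H => LinearMap.ker (f.restrictScalars ℂ)
  let g : M →ₗ[R] (t → H) := LinearMap.pi fun f => f.1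
  have hg : ∀ (f : M →ₗ[R] H), LinearMap.ker g ≤ LinearMap.ker f := by
    intro f m hm
    refine ht f ((Submodule.mem_finsetInf).2 fun f' hf' => ?_)
    exact congrFun (LinearMap.mem_ker.1 hm) ⟨f', hf'⟩
  have := finiteDimensional_hom_of_injective_pi hH ((LinearMap.ker g).liftQ g le_rfl)
    (LinearMap.ker_eq_bot.1 (Submodule.ker_liftQ_eq_bot' _ _ rfl))
  let Φ : ((M ⧸ LinearMap.ker g) →ₗ[R] H) →ₗ[ℂ] (M →ₗ[R] H) :=
    { toFun := fun f => f ∘ₗ (LinearMap.ker g).mkQ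
      map_add' := fun f g => rfl
      map_smul' := fun c f => rfl }
  exact FiniteDimensional.of_surjective Φ fun f =>
    ⟨(LinearMap.ker g).liftQ f (hg f), Submodule.liftQ_mkQ _ _ _⟩

/-- A finite-dimensional module has finite-dimensional image in a semisimple module with finite
multiplicities. -/
lemma exists_finiteDimensional_forall_hom_mem [IsSemisimpleModule R H]
    (hH : ∀ S : Submodule R H, IsSimpleModule R S → FiniteDimensional ℂ (S →ₗ[R] H))
    (M : Type*) [AddCommGroup M] [Module ℂ M] [Module R M] [IsScalarTower ℂ R M]
    [FiniteDimensional ℂ M] :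
    ∃ W : Submodule ℂ H, FiniteDimensional ℂ W ∧ ∀ (f : M →ₗ[R] H) m, f m ∈ W := by
  have := finiteDimensional_hom hH M
  let β : (M →ₗ[R] H) →ₗ[ℂ] M →ₗ[ℂ] H := LinearMap.mk₂ ℂ (fun f m => f m)
    (fun _ _ _ => rfl) (fun _ _ _ => rfl) (fun f m m' => map_add f m m')
    (fun c f m => f.map_smul_of_tower c m)
  -- The image of evaluation on the tensor product of two finite-dimensional spaces.
  exact ⟨LinearMap.range (TensorProduct.lift β), inferInstance, fun f m => ⟨f ⊗ₜ m, rfl⟩⟩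

end FiniteMultiplicity

end StarModules

end DrinfeldCoideal

/-! ### Finite rank of the elements of the restricted dual under admissibility. -/

namespace DrinfeldCoideal

open Coalgebra HopfAlgebra WithConv Filter

universe u v w

section FiniteRank

variable {U : Type u} [Ring U] [HopfAlgebra ℂ U] [StarRing U] [StarModule ℂ U]
  [HopfStarAlgebra U] {I : StarSubalgebra ℂ U} [IsLeftCoideal I] {F : RepFamily.{u, v, w} U}

namespace RepFamily

namespace CoimageRep

variable {V : Type*} [AddCommGroup V] [Module ℂ V] (M : F.CoimageRep I V)

/-- The module over the full dual of `C` underlying a `C`-comodule. -/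
@[reducible] noncomputable def module : Module (F.fullDual I) V :=
  Module.compHom V M.dualRep.toRingHom

lemma smul_eq (x : F.fullDual I) (v : V) : letI := M.module; x • v = M.dualRep x v := rfl

lemma isScalarTower : letI := M.module; IsScalarTower ℂ (F.fullDual I) V :=
  letI := M.module
  ⟨fun c x v => by rw [M.smul_eq, M.smul_eq, map_smul]; rfl⟩

lemma smulCommClass : letI := M.module; SMulCommClass (F.fullDual I) ℂ V :=
  letI := M.module
  ⟨fun x c v => by rw [M.smul_eq, M.smul_eq, map_smul]⟩

end CoimageRep

variable {H : Type*} [NormedAddCommGroup H] [InnerProductSpace ℂ H]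
  {π : StarRep I H} (hπ : F.IsCoidealFType π)

lemma IsCoidealFType.isSemisimpleModule :
    letI := hπ.coimageRep.module; IsSemisimpleModule (F.fullDual I) H := by
  let := hπ.coimageRep.module
  have := hπ.coimageRep.isScalarTower
  refine isSemisimpleModule_of_star hπ.inner_dualRep fun ξ => ?_
  have := (hπ ξ).1
  refine Submodule.finiteDimensional_of_le (S₂ := π.cyclic ξ) ?_
  intro v hv
  obtain ⟨x, rfl⟩ := Submodule.mem_span_singleton.1 hv
  obtain ⟨y, hy⟩ := hπ.coimageRep.exists_rep_eq_dualRep x ξ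
  exact ⟨y, hy.symm⟩

/-- Transfers admissibility from `I` to the full dual: both have the same stable subspaces, and
linear maps over the full dual intertwine `I` because `evalI` embeds its action. -/
lemma IsCoidealFType.finiteDimensional_hom_of_isSimpleModule (hadm : π.HasFiniteMultiplicities) :
    letI := hπ.coimageRep.module
    haveI := hπ.coimageRep.smulCommClass
    ∀ S : Submodule (F.fullDual I) H, IsSimpleModule (F.fullDual I) S →
      FiniteDimensional ℂ (S →ₗ[F.fullDual I] H) := by
  let := hπ.coimageRep.module
  have := hπ.coimageRep.isScalarTower
  have := hπ.coimageRep.smulCommClass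
  intro S hS
  have hmem : ∀ y v, π y v = F.evalI I y • v := fun y v =>
    (hπ.coimageRep.dualRep_evalI y v).symm
  have hS' := isSimpleModule_iff_isAtom.1 hS
  have hirr : π.IsIrreducibleSub (S.restrictScalars ℂ) := by
    refine ⟨fun h => hS'.1 ?_, fun y v hv => ?_, fun W' hW' hst => ?_⟩
    · rwa [Submodule.restrictScalars_eq_bot_iff] at h
    · rw [hmem]
      exact S.smul_mem _ hv
    · let T : Submodule (F.fullDual I) H :=
        { W' with
          smul_mem' := fun x v hv => by
            obtain ⟨y, hy⟩ := hπ.coimageRep.exists_rep_eq_dualRep x v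
            rw [hπ.coimageRep.smul_eq, hy]
            exact hst y v hv }
      have hT : T.restrictScalars ℂ = W' := rfl
      rcases hS'.le_iff.1 (show T ≤ S from hW') with h | h
      · exact Or.inl (by rw [← hT, h]; rfl)
      · exact Or.inr (by rw [← hT, h])
  have := hadm _ hirr
  let Φ : (S →ₗ[F.fullDual I] H) →ₗ[ℂ] π.intertwiners (S.restrictScalars ℂ) :=
    { toFun := fun f => ⟨f.restrictScalars ℂ, fun y v w h => by
        have h1 : w = F.evalI I y • v := Subtype.ext (h.trans (hmem y v))
        rw [h1, hmem]
        exact f.map_smul _ _⟩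
      map_add' := fun f g => rfl
      map_smul' := fun c f => rfl }
  refine FiniteDimensional.of_injective Φ fun f g h => ?_
  ext v
  exact LinearMap.congr_fun (congrArg Subtype.val h) v

/-- The elements of the restricted dual of `C` act by finite rank operators. -/
lemma IsCoidealFType.finiteDimensional_range (hadm : π.HasFiniteMultiplicities)
    {x : F.fullDual I} (hx : x ∈ F.restrictedDual I) :
    FiniteDimensional ℂ (LinearMap.range (hπ.coimageRep.dualRep x)) := by
  let := hπ.coimageRep.module
  have := hπ.coimageRep.isScalarTower
  have := hπ.coimageRep.smulCommClass
  have := hπ.isSemisimpleModule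
  -- The space spanned by the `p * x * q` is a left ideal, and its finite dimension is exactly the
  -- definition of the restricted dual.
  let L : Submodule (F.fullDual I) (F.fullDual I) :=
    { F.bimod I x with
      smul_mem' := fun y v hv => by
        change v ∈ F.bimod I x at hv
        change y * v ∈ F.bimod I x
        induction hv using Submodule.span_induction with
        | mem v hv =>
          obtain ⟨p, q, rfl⟩ := hv
          exact Submodule.subset_span ⟨y * p, q, by simp [mul_assoc]⟩
        | zero => simp
        | add p q _ _ hp hq => rw [mul_add]; exact add_mem hp hq
        | smul c p _ hp => rw [mul_smul_comm]; exact Submodule.smul_mem _ _ hp }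
  have hL : FiniteDimensional ℂ L := hx
  obtain ⟨W, hW, h⟩ := exists_finiteDimensional_forall_hom_mem
    (hπ.finiteDimensional_hom_of_isSimpleModule hadm) L
  refine Submodule.finiteDimensional_of_le (S₂ := W) ?_
  rintro _ ⟨ξ, rfl⟩
  -- The vector `x ξ` is the value at `x = 1 * x * 1` of the module map `z ↦ z ξ` from `L` to `H`,
  -- so it lies in `W`, which does not depend on `ξ`.
  exact h ((LinearMap.toSpanSingleton _ H ξ) ∘ₗ L.subtype)
    ⟨x, Submodule.subset_span ⟨1, 1, by simp⟩⟩

lemma finiteDimensional_range_fullRep (θ₀ : StarRep (F.drinfeldDouble I) H)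
    (hF : F.IsCoidealFType (resI θ₀)) (hadm : (resI θ₀).HasFiniteMultiplicities)
    {d : F.fullDouble I} (hd : d ∈ F.restrictedSpan I) :
    FiniteDimensional ℂ (LinearMap.range (fullRep θ₀ hF d)) := by
  induction hd using Submodule.span_induction with
  | mem d hd =>
    obtain ⟨b, x, hx, rfl⟩ := hd
    have := hF.finiteDimensional_range hadm hx
    rw [map_mul, fullRep_inr, Module.End.mul_eq_comp, LinearMap.range_comp]
    infer_instance
  | zero => rw [map_zero, LinearMap.range_zero]; infer_instance
  | add p q _ _ hp hq =>
    rw [map_add]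
    exact Submodule.finiteDimensional_of_le (LinearMap.range_add_le _ _)
  | smul c p _ hp =>
    rw [map_smul]
    refine Submodule.finiteDimensional_of_le (S₂ := LinearMap.range (fullRep θ₀ hF p)) ?_
    rintro _ ⟨v, rfl⟩
    exact ⟨c • v, by simp⟩

end RepFamily

end FiniteRank

end DrinfeldCoideal

/-! ### Spanning `A` by entries of unitary matrices, with unitarizable contragredients. -/

namespace DrinfeldCoideal

open Coalgebra HopfAlgebra WithConv Filter

universe u v w

section UnitaryCoeffs

variable {U : Type u} [Ring U] [HopfAlgebra ℂ U] [StarRing U] [StarModule ℂ U]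

namespace RepFamily

/-- The matrix of a finite-dimensional unitary representation of `U` with entries in `A`, in an
orthonormal basis that diagonalises the operator implementing the square of the antipode. -/
structure UnitaryCoeffs (F : RepFamily.{u, v, w} U) where
  n : Type
  [fintype : Fintype n]
  [decidableEq : DecidableEq n]
  entry : n → n → WithConv (U →ₗ[ℂ] ℂ)
  mem : ∀ i j, entry i j ∈ F.matAlg
  entry_one : ∀ i j, entry i j 1 = if i = j then 1 else 0
  entry_mul : ∀ i j x y, entry i j (x * y) = ∑ k, entry i k x * entry k j y
  entry_star : ∀ i j x, entry i j (star x) = conj (entry j i x)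
  weight : n → ℝ
  weight_pos : ∀ i, 0 < weight i
  antipode_sq : ∀ i j x, entry i j (antipode ℂ (antipode ℂ x)) =
    (weight i : ℂ) / (weight j : ℂ) * entry i j x

attribute [instance] UnitaryCoeffs.fintype UnitaryCoeffs.decidableEq

variable (F : RepFamily.{u, v, w} U)

/-- The set of entries of unitary matrices. -/
def unitaryEntries : Set (WithConv (U →ₗ[ℂ] ℂ)) :=
  {f | ∃ (u : F.UnitaryCoeffs) (i j : u.n), f = u.entry i j}

/-- Expand `ξ` and `η` in an orthonormal eigenbasis of the positive operator `T`; in that basis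
conjugation by `T` multiplies the entry `i j` by a quotient of eigenvalues, which supplies the
weights. -/
lemma coeff_mem_span_unitaryEntries (k : F.ι) (ξ η : F.space k) :
    (F.rep k).coeff ξ η ∈ Submodule.span ℂ F.unitaryEntries := by
  obtain ⟨T, hT, hTS⟩ := F.antipodeSq_compatible k
  let e := hT.isSymmetric.eigenvectorBasis rfl
  let t := hT.isSymmetric.eigenvalues rfl
  have hte : ∀ i, (T : Module.End ℂ (F.space k)) (e i) = (t i : ℂ) • e i :=
    hT.isSymmetric.apply_eigenvectorBasis rfl
  have hinv : ∀ v, (↑T⁻¹ : Module.End ℂ (F.space k)) ((T : Module.End ℂ (F.space k)) v) = v :=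
    fun v => by rw [← Module.End.mul_apply, T.inv_mul]; rfl
  have ht0 : ∀ i, t i ≠ 0 := by
    intro i h
    have h1 := hinv (e i)
    rw [hte, h, Complex.ofReal_zero, zero_smul, map_zero] at h1
    exact e.toBasis.ne_zero i (by simpa using h1.symm)
  have hte' : ∀ i, (↑T⁻¹ : Module.End ℂ (F.space k)) (e i) = (t i : ℂ)⁻¹ • e i := by
    intro i
    have h1 := congrArg (fun v => (t i : ℂ)⁻¹ • v) (hinv (e i))
    simp only [hte, map_smul] at h1
    rwa [inv_smul_smul₀ (Complex.ofReal_ne_zero.2 (ht0 i))] at h1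
  let u : F.UnitaryCoeffs :=
    { n := Fin (Module.finrank ℂ (F.space k))
      entry := fun i j => (F.rep k).coeff (e i) (e j)
      mem := fun i j => F.coeff_mem _ _ _
      entry_one := fun i j => by
        simp [orthonormal_iff_ite.1 e.orthonormal]
      entry_mul := fun i j x y => by
        simp only [StarRep.coeff_apply, map_mul, Module.End.mul_apply]
        conv_lhs => rw [← e.sum_repr' ((F.rep k) y (e j))]
        simp [mul_comm]
      entry_star := fun i j x => by
        rw [StarRep.coeff_apply, StarRep.coeff_apply, inner_conj_symm, (F.rep k).inner_star,
          star_star]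
      weight := t
      weight_pos := fun i => lt_of_le_of_ne (hT.nonneg_eigenvalues rfl i) (ht0 i).symm
      antipode_sq := fun i j x => by
        rw [StarRep.coeff_apply, StarRep.coeff_apply, hTS, Module.End.mul_apply,
          Module.End.mul_apply, hte', map_smul, map_smul, inner_smul_right, ← hT.isSymmetric,
          hte, inner_smul_left, Complex.conj_ofReal]
        ring }
  have h : (F.rep k).coeff ξ η = ∑ i, ∑ j, (⟪ξ, e i⟫_ℂ * ⟪e j, η⟫_ℂ) • u.entry i j := by
    ext x
    let φ : WithConv (U →ₗ[ℂ] ℂ) →ₗ[ℂ] ℂ :=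
      LinearMap.applyₗ x ∘ₗ (WithConv.linearEquiv ℂ (U →ₗ[ℂ] ℂ)).toLinearMap
    change ⟪ξ, F.rep k x η⟫_ℂ = φ (∑ i, ∑ j, (⟪ξ, e i⟫_ℂ * ⟪e j, η⟫_ℂ) • u.entry i j)
    simp only [map_sum, map_smul]
    rw [← e.sum_inner_mul_inner]
    refine Finset.sum_congr rfl fun i _ => ?_
    conv_lhs => rw [← e.sum_repr' η]
    rw [map_sum, inner_sum, Finset.mul_sum]
    refine Finset.sum_congr rfl fun j _ => ?_
    change _ = (⟪ξ, e i⟫_ℂ * ⟪e j, η⟫_ℂ) * ⟪e i, F.rep k x (e j)⟫_ℂ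
    rw [map_smul, inner_smul_right, mul_assoc]
  rw [h]
  exact Submodule.sum_mem _ fun i _ => Submodule.sum_mem _ fun j _ =>
    Submodule.smul_mem _ _ (Submodule.subset_span ⟨u, i, j, rfl⟩)

variable {F}

/-- The trivial representation. -/
noncomputable def UnitaryCoeffs.triv [HopfStarAlgebra U] : F.UnitaryCoeffs where
  n := Unit
  entry _ _ := 1
  mem _ _ := one_mem _
  entry_one _ _ := Bialgebra.counit_one
  entry_mul _ _ x y := by
    rw [Finset.univ_unique, Finset.sum_singleton]
    exact Bialgebra.counit_mul x y
  entry_star _ _ x := counit_star x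
  weight _ := 1
  weight_pos _ := one_pos
  antipode_sq _ _ x := by
    change counit (R := ℂ) (antipode ℂ (antipode ℂ x)) = _ * counit (R := ℂ) x
    simp

/-- A Sweedler representation of the unit. -/
def reprOne : Coalgebra.Repr ℂ (1 : U) Unit where
  index := Finset.univ
  left _ := 1
  right _ := 1
  eq := by simp [Algebra.TensorProduct.one_def]

/-- The tensor product of unitary representations. -/
noncomputable def UnitaryCoeffs.prod [HopfStarAlgebra U] (u u' : F.UnitaryCoeffs) :
    F.UnitaryCoeffs where
  n := u.n × u'.n
  entry i j := u.entry i.1 j.1 * u'.entry i.2 j.2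
  mem i j := mul_mem (u.mem _ _) (u'.mem _ _)
  entry_one i j := by
    rw [reprOne.convMul_apply]
    simp [reprOne, u.entry_one, u'.entry_one, Prod.ext_iff, ite_and]
    split_ifs <;> rfl
  entry_mul i j x y := by
    rw [((ℛ ℂ x).mul (ℛ ℂ y)).convMul_apply]
    simp only [(ℛ ℂ x).convMul_apply, (ℛ ℂ y).convMul_apply]
    have h : ∀ p q r s : U, u.entry i.1 j.1 (p * q) * u'.entry i.2 j.2 (r * s) =
        ∑ k : u.n × u'.n, u.entry i.1 k.1 p * u.entry k.1 j.1 q *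
          (u'.entry i.2 k.2 r * u'.entry k.2 j.2 s) := by
      intro p q r s
      rw [u.entry_mul, u'.entry_mul, Finset.sum_mul_sum, Fintype.sum_prod_type]
    simp only [Coalgebra.Repr.mul_index, Coalgebra.Repr.mul_left, Coalgebra.Repr.mul_right, h]
    rw [Finset.sum_comm]
    refine Finset.sum_congr rfl fun k _ => ?_
    rw [Finset.sum_mul_sum, Finset.sum_product]
    exact Finset.sum_congr rfl fun a _ => Finset.sum_congr rfl fun b _ => by ring
  entry_star i j x := by
    rw [(ℛ ℂ x).convMul_apply, (reprStar (ℛ ℂ x)).convMul_apply]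
    simp [reprStar, u.entry_star, u'.entry_star]
  weight i := u.weight i.1 * u'.weight i.2
  weight_pos i := mul_pos (u.weight_pos _) (u'.weight_pos _)
  antipode_sq i j x := by
    rw [(ℛ ℂ x).convMul_apply, (reprAntipode (reprAntipode (ℛ ℂ x))).convMul_apply,
      Finset.mul_sum]
    refine Finset.sum_congr rfl fun k _ => ?_
    simp only [reprAntipode, u.antipode_sq, u'.antipode_sq]
    push_cast
    ring

/-- The contragredient of a unitary representation. -/
noncomputable def UnitaryCoeffs.contragredient [HopfStarAlgebra U] (u : F.UnitaryCoeffs) :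
    F.UnitaryCoeffs :=
  -- The transposed matrix composed with the antipode is unitary only after conjugation by the
  -- square root of the weights: comparing it with its adjoint produces a square of the antipode,
  -- hence a factor `weight i / weight j`, which has to be shared equally between the two sides.
  let s : u.n → ℂ := fun i => (Real.sqrt (u.weight i) : ℂ)
  have hs : ∀ i, s i ≠ 0 := fun i =>
    Complex.ofReal_ne_zero.2 (Real.sqrt_pos.2 (u.weight_pos i)).ne'
  have hss : ∀ i, (u.weight i : ℂ) = s i * s i := fun i => by
    rw [← Complex.ofReal_mul, Real.mul_self_sqrt (u.weight_pos i).le]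
  have hval : ∀ i j x, ((s i / s j) • dualStar (u.entry i j)) x =
      s i / s j * u.entry j i (antipode ℂ x) := fun i j x => by
    change s i / s j * dualStar (u.entry i j) x = _
    rw [dualStar_apply, u.entry_star, Complex.conj_conj]
  { n := u.n
    entry := fun i j => (s i / s j) • dualStar (u.entry i j)
    mem := fun i j => Subalgebra.smul_mem _ (F.dualStar_mem (u.mem i j)) _
    entry_one := fun i j => by
      rw [hval, antipode_one, u.entry_one]
      rcases eq_or_ne i j with rfl | h
      · simp [hs]
      · simp [h, h.symm]
    entry_mul := fun i j x y => by
      simp only [hval, antipode_mul_antidistrib, u.entry_mul, Finset.mul_sum]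
      refine Finset.sum_congr rfl fun k _ => ?_
      have := hs k
      field_simp
    entry_star := fun i j x => by
      rw [hval, hval, map_mul, map_div₀, Complex.conj_ofReal, Complex.conj_ofReal]
      -- Writing `x` as `S(S(x*)*)` creates the square of the antipode to which `antipode_sq`
      -- applies.
      conv_rhs => rw [← antipode_star_antipode_star x]
      rw [u.antipode_sq, u.entry_star, map_mul, Complex.conj_conj, map_div₀, Complex.conj_ofReal,
        Complex.conj_ofReal, hss, hss]
      have := hs i
      have := hs j
      change s i / s j * _ = s j / s i * _
      field_simp
    weight := fun i => (u.weight i)⁻¹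
    weight_pos := fun i => inv_pos.2 (u.weight_pos i)
    antipode_sq := fun i j x => by
      rw [hval, hval, u.antipode_sq]
      push_cast
      rw [inv_div_inv]
      ring }

variable (F) in
/-- The span of the entries of unitary matrices, as a subalgebra. -/
noncomputable def unitarySpan [HopfStarAlgebra U] : Subalgebra ℂ (WithConv (U →ₗ[ℂ] ℂ)) :=
  (Submodule.span ℂ F.unitaryEntries).toSubalgebra
    (Submodule.subset_span ⟨UnitaryCoeffs.triv, (), (), rfl⟩)
    (fun f g hf hg => by
      have h := Submodule.mul_mem_mul hf hg
      rw [Submodule.span_mul_span] at h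
      refine Submodule.span_mono ?_ h
      rintro _ ⟨_, ⟨u, i, j, rfl⟩, _, ⟨u', i', j', rfl⟩, rfl⟩
      exact ⟨u.prod u', (i, i'), (j, j'), rfl⟩)

/-- Up to a nonzero scalar, the adjoint of an entry is an entry of the contragredient. With
`unitarySpan` being an algebra, this is what minimality of `matAlg` requires. -/
lemma dualStar_mem_unitarySpan [HopfStarAlgebra U] {f : WithConv (U →ₗ[ℂ] ℂ)}
    (hf : f ∈ F.unitarySpan) : dualStar f ∈ F.unitarySpan := by
  change f ∈ Submodule.span ℂ F.unitaryEntries at hf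
  change dualStar f ∈ Submodule.span ℂ F.unitaryEntries
  induction hf using Submodule.span_induction with
  | mem f hf =>
    obtain ⟨u, i, j, rfl⟩ := hf
    have hs : ∀ i, (Real.sqrt (u.weight i) : ℂ) ≠ 0 := fun i =>
      Complex.ofReal_ne_zero.2 (Real.sqrt_pos.2 (u.weight_pos i)).ne'
    have h : dualStar (u.entry i j) = ((Real.sqrt (u.weight j) : ℂ) / (Real.sqrt (u.weight i) : ℂ)) •
        u.contragredient.entry i j := by
      change _ = _ • (((Real.sqrt (u.weight i) : ℂ) / (Real.sqrt (u.weight j) : ℂ)) •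
        dualStar (u.entry i j))
      rw [smul_smul, div_mul_div_cancel₀ (hs i), div_self (hs j), one_smul]
    rw [h]
    exact Submodule.smul_mem _ _ (Submodule.subset_span ⟨u.contragredient, i, j, rfl⟩)
  | zero =>
    have : dualStar (0 : WithConv (U →ₗ[ℂ] ℂ)) = 0 := by
      have := dualStar_smul (U := U) 0 0
      simpa using this
    rw [this]
    exact zero_mem _
  | add p q _ _ hp hq => rw [dualStar_add]; exact add_mem hp hq
  | smul c p _ hp => rw [dualStar_smul]; exact Submodule.smul_mem _ _ hp

/-- The algebra `A` is spanned by the entries of unitary matrices. -/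
lemma matAlg_le_unitarySpan [HopfStarAlgebra U] : F.matAlg ≤ F.unitarySpan := by
  refine sInf_le ⟨?_, fun f hf => dualStar_mem_unitarySpan hf⟩
  rintro _ ⟨k, ξ, η, rfl⟩
  exact F.coeff_mem_span_unitaryEntries k ξ η

end RepFamily

end UnitaryCoeffs

end DrinfeldCoideal

/-! ### Cosemisimplicity of `C` and local units in its restricted dual. -/

namespace DrinfeldCoideal

open Coalgebra HopfAlgebra WithConv Filter

universe u v w

set_option linter.unusedSectionVars false

/-- Fully invariant submodules of a semisimple module correspond to sets of isotypic components, and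
sets have complements. For the regular module on `C`, full invariance includes stability under
translations from the other side, so it yields subcoalgebras. -/
lemma exists_isCompl_isFullyInvariant {R M : Type*} [Ring R] [AddCommGroup M] [Module R M]
    [IsSemisimpleModule R M] {N : Submodule R M} (hN : N.IsFullyInvariant) :
    ∃ N' : Submodule R M, N'.IsFullyInvariant ∧ IsCompl N N' := by
  have h : ComplementedLattice (fullyInvariantSubmodule R M) :=
    OrderIso.setIsotypicComponents.complementedLattice
  obtain ⟨N', hN', hc⟩ := CompleteSublattice.isComplemented_iff.1 h N hN
  exact ⟨N', hN', hc⟩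

section Cosemisimple

variable {U : Type u} [Ring U] [HopfAlgebra ℂ U] [StarRing U] [StarModule ℂ U]
  [HopfStarAlgebra U] {I : StarSubalgebra ℂ U} [IsLeftCoideal I] {F : RepFamily.{u, v, w} U}

namespace RepFamily

namespace UnitaryCoeffs

variable (I) (u : F.UnitaryCoeffs)

/-- The image in `C` of an entry of a unitary matrix. -/
noncomputable def entryC (i j : u.n) : F.coimage I := F.proj I (F.ofMem _ (u.mem i j))

lemma pairC_entryC (i j : u.n) (y : I) : F.pairC I (u.entryC I i j) y = u.entry i j y := rfl

/-- The action of `I` by a unitary matrix. -/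
noncomputable def act : I →ₐ[ℂ] Module.End ℂ (EuclideanSpace ℂ u.n) := AlgHom.ofLinearMap
  { toFun := fun y =>
      { toFun := fun v => WithLp.toLp 2 fun i => ∑ j, u.entry i j y * v j
        map_add' := fun v w => by ext; simp [mul_add, Finset.sum_add_distrib]
        map_smul' := fun c v => by ext; simp [Finset.mul_sum, mul_left_comm] }
    map_add' := fun y y' => by ext; simp [add_mul, Finset.sum_add_distrib]
    map_smul' := fun c y => by ext; simp [Finset.mul_sum, mul_assoc] }
  (by ext; simp [u.entry_one])
  (fun y y' => by
    ext v i
    simp only [LinearMap.coe_mk, AddHom.coe_mk, Module.End.mul_apply, MulMemClass.coe_mul,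
      u.entry_mul, Finset.sum_mul, Finset.mul_sum]
    rw [Finset.sum_comm]
    simp only [mul_assoc])

@[simp] lemma act_apply (y : I) (v : EuclideanSpace ℂ u.n) (i : u.n) :
    u.act I y v i = ∑ j, u.entry i j y * v j := rfl

/-- The `C`-comodule given by a unitary matrix. -/
noncomputable def coimageRep : F.CoimageRep I (EuclideanSpace ℂ u.n) where
  rep := u.act I
  coaction := ∑ i, ∑ j, TensorProduct.mk ℂ _ _ (EuclideanSpace.single i 1) ∘ₗ
    (LinearMap.toSpanSingleton ℂ _ (u.entryC I i j)) ∘ₗ (EuclideanSpace.proj j).toLinearMap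
  slice_coaction v y := by
    ext i
    simp only [LinearMap.sum_apply, map_sum, LinearMap.comp_apply, TensorProduct.mk_apply,
      slice_tmul, LinearMap.toSpanSingleton_apply, map_smul, pairC_entryC,
      WithLp.ofLp_sum, Finset.sum_apply]
    rw [Finset.sum_eq_single i]
    · simp [act, mul_comm]
    · intro k _ hk
      simp [hk.symm]
    · simp

lemma inner_act (y : I) (v w : EuclideanSpace ℂ u.n) :
    ⟪v, u.act I y w⟫_ℂ = ⟪u.act I (star y) v, w⟫_ℂ := by
  simp only [PiLp.inner_apply, act_apply, RCLike.inner_apply, map_sum, map_mul,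
    StarMemClass.coe_star, u.entry_star, Complex.conj_conj, Finset.sum_mul, Finset.mul_sum]
  rw [Finset.sum_comm]
  exact Finset.sum_congr rfl fun i _ => Finset.sum_congr rfl fun j _ => by ring

lemma isSemisimpleModule : letI := (u.coimageRep I).module;
    IsSemisimpleModule (F.fullDual I) (EuclideanSpace ℂ u.n) := by
  let := (u.coimageRep I).module
  have := (u.coimageRep I).isScalarTower
  exact isSemisimpleModule_of_star ((u.coimageRep I).inner_dualRep (u.inner_act I))
    fun ξ => inferInstance

/-- Dual form of `Δ(uᵢⱼ) = ∑ uᵢₖ ⊗ uₖⱼ`: the entries of one row span a stable subspace of `C`. -/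
lemma regular_entryC (i j : u.n) (y : I) :
    (F.regular I).rep y (u.entryC I i j) = ∑ k, u.entry k j y • u.entryC I i k := by
  apply F.pairC_injective I
  ext z
  rw [pairC_regular, pairC_entryC]
  simp [u.entry_mul, pairC_entryC, mul_comm]

/-- The comodule map to `C` given by a row of a unitary matrix. -/
noncomputable def rowMap (i : u.n) : EuclideanSpace ℂ u.n →ₗ[ℂ] F.coimage I :=
  ∑ j, LinearMap.toSpanSingleton ℂ _ (u.entryC I i j) ∘ₗ (EuclideanSpace.proj j).toLinearMap

lemma rowMap_apply (i : u.n) (v : EuclideanSpace ℂ u.n) :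
    u.rowMap I i v = ∑ j, v j • u.entryC I i j := by
  simp [rowMap]

lemma rowMap_rep (i : u.n) (y : I) (v : EuclideanSpace ℂ u.n) :
    u.rowMap I i ((u.coimageRep I).rep y v) = (F.regular I).rep y (u.rowMap I i v) := by
  rw [rowMap_apply, rowMap_apply]
  simp only [map_sum, map_smul, regular_entryC, Finset.smul_sum]
  rw [Finset.sum_comm]
  refine Finset.sum_congr rfl fun k _ => ?_
  change (∑ j, u.entry k j y * v j) • _ = _
  rw [Finset.sum_smul]
  exact Finset.sum_congr rfl fun j _ => by rw [smul_smul, mul_comm]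

end UnitaryCoeffs

lemma coimage_induction {P : F.coimage I → Prop}
    (hentry : ∀ (u : F.UnitaryCoeffs) i j, P (u.entryC I i j))
    (hzero : P 0) (hadd : ∀ c d, P c → P d → P (c + d)) (hsmul : ∀ (t : ℂ) c, P c → P (t • c))
    (c : F.coimage I) : P c := by
  obtain ⟨a, rfl⟩ := F.proj_surjective I c
  have h : ∀ f ∈ Submodule.span ℂ F.unitaryEntries,
      ∃ hf : f ∈ F.matAlg, P (F.proj I (F.ofMem f hf)) := by
    intro f hf
    induction hf using Submodule.span_induction with
    | mem f hf =>
      obtain ⟨u, i, j, rfl⟩ := hf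
      exact ⟨u.mem i j, hentry u i j⟩
    | zero => exact ⟨zero_mem _, hzero⟩
    | add f g _ _ hf hg =>
      obtain ⟨hf, hf'⟩ := hf
      obtain ⟨hg, hg'⟩ := hg
      exact ⟨add_mem hf hg, hadd _ _ hf' hg'⟩
    | smul t f _ hf =>
      obtain ⟨hf, hf'⟩ := hf
      exact ⟨Subalgebra.smul_mem _ hf t, hsmul t _ hf'⟩
  exact (h (F.val a) (matAlg_le_unitarySpan (F.val_mem a))).2

variable (I F)

/-- The regular module of the full dual of `C` on `C`. -/
noncomputable instance : Module (F.fullDual I) (F.coimage I) := (F.regular I).module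

instance : IsScalarTower ℂ (F.fullDual I) (F.coimage I) := (F.regular I).isScalarTower

lemma fullDual_smul_def (x : F.fullDual I) (c : F.coimage I) :
    x • c = (F.regular I).dualRep x c := rfl

lemma evalI_smul (y : I) (c : F.coimage I) : F.evalI I y • c = (F.regular I).rep y c :=
  (F.regular I).dualRep_evalI y c

/-- The coalgebra `C` is cosemisimple. -/
instance : IsSemisimpleModule (F.fullDual I) (F.coimage I) := by
  -- The rows of all unitary matrices: each is the image of a semisimple module under `rowMap`, and
  -- together they span `C`.
  let f : (Σ u : F.UnitaryCoeffs, u.n) → Submodule (F.fullDual I) (F.coimage I) := fun p =>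
    let := (p.1.coimageRep I).module
    LinearMap.range (
      { p.1.rowMap I p.2 with
        map_smul' := fun x v =>
          (p.1.coimageRep I).map_dualRep (F.regular I) (p.1.rowMap I p.2) v
            (fun y => p.1.rowMap_rep I p.2 y v) x } :
      EuclideanSpace ℂ p.1.n →ₗ[F.fullDual I] F.coimage I)
  have hf : ∀ p, IsSemisimpleModule (F.fullDual I) (f p) := fun p => by
    let := (p.1.coimageRep I).module
    have := p.1.isSemisimpleModule I
    exact IsSemisimpleModule.range _
  refine isSemisimpleModule_of_isSemisimpleModule_submodule' hf ?_
  rw [eq_top_iff]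
  rintro c -
  induction c using coimage_induction with
  | hentry u i j =>
    refine Submodule.mem_iSup_of_mem ⟨u, i⟩ ⟨EuclideanSpace.single j 1, ?_⟩
    change u.rowMap I i _ = _
    simp [u.rowMap_apply I]
  | hzero => exact zero_mem _
  | hadd c d hc hd => exact add_mem hc hd
  | hsmul t c hc => exact Submodule.smul_of_tower_mem _ t hc

variable {I F}

/-- The span of the entries of a unitary matrix in `C`. -/
noncomputable def UnitaryCoeffs.spanC (I : StarSubalgebra ℂ U) [IsLeftCoideal I] (u : F.UnitaryCoeffs) :
    Submodule (F.fullDual I) (F.coimage I) :=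
  { Submodule.span ℂ (Set.range fun p : u.n × u.n => u.entryC I p.1 p.2) with
    smul_mem' := fun x c hc => by
      have h : (Submodule.span ℂ (Set.range fun p : u.n × u.n => u.entryC I p.1 p.2)).map
          ((F.regular I).dualRep x) ≤
          Submodule.span ℂ (Set.range fun p : u.n × u.n => u.entryC I p.1 p.2) := by
        rw [Submodule.map_span_le]
        rintro _ ⟨p, rfl⟩
        obtain ⟨y, hy⟩ := (F.regular I).exists_rep_eq_dualRep x (u.entryC I p.1 p.2)
        rw [hy, u.regular_entryC I]
        exact Submodule.sum_mem _ fun k _ => Submodule.smul_mem _ _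
          (Submodule.subset_span ⟨(p.1, k), rfl⟩)
      exact h ⟨c, hc, rfl⟩ }

lemma UnitaryCoeffs.restrictScalars_spanC (u : F.UnitaryCoeffs) :
    (u.spanC I).restrictScalars ℂ =
      Submodule.span ℂ (Set.range fun p : u.n × u.n => u.entryC I p.1 p.2) := rfl

lemma UnitaryCoeffs.entryC_mem_spanC (u : F.UnitaryCoeffs) (i j : u.n) :
    u.entryC I i j ∈ u.spanC I :=
  Submodule.subset_span (R := ℂ) ⟨(i, j), rfl⟩

/-- An endomorphism `f` of the regular module is determined by the functional "value of `f` at `1`":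
it is translation by that functional, which replaces the row of an entry by a combination of rows
with the same column. -/
lemma UnitaryCoeffs.isFullyInvariant_spanC (u : F.UnitaryCoeffs) :
    (u.spanC I).IsFullyInvariant := by
  intro f
  have h : Submodule.span ℂ (Set.range fun p : u.n × u.n => u.entryC I p.1 p.2) ≤
      ((u.spanC I).comap f).restrictScalars ℂ := by
    rw [Submodule.span_le]
    rintro _ ⟨⟨i, j⟩, rfl⟩
    have h1 : f (u.entryC I i j) =
        ∑ k, F.pairC I (f (u.entryC I i k)) 1 • u.entryC I k j := by
      apply F.pairC_injective I
      ext z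
      -- Evaluation at `z` is evaluation at `1` after acting by `z`, and `f` commutes with that
      -- action.
      have h2 : F.pairC I (f (u.entryC I i j)) z =
          F.pairC I (f (F.evalI I z • u.entryC I i j)) 1 := by
        rw [map_smul, evalI_smul, pairC_regular, one_mul]
      rw [h2, evalI_smul, u.regular_entryC I]
      simp only [map_sum, LinearMap.map_smul_of_tower, map_smul, LinearMap.sum_apply,
        LinearMap.smul_apply, pairC_entryC, smul_eq_mul, mul_comm]
    change f (u.entryC I i j) ∈ u.spanC I
    rw [h1]
    exact Submodule.sum_mem _ fun k _ =>
      Submodule.smul_of_tower_mem _ _ (u.entryC_mem_spanC k j)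
  exact h

/-- Every element of `C` lies in a finite-dimensional subcoalgebra. -/
lemma exists_finiteDimensional_isFullyInvariant (c : F.coimage I) :
    ∃ N : Submodule (F.fullDual I) (F.coimage I),
      FiniteDimensional ℂ (N.restrictScalars ℂ) ∧ N.IsFullyInvariant ∧ c ∈ N := by
  induction c using coimage_induction with
  | hentry u i j =>
    refine ⟨u.spanC I, ?_, u.isFullyInvariant_spanC, u.entryC_mem_spanC i j⟩
    rw [u.restrictScalars_spanC]
    exact FiniteDimensional.span_of_finite ℂ (Set.finite_range _)
  | hzero => exact ⟨⊥, inferInstanceAs (FiniteDimensional ℂ (⊥ : Submodule ℂ (F.coimage I))),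
      (fullyInvariantSubmodule _ _).bot_mem, zero_mem _⟩
  | hadd c d hc hd =>
    obtain ⟨N, h1, h2, h3⟩ := hc
    obtain ⟨N', h1', h2', h3'⟩ := hd
    refine ⟨N ⊔ N', ?_, (fullyInvariantSubmodule _ _).sup_mem h2 h2',
      Submodule.add_mem_sup h3 h3'⟩
    rw [Submodule.restrictScalars_sup]
    infer_instance
  | hsmul t c hc =>
    obtain ⟨N, h1, h2, h3⟩ := hc
    exact ⟨N, h1, h2, Submodule.smul_of_tower_mem _ t h3⟩

/-- Mirror image of `dualEquiv_regular`; the two together move both outer factors of `p * x * q`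
into translations of the argument. -/
lemma dualEquiv_lid_rTensor (x x' : F.fullDual I) (c : F.coimage I) :
    F.dualEquiv I x' (TensorProduct.lid ℂ _ ((F.dualEquiv I x).rTensor _ (comul c))) =
      F.dualEquiv I (x * x') c := by
  rw [F.dualEquiv_mul I x x' c (ℛ ℂ c), ← (ℛ ℂ c).eq]
  simp

/-- The right translation of `C` by a functional, `c ↦ x(c₍₁₎) c₍₂₎`, as an endomorphism of the
regular module. -/
noncomputable def rightTranslation (x : F.fullDual I) :
    Module.End (F.fullDual I) (F.coimage I) where
  toFun c := TensorProduct.lid ℂ _ ((F.dualEquiv I x).rTensor _ (comul c))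
  map_add' := by simp
  map_smul' x' c := by
    apply F.pairC_injective I
    ext z
    rw [← dualEquiv_evalI, ← dualEquiv_evalI, dualEquiv_lid_rTensor, RingHom.id_apply,
      fullDual_smul_def, fullDual_smul_def, dualEquiv_regular, dualEquiv_regular,
      dualEquiv_lid_rTensor, mul_assoc]

lemma dualEquiv_rightTranslation (x x' : F.fullDual I) (c : F.coimage I) :
    F.dualEquiv I x' (rightTranslation x c) = F.dualEquiv I (x * x') c :=
  dualEquiv_lid_rTensor x x' c

/-- Functionals vanishing on a subcoalgebra of finite codimension lie in the restricted dual. -/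
lemma mem_restrictedDual_of_isCompl {N N' : Submodule (F.fullDual I) (F.coimage I)}
    [FiniteDimensional ℂ (N.restrictScalars ℂ)] (hN' : N'.IsFullyInvariant) (h : IsCompl N N')
    {x : F.fullDual I} (hx : ∀ c ∈ N', F.dualEquiv I x c = 0) : x ∈ F.restrictedDual I := by
  rw [mem_restrictedDual]
  -- All of `bimod x` vanishes on `N'`, so restriction to the finite-dimensional complement `N`
  -- loses nothing.
  let ρ : F.bimod I x →ₗ[ℂ] Module.Dual ℂ (N.restrictScalars ℂ) :=
    (N.restrictScalars ℂ).subtype.dualMap ∘ₗ (F.dualEquiv I).toLinearMap ∘ₗ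
      (F.bimod I x).subtype
  have hvan : ∀ z ∈ F.bimod I x, ∀ c ∈ N', F.dualEquiv I z c = 0 := by
    intro z hz
    induction hz using Submodule.span_induction with
    | mem z hz =>
      obtain ⟨p, q, rfl⟩ := hz
      intro c hc
      rw [← dualEquiv_regular, ← dualEquiv_rightTranslation]
      -- The value of `p * x * q` at `c` is that of `x` at a two-sided translate of `c`: `N'` is
      -- stable under `q` as a submodule and under `p` by full invariance.
      exact hx _ (hN' _ (N'.smul_mem q hc))
    | zero => simp
    | add p q _ _ hp hq => intro c hc; rw [map_add, LinearMap.add_apply, hp c hc, hq c hc, add_zero]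
    | smul t p _ hp => intro c hc; rw [map_smul, LinearMap.smul_apply, hp c hc, smul_zero]
  refine FiniteDimensional.of_injective ρ fun z z' hzz => ?_
  apply Subtype.ext
  apply (F.dualEquiv I).injective
  apply LinearMap.ext
  intro c
  have hc : c ∈ N ⊔ N' := by
    rw [h.sup_eq_top]
    exact Submodule.mem_top
  obtain ⟨n, hn, n', hn', rfl⟩ := Submodule.mem_sup.1 hc
  rw [map_add, map_add, hvan _ z.2 n' hn', hvan _ z'.2 n' hn', add_zero, add_zero]
  exact LinearMap.congr_fun hzz ⟨n, hn⟩

/-- The restricted dual contains local units for finite subsets of `C`. -/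
lemma exists_mem_restrictedDual_eq_counit {ι : Type*} (s : Finset ι) (c : ι → F.coimage I) :
    ∃ x ∈ F.restrictedDual I, ∀ i ∈ s, F.dualEquiv I x (c i) = counit (R := ℂ) (c i) := by
  choose N h1 h2 h3 using exists_finiteDimensional_isFullyInvariant (F := F) (I := I)
  let P : Submodule (F.fullDual I) (F.coimage I) := s.sup fun i => N (c i)
  have hP : FiniteDimensional ℂ (P.restrictScalars ℂ) ∧ P.IsFullyInvariant := by
    refine Finset.sup_induction (p := fun P : Submodule (F.fullDual I) (F.coimage I) =>
      FiniteDimensional ℂ (P.restrictScalars ℂ) ∧ P.IsFullyInvariant) ?_ ?_ fun i _ =>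
        ⟨h1 _, h2 _⟩
    · exact ⟨inferInstanceAs (FiniteDimensional ℂ (⊥ : Submodule ℂ (F.coimage I))),
        (fullyInvariantSubmodule _ _).bot_mem⟩
    · rintro P ⟨hP, hP'⟩ Q ⟨hQ, hQ'⟩
      refine ⟨?_, (fullyInvariantSubmodule _ _).sup_mem hP' hQ'⟩
      rw [Submodule.restrictScalars_sup]
      infer_instance
  have := hP.1
  obtain ⟨P', hP', hc⟩ := exists_isCompl_isFullyInvariant hP.2
  have hcℂ : IsCompl (P.restrictScalars ℂ) (P'.restrictScalars ℂ) := by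
    rw [isCompl_iff, disjoint_iff, codisjoint_iff, ← Submodule.restrictScalars_inf,
      ← Submodule.restrictScalars_sup, hc.inf_eq_bot, hc.sup_eq_top]
    exact ⟨rfl, rfl⟩
  -- The counit on `P`, extended by zero on the complementary subcoalgebra `P'`.
  let x : F.fullDual I := (F.dualEquiv I).symm
    (counit ∘ₗ (P.restrictScalars ℂ).subtype ∘ₗ Submodule.projectionOnto _ _ hcℂ)
  refine ⟨x, mem_restrictedDual_of_isCompl hP' hc fun c hc => ?_, fun i hi => ?_⟩
  · simp only [x, LinearEquiv.apply_symm_apply, LinearMap.comp_apply]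
    rw [Submodule.projectionOnto_apply_of_mem_right hcℂ hc, map_zero, map_zero]
  · have hi' : c i ∈ P := Finset.le_sup (f := fun i => N (c i)) hi (h3 _)
    have := Submodule.projectionOnto_apply_left hcℂ ⟨c i, hi'⟩
    simp only [x, LinearEquiv.apply_symm_apply, LinearMap.comp_apply]
    rw [this]
    rfl

/-- The restricted dual acts non-degenerately on any `C`-comodule. -/
lemma CoimageRep.exists_dualRep_eq_self {V : Type*} [AddCommGroup V] [Module ℂ V]
    (M : F.CoimageRep I V) (ξ : V) : ∃ x ∈ F.restrictedDual I, M.dualRep x ξ = ξ := by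
  obtain ⟨n, p, q, h⟩ := TensorProduct.exists_sum_tmul_eq (M.coaction ξ)
  obtain ⟨x, hx, hx'⟩ := exists_mem_restrictedDual_eq_counit Finset.univ q
  refine ⟨x, hx, ?_⟩
  -- The unit of `I` pairs with `C` as the counit, which `x` imitates on the finitely many elements
  -- of `C` occurring in `δ(ξ)`.
  have h1 : M.rep 1 ξ = ξ := by simp
  conv_rhs => rw [← h1, ← M.slice_coaction, h]
  change TensorProduct.rid ℂ V ((F.dualEquiv I x).lTensor V (M.coaction ξ)) = _
  rw [h]
  simp only [map_sum]
  refine Finset.sum_congr rfl fun i hi => ?_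
  simp [hx' i hi, counitC_eq]

end RepFamily

end Cosemisimple

end DrinfeldCoideal

/-! ### Bounded operators on the completion, and comparison of the two notions of irreducibility. -/

namespace DrinfeldCoideal

open Coalgebra HopfAlgebra WithConv Filter UniformSpace

universe u v w

section Completion

variable {H : Type*} [NormedAddCommGroup H] [InnerProductSpace ℂ H]

/-- In an orthonormal basis of the range, the coefficients of `T v` are `⟪T' eₖ, v⟫`, which are
continuous in `v`. The adjoint is essential: finite rank alone does not bound an operator on a
pre-Hilbert space. -/
lemma continuous_of_finiteDimensional_range {T T' : H →ₗ[ℂ] H}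
    (h : ∀ v w, ⟪v, T w⟫_ℂ = ⟪T' v, w⟫_ℂ) [FiniteDimensional ℂ (LinearMap.range T)] :
    Continuous T := by
  let e := stdOrthonormalBasis ℂ (LinearMap.range T)
  have h1 : ∀ v, T v = ∑ k, ⟪T' (e k : H), v⟫_ℂ • (e k : H) := by
    intro v
    have := congrArg Subtype.val (e.sum_repr' ⟨T v, v, rfl⟩)
    simpa [h] using this.symm
  rw [show (T : H → H) = fun v => ∑ k, ⟪T' (e k : H), v⟫_ℂ • (e k : H) from funext h1]
  fun_prop

lemma completion_clm_ext {S T : Completion H →L[ℂ] Completion H}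
    (h : ∀ ξ : H, S (ξ : Completion H) = T (ξ : Completion H)) : S = T :=
  ContinuousLinearMap.ext fun v => congrFun (Completion.ext S.continuous T.continuous h) v

lemma StarRep.isSimple_iff {R : Type*} [Ring R] [Algebra ℂ R] [StarRing R] (π : StarRep R H) :
    π.IsSimple ↔ Nontrivial H ∧ ∀ W : Submodule ℂ H, π.IsStable W → W = ⊥ ∨ W = ⊤ := by
  rw [StarRep.IsSimple]
  let : Module R H := Module.compHom H (π.toAlgHom : R →+* Module.End ℂ H)
  have hsmul : ∀ (x : R) (v : H), x • v = π x v := fun _ _ => rfl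
  have : IsScalarTower ℂ R H := ⟨fun c x v => by rw [hsmul, hsmul, map_smul]; rfl⟩
  constructor
  · intro h
    refine ⟨IsSimpleModule.nontrivial R H, fun W hW => ?_⟩
    let W' : Submodule R H := { W with smul_mem' := fun x v hv => hW x v hv }
    have hW' : W'.restrictScalars ℂ = W := rfl
    rcases eq_bot_or_eq_top W' with h | h
    · exact Or.inl (by rw [← hW', h]; rfl)
    · exact Or.inr (by rw [← hW', h]; rfl)
  · rintro ⟨h, h'⟩
    have : IsSimpleOrder (Submodule R H) := ⟨fun W => by
      refine (h' (W.restrictScalars ℂ) fun x v hv => W.smul_mem x hv).imp (fun h => ?_) fun h => ?_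
      · rwa [Submodule.restrictScalars_eq_bot_iff] at h
      · rwa [Submodule.restrictScalars_eq_top_iff] at h⟩
    exact (isSimpleModule_iff R H).2 this

end Completion

section Representation

variable {U : Type u} [Ring U] [HopfAlgebra ℂ U] [StarRing U] [StarModule ℂ U]
  [HopfStarAlgebra U] {I : StarSubalgebra ℂ U} [IsLeftCoideal I] {F : RepFamily.{u, v, w} U}
  {H : Type*} [NormedAddCommGroup H] [InnerProductSpace ℂ H]

namespace RepFamily

lemma restrictedDouble_induction {P : F.restrictedDouble I → Prop}
    (mk : ∀ b x, P (F.restrictedMk I b x)) (zero : P 0) (add : ∀ p q, P p → P q → P (p + q))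
    (smul : ∀ (c : ℂ) p, P p → P (c • p)) (d : F.restrictedDouble I) : P d := by
  have h : ∀ d ∈ F.restrictedSpan I, ∃ hd : d ∈ F.restrictedDouble I, P ⟨d, hd⟩ := by
    intro d hd
    induction hd using Submodule.span_induction with
    | mem d hd =>
      obtain ⟨b, x, hx, rfl⟩ := hd
      exact ⟨F.inl_mul_inr_mem I b hx, mk b ⟨x, hx⟩⟩
    | zero => exact ⟨zero_mem _, zero⟩
    | add p q _ _ hp hq => exact ⟨add_mem hp.1 hq.1, add _ _ hp.2 hq.2⟩
    | smul c p _ hp => exact ⟨(F.restrictedDouble I).smul_mem' c hp.1, smul c _ hp.2⟩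
  exact (h d.1 d.2).2

variable (θ₀ : StarRep (F.drinfeldDouble I) H) (hF : F.IsCoidealFType (resI θ₀))

lemma fullRep_restrictedMk (b : F.coinv I) (x : F.restrictedDual I) (ξ : H) :
    fullRep θ₀ hF (F.restrictedMk I b x : F.fullDouble I) ξ =
      θ₀ (Double.inl _ b) (hF.coimageRep.dualRep x ξ) := by
  change fullRep θ₀ hF (Double.inl _ b * Double.inr _ (x : F.fullDual I)) ξ = _
  rw [map_mul, fullRep_inl, fullRep_inr]
  rfl

section Existence

variable (hadm : (resI θ₀).HasFiniteMultiplicities)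

include hadm in
lemma continuous_fullRep (d : F.restrictedDouble I) :
    Continuous (fullRep θ₀ hF (d : F.fullDouble I)) := by
  have := finiteDimensional_range_fullRep θ₀ hF hadm d.2
  exact continuous_of_finiteDimensional_range ((fullRep θ₀ hF).inner_star d)

/-- The bounded operator on the completion given by an element of `𝒟(B, 𝓘)`. -/
noncomputable def completionOp (d : F.restrictedDouble I) : Completion H →L[ℂ] Completion H :=
  ContinuousLinearMap.completion
    (⟨fullRep θ₀ hF (d : F.fullDouble I), continuous_fullRep θ₀ hF hadm d⟩ : H →L[ℂ] H)

lemma completionOp_coe (d : F.restrictedDouble I) (ξ : H) :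
    completionOp θ₀ hF hadm d (ξ : Completion H) =
      ((fullRep θ₀ hF (d : F.fullDouble I) ξ : H) : Completion H) :=
  ContinuousLinearMap.completion_apply_coe _ ξ

/-- The `*`-representation of `𝒟(B, 𝓘)` by bounded operators on the completion. -/
noncomputable def completionRep :
    F.restrictedDouble I →⋆ₙₐ[ℂ] (Completion H →L[ℂ] Completion H) where
  toFun := completionOp θ₀ hF hadm
  map_smul' c d := completion_clm_ext fun ξ => by
    change _ = c • completionOp θ₀ hF hadm d ξ
    rw [completionOp_coe, completionOp_coe, ← Completion.coe_smul]
    exact congrArg _ (LinearMap.congr_fun (map_smul (fullHom θ₀ hF) c (d : F.fullDouble I)) ξ)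
  map_zero' := completion_clm_ext fun ξ => by
    rw [completionOp_coe]
    exact congrArg _ (LinearMap.congr_fun (map_zero (fullHom θ₀ hF)) ξ)
  map_add' d e := completion_clm_ext fun ξ => by
    change _ = completionOp θ₀ hF hadm d ξ + completionOp θ₀ hF hadm e ξ
    rw [completionOp_coe, completionOp_coe, completionOp_coe, ← Completion.coe_add]
    exact congrArg _ (LinearMap.congr_fun
      (map_add (fullHom θ₀ hF) (d : F.fullDouble I) (e : F.fullDouble I)) ξ)
  map_mul' d e := completion_clm_ext fun ξ => by
    change _ = completionOp θ₀ hF hadm d (completionOp θ₀ hF hadm e ξ)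
    rw [completionOp_coe, completionOp_coe, completionOp_coe]
    exact congrArg _ (LinearMap.congr_fun
      (map_mul (fullHom θ₀ hF) (d : F.fullDouble I) (e : F.fullDouble I)) ξ)
  map_star' d := by
    rw [ContinuousLinearMap.star_eq_adjoint, ContinuousLinearMap.eq_adjoint_iff]
    intro x y
    induction x, y using Completion.induction_on₂ with
    | hp => exact isClosed_eq (by fun_prop) (by fun_prop)
    | ih x y =>
      rw [completionOp_coe, completionOp_coe, Completion.inner_coe, Completion.inner_coe,
        (fullRep θ₀ hF).inner_star]
      rfl

lemma isAssociated_completionRep : IsAssociated θ₀ hF (completionRep θ₀ hF hadm) := by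
  intro b x ξ
  refine (completionOp_coe θ₀ hF hadm _ ξ).trans ?_
  rw [fullRep_restrictedMk]
  rfl

end Existence

variable {θ₀ hF} {θ : F.restrictedDouble I →⋆ₙₐ[ℂ] (Completion H →L[ℂ] Completion H)}

/-- The products `b x` span the restricted double, so the association condition fixes `θ` on the
dense subspace `H₀`; uniqueness follows by continuity. -/
lemma IsAssociated.apply_coe (hθ : IsAssociated θ₀ hF θ) (d : F.restrictedDouble I) (ξ : H) :
    θ d (ξ : Completion H) = ((fullRep θ₀ hF (d : F.fullDouble I) ξ : H) : Completion H) := by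
  induction d using restrictedDouble_induction with
  | mk b x =>
    rw [fullRep_restrictedMk]
    exact hθ b x ξ
  | zero =>
    rw [map_zero]
    change (0 : Completion H) = _
    rw [← Completion.coe_zero]
    exact (congrArg _ (LinearMap.congr_fun (map_zero (fullHom θ₀ hF)) ξ)).symm
  | add p q hp hq =>
    rw [map_add]
    change θ p ξ + θ q ξ = _
    rw [hp, hq, ← Completion.coe_add]
    exact (congrArg _ (LinearMap.congr_fun
      (map_add (fullHom θ₀ hF) (p : F.fullDouble I) (q : F.fullDouble I)) ξ)).symm
  | smul c p hp =>
    rw [map_smul]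
    change c • θ p ξ = _
    rw [hp, ← Completion.coe_smul]
    exact (congrArg _ (LinearMap.congr_fun
      (map_smul (fullHom θ₀ hF) c (p : F.fullDouble I)) ξ)).symm

/-- Stability under `D(B, I)` implies stability under the restricted double. -/
lemma fullRep_mem_of_isStable {W : Submodule ℂ H} (hW : θ₀.IsStable W) (d : F.fullDouble I) :
    ∀ ξ ∈ W, fullRep θ₀ hF d ξ ∈ W := by
  induction d using Double.induction with
  | hl b =>
    intro ξ hξ
    rw [fullRep_inl]
    exact hW _ ξ hξ
  | hr x =>
    intro ξ hξ
    obtain ⟨y, hy⟩ := hF.coimageRep.exists_rep_eq_dualRep x ξ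
    rw [fullRep_inr, hy]
    exact hW _ ξ hξ
  | hadd p q hp hq =>
    intro ξ hξ
    rw [map_add]
    exact add_mem (hp ξ hξ) (hq ξ hξ)
  | hmul p q hp hq =>
    intro ξ hξ
    rw [map_mul]
    exact hp _ (hq ξ hξ)

variable (hadm : (resI θ₀).HasFiniteMultiplicities)

include hadm in
-- The closure of a stable `W` is stable, so it is zero or everything. In the second case a finite
-- rank local unit at `ξ` upgrades density to `ξ ∈ W`.
lemma IsAssociated.isSimple (hθ : IsAssociated θ₀ hF θ) (h : IsIrreducibleRep θ) :
    θ₀.IsSimple := by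
  rw [StarRep.isSimple_iff]
  obtain ⟨hnt, hirr⟩ := h
  refine ⟨?_, fun W hW => ?_⟩
  · by_contra hsub
    rw [not_nontrivial_iff_subsingleton] at hsub
    obtain ⟨v, hv⟩ := exists_ne (0 : Completion H)
    refine hv ?_
    clear hv
    induction v using Completion.induction_on with
    | hp => exact isClosed_eq continuous_id continuous_const
    | ih ξ => rw [Subsingleton.elim ξ 0, Completion.coe_zero]
  let K : Submodule ℂ (Completion H) := W.map (Completion.toComplL (𝕜 := ℂ) (E := H)).toLinearMap
  have hcoe : ∀ ξ ∈ W, (ξ : Completion H) ∈ K.topologicalClosure := fun ξ hξ =>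
    K.le_topologicalClosure ⟨ξ, hξ, rfl⟩
  have hst : ∀ d, ∀ v ∈ K.topologicalClosure, θ d v ∈ K.topologicalClosure := by
    intro d v hv
    have h : Set.MapsTo (θ d) K K := ?_
    · exact map_mem_closure (θ d).continuous hv h
    rintro _ ⟨ξ, hξ, rfl⟩
    exact ⟨_, fullRep_mem_of_isStable (hF := hF) hW d ξ hξ, (hθ.apply_coe d ξ).symm⟩
  rcases hirr _ K.isClosed_topologicalClosure hst with h | h
  · left
    rw [eq_bot_iff]
    intro ξ hξ
    have := hcoe ξ hξ
    rw [h, Submodule.mem_bot, Completion.coe_eq_zero_iff] at this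
    exact this
  · right
    rw [eq_top_iff]
    rintro ξ -
    obtain ⟨x, hx, hxξ⟩ := hF.coimageRep.exists_dualRep_eq_self ξ
    let d := F.restrictedMk I 1 ⟨x, hx⟩
    have hd : fullRep θ₀ hF (d : F.fullDouble I) = hF.coimageRep.dualRep x := by
      change fullRep θ₀ hF (Double.inl _ 1 * Double.inr _ x) = _
      rw [map_one, one_mul, fullRep_inr]
    have := hF.finiteDimensional_range hadm hx
    -- The image of `W` under `x`. It is finite-dimensional, hence closed, so `θ d` maps even the
    -- closure of `W` into it; since `x` fixes `ξ`, this puts `ξ` in `x W`.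
    let K' : Submodule ℂ (Completion H) :=
      (W.map (hF.coimageRep.dualRep x)).map (Completion.toComplL (𝕜 := ℂ) (E := H)).toLinearMap
    have hfd : FiniteDimensional ℂ (W.map (hF.coimageRep.dualRep x)) :=
      Submodule.finiteDimensional_of_le (LinearMap.map_le_range)
    have hK' : IsClosed (K' : Set (Completion H)) := K'.closed_of_finiteDimensional
    have hmem : θ d (ξ : Completion H) ∈ K' := by
      have hξ : (ξ : Completion H) ∈ K.topologicalClosure := by
        rw [h]
        exact Submodule.mem_top
      have h2 : Set.MapsTo (θ d) K K' := ?_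
      · have h3 := map_mem_closure (θ d).continuous hξ h2
        rwa [hK'.closure_eq] at h3
      rintro _ ⟨η, hη, rfl⟩
      refine ⟨_, ⟨η, hη, rfl⟩, ?_⟩
      rw [← hd]
      exact (hθ.apply_coe d η).symm
    rw [hθ.apply_coe, hd, hxξ] at hmem
    obtain ⟨_, ⟨η, hη, rfl⟩, hη'⟩ := hmem
    have h1 : hF.coimageRep.dualRep x η = ξ := Completion.coe_injective H hη'
    rw [← h1, ← fullRep_inr θ₀]
    exact fullRep_mem_of_isStable hW _ η hη

include hadm in
-- A closed stable `V` is compared with its trace `W` on `H₀`: `W = ⊤` makes `V` dense, and `W = ⊥`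
-- forces `V` to be orthogonal to `H₀`.
lemma IsAssociated.isIrreducibleRep (hθ : IsAssociated θ₀ hF θ) (h : θ₀.IsSimple) :
    IsIrreducibleRep θ := by
  obtain ⟨hnt, hsimple⟩ := θ₀.isSimple_iff.1 h
  have hmk : ∀ b x (ξ : H), θ (F.restrictedMk I b x) (ξ : Completion H) =
      ((θ₀ (Double.inl _ b) (hF.coimageRep.dualRep x ξ) : H) : Completion H) := hθ
  refine ⟨(Completion.coe_injective H).nontrivial, fun V hV hst => ?_⟩
  let W : Submodule ℂ H := V.comap (Completion.toComplL (𝕜 := ℂ) (E := H)).toLinearMap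
  have hWmem : ∀ ξ : H, ξ ∈ W ↔ (ξ : Completion H) ∈ V := fun ξ => Iff.rfl
  -- The generator `b` need not lie in the restricted double, but `b x` does, and it acts on `ξ = x
  -- ξ` as `b`.
  have hl : ∀ b, ∀ ξ ∈ W, θ₀ (Double.inl _ b) ξ ∈ W := by
    intro b ξ hξ
    obtain ⟨x, hx, hxξ⟩ := hF.coimageRep.exists_dualRep_eq_self ξ
    have := hst (F.restrictedMk I b ⟨x, hx⟩) _ hξ
    rw [hWmem]
    change θ _ (ξ : Completion H) ∈ V at this
    rwa [hmk, hxξ] at this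
  have hr : ∀ y, ∀ ξ ∈ W, θ₀ (Double.inr _ y) ξ ∈ W := by
    intro y ξ hξ
    obtain ⟨x, hx, hxξ⟩ := hF.coimageRep.exists_dualRep_eq_self ξ
    -- The same device for `y ∈ I`: the restricted dual is an ideal, so it contains `y x`.
    have := hst (F.restrictedMk I 1 ⟨F.evalI I y * x, F.mul_mem_restrictedDual_left I hx _⟩) _ hξ
    rw [hWmem]
    change θ _ (ξ : Completion H) ∈ V at this
    rwa [hmk, map_one, map_one, map_mul, Module.End.one_apply, Module.End.mul_apply, hxξ,
      hF.coimageRep.dualRep_evalI] at this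
  have hW : θ₀.IsStable W := by
    intro d
    induction d using Double.induction with
    | hl b => exact hl b
    | hr y => exact hr y
    | hadd p q hp hq =>
      intro ξ hξ
      rw [map_add]
      exact add_mem (hp ξ hξ) (hq ξ hξ)
    | hmul p q hp hq =>
      intro ξ hξ
      rw [map_mul]
      exact hp _ (hq ξ hξ)
  rcases hsimple W hW with h | h
  · left
    rw [eq_bot_iff]
    intro v hv
    -- By finite rank, the extension of `x` to the completion still takes values in `H₀`, so it maps
    -- `V` into the trace `V ∩ H₀`, which is zero.
    have hzero : ∀ x (hx : x ∈ F.restrictedDual I), θ (F.restrictedMk I 1 ⟨x, hx⟩) v = 0 := by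
      intro x hx
      have := hF.finiteDimensional_range hadm hx
      let K : Submodule ℂ (Completion H) := (LinearMap.range (hF.coimageRep.dualRep x)).map
        (Completion.toComplL (𝕜 := ℂ) (E := H)).toLinearMap
      have hK : IsClosed (K : Set (Completion H)) := K.closed_of_finiteDimensional
      have hmem : ∀ v, θ (F.restrictedMk I 1 ⟨x, hx⟩) v ∈ K := by
        intro v
        induction v using Completion.induction_on with
        | hp => exact hK.preimage (θ (F.restrictedMk I 1 ⟨x, hx⟩)).continuous
        | ih ξ =>
          rw [hmk, map_one, map_one]
          exact ⟨_, ⟨ξ, rfl⟩, rfl⟩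
      obtain ⟨η, -, hη⟩ := hmem v
      have h1 : η ∈ W := by
        rw [hWmem]
        have h2 := hst (F.restrictedMk I 1 ⟨x, hx⟩) v hv
        rwa [← hη] at h2
      rw [h, Submodule.mem_bot] at h1
      rw [← hη, h1, map_zero]
    -- Write `ξ = x ξ` and move `x` to the other side, where its adjoint, again from the restricted
    -- dual, kills `v`.
    have horth : ∀ ξ : H, ⟪v, (ξ : Completion H)⟫_ℂ = 0 := by
      intro ξ
      obtain ⟨x, hx, hxξ⟩ := hF.coimageRep.exists_dualRep_eq_self ξ
      have h1 : star (F.restrictedMk I 1 ⟨star x, F.star_mem_restrictedDual I hx⟩) =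
          F.restrictedMk I 1 ⟨x, hx⟩ := by
        apply Subtype.ext
        change star (Double.inl _ 1 * Double.inr _ (star x)) = Double.inl _ 1 * Double.inr _ x
        rw [map_one, one_mul, one_mul, Double.star_inr, star_star]
      have h2 : θ (F.restrictedMk I 1 ⟨x, hx⟩) (ξ : Completion H) = ξ := by
        rw [hmk, map_one, map_one, Module.End.one_apply, hxξ]
      rw [← h2, ← h1, map_star, ContinuousLinearMap.star_eq_adjoint,
        ContinuousLinearMap.adjoint_inner_right, hzero, inner_zero_left]
    have : ∀ w : Completion H, ⟪v, w⟫_ℂ = 0 := by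
      intro w
      induction w using Completion.induction_on with
      | hp => exact isClosed_eq (by fun_prop) continuous_const
      | ih ξ => exact horth ξ
    exact (Submodule.mem_bot ℂ).2 (inner_self_eq_zero.1 (this v))
  · right
    rw [eq_top_iff]
    rintro v -
    induction v using Completion.induction_on with
    | hp => exact hV
    | ih ξ =>
      rw [← hWmem, h]
      exact Submodule.mem_top

end RepFamily

end Representation

end DrinfeldCoideal

theorem mainTheorem7 {U : Type*} [Ring U] [HopfAlgebra ℂ U] [StarRing U] [StarModule ℂ U]
    [HopfStarAlgebra U] (F : RepFamily U) (I : StarSubalgebra ℂ U) [IsLeftCoideal I]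
    {H₀ : Type*} [NormedAddCommGroup H₀] [InnerProductSpace ℂ H₀]
    (θ₀ : StarRep (F.drinfeldDouble I) H₀)
    (hF : F.IsCoidealFType (RepFamily.resI θ₀))
    (hadm : (RepFamily.resI θ₀).HasFiniteMultiplicities) :
    (∃! θ : F.restrictedDouble I →⋆ₙₐ[ℂ]
        (UniformSpace.Completion H₀ →L[ℂ] UniformSpace.Completion H₀),
      RepFamily.IsAssociated θ₀ hF θ) ∧
    ∀ θ : F.restrictedDouble I →⋆ₙₐ[ℂ]
        (UniformSpace.Completion H₀ →L[ℂ] UniformSpace.Completion H₀),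
      RepFamily.IsAssociated θ₀ hF θ → (IsIrreducibleRep θ ↔ θ₀.IsSimple) := by
  refine ⟨⟨RepFamily.completionRep θ₀ hF hadm,
    RepFamily.isAssociated_completionRep θ₀ hF hadm, fun θ hθ => ?_⟩, fun θ hθ =>
      ⟨hθ.isSimple hadm, hθ.isIrreducibleRep hadm⟩⟩
  ext1 d
  exact completion_clm_ext fun ξ => (hθ.apply_coe d ξ).trans
    ((RepFamily.isAssociated_completionRep θ₀ hF hadm).apply_coe d ξ).symm
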